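/- All manifolds are smooth, finite-dimensional, Hausdorff, second countable and without boundary. Let $I=[0,1]$. For a Lie algebroid $A\to M$ with anchor $\sharp$, let $P(A)$ be the space of $A$-paths, i.e. of $C^1$ curves $a:I\to A$ over a base curve $\gamma:I\to M$ with $\dot\gamma=\sharp a$, with the $C^1$ topology. Let $\pi:A_E\to A_B$ be an extension of Lie algebroids: a fibrewise surjective Lie algebroid morphism covering a surjective submersion $p:E\to B$. Let $\mathcal K=\ker\pi$, a Lie subalgebroid of $A_E$. Fix an Ehresmann connection, i.e. a smooth subbundle $H\subset A_E$ with $A_E=\mathcal K\oplus H$, and denote by $h(\alpha)\in\Gamma(H)$ the horizontal lift of $\alpha\in\Gamma(A_B)$. For an $A_B$-path $a$ over $\gamma$, extended to a time-dependent section $\alpha^t$ of $A_B$, let $\Phi^a_{t,s}:\mathcal K|_{p^{-1}(\gamma(s))}\to\mathcal K|_{p^{-1}(\gamma(t))}$ be the parallel transport, i.e. the flow from time $s$ to time $t$ of the time-dependent linear vector field on $\mathcal K$ attached to the derivation $[h(\alpha^t),\cdot\,]_{A_E}$ (it does not depend on the choice of $\alpha^t$). Assume that the connection is complete: for every $A_B$-path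 $a$ over $\gamma$, every $\kappa\in\mathcal K|_{p^{-1}(\gamma(0))}$ and every $t\in I$, $\Phi^a_{t,0}(\kappa)$ is defined. For an $A_E$-path $a$ let $a_B=\pi\circ a$, let $a_V(t)$ be the $\mathcal K$-component of $a(t)$ in $\mathcal K\oplus H$, and let $a_K(t)=\Phi^{a_B}_{0,t}(a_V(t))$. Let $P(A_B)\ltimes_B P(\mathcal K)$ be the space of pairs $(a_B,a_K)\in P(A_B)\times P(\mathcal K)$ such that the base curve of $a_K$ lies in the fibre of $p$ over the initial point of the base curve of $a_B$, with the subspace topology. Then $$P(A_E)\to P(A_B)\ltimes_B P(\mathcal K),\qquad a\mapsto(a_B,a_K)$$ is (well defined and) a homeomorphism, under which concatenation in $P(A_E)$ becomes $$(a^2_B,a^2_K)\cdot(a^1_B,a^1_K)=\bigl(a^2_B\cdot a^1_B,\ \Phi^{-1}_{a^1_B}(a^2_K)\cdot a^1_K\bigr),\qquad \Phi^{-1}_{a^1_B}(a^2_K)(t):=\Phi^{a^1_B}_{0,1}(a^2_K(t)),$$ whenever the base curve of $a^1$ ends where that of $a^2$ starts; here $\Phi^{-1}_{a^1_B}(a^2_K)$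 is a $\mathcal K$-path whose base curve starts where that of $a^1_K$ ends. The concatenation $a^2\cdot a^1$ is taken in each of the following two senses. (i) For any smooth cut-off function $\tau:\mathbb R\to\mathbb R$ ($\tau=0$ on $(-\infty,0]$, $\tau=1$ on $[1,\infty)$, $\tau'>0$ on $(0,1)$) and $a^\tau(t)=\tau'(t)\,a(\tau(t))$, it is the path equal to $2(a^1)^\tau(2t)$ for $t\le\frac12$ and to $2(a^2)^\tau(2t-1)$ for $t>\frac12$; all the concatenations in the formula are then $C^1$ paths of the respective algebroids. (ii) It is the path equal to $2a^1(2t)$ for $t\le\frac12$ and to $2a^2(2t-1)$ for $t>\frac12$, whenever this is again an $A_E$-path. -/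

import Mathlib

open scoped Manifold ContDiff Topology
open Bundle

namespace AlgebroidSplitting

noncomputable section

/-- The parameter interval `[0, 1]`, a manifold with boundary. -/
abbrev Interval : Type := Set.Icc (0 : ℝ) 1

section Algebroids

variable {EM : Type*} [NormedAddCommGroup EM] [NormedSpace ℝ EM]
  {M : Type*} [TopologicalSpace M] [ChartedSpace EM M]
  {F : Type*} [NormedAddCommGroup F] [NormedSpace ℝ F]
  {V : M → Type*} [TopologicalSpace (TotalSpace F V)] [∀ x, TopologicalSpace (V x)]
  [∀ x, AddCommGroup (V x)] [∀ x, Module ℝ (V x)] [FiberBundle F V] [VectorBundle ℝ F V]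

variable (EM F V) in
/-- Smooth sections of the vector bundle `V → M` with typical fibre `F`. -/
abbrev Sec := ContMDiffSection 𝓘(ℝ, EM) F ∞ V

/-- The product `f β` of a smooth function and a smooth section. -/
def Sec.smul (f : C^∞⟮𝓘(ℝ, EM), M; ℝ⟯) (β : Sec EM F V) : Sec EM F V :=
  ⟨fun x => f x • β x, f.contMDiff.smul_section β.contMDiff⟩

variable (EM F V) in
/-- A Lie algebroid structure on the smooth vector bundle `V → M`. -/
structure LieAlgebroid [IsManifold 𝓘(ℝ, EM) ∞ M] [ContMDiffVectorBundle ∞ F V 𝓘(ℝ, EM)] where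
  /-- The anchor `♯ : V → TM`. -/
  anchor : ∀ x : M, V x →ₗ[ℝ] TangentSpace 𝓘(ℝ, EM) x
  contMDiff_anchor : ContMDiff (𝓘(ℝ, EM).prod 𝓘(ℝ, F)) 𝓘(ℝ, EM).tangent ∞
    (fun v : TotalSpace F V => (⟨v.1, anchor v.1 v.2⟩ : TangentBundle 𝓘(ℝ, EM) M))
  /-- The bracket on smooth sections. -/
  bracket : Sec EM F V → Sec EM F V → Sec EM F V
  bracket_add : ∀ α β γ, bracket α (β + γ) = bracket α β + bracket α γ
  bracket_smul : ∀ (r : ℝ) α β, bracket α (r • β) = r • bracket α β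
  bracket_skew : ∀ α β, bracket α β = - bracket β α
  /-- `[α, f β] = f [α, β] + (L_{♯α} f) β`. -/
  leibniz : ∀ (f : C^∞⟮𝓘(ℝ, EM), M; ℝ⟯) (α β : Sec EM F V) (x : M),
    bracket α (Sec.smul f β) x = f x • bracket α β x +
      (show ℝ from mfderiv 𝓘(ℝ, EM) 𝓘(ℝ, ℝ) f x (anchor x (α x))) • β x
  anchor_bracket : ∀ (α β : Sec EM F V) (x : M), anchor x (bracket α β x) =
    VectorField.mlieBracket 𝓘(ℝ, EM) (fun y => anchor y (α y)) (fun y => anchor y (β y)) x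
  jacobi : ∀ α β γ, bracket (bracket α β) γ + bracket (bracket β γ) α
    + bracket (bracket γ α) β = 0

variable (EM F V) in
/-- Differential forms on the vector bundle `V`, i.e. smooth sections of `Λ^k V^*`. -/
structure Form (k : ℕ) where
  /-- The value of the form at each point. -/
  toFun : ∀ x : M, V x [⋀^Fin k]→ₗ[ℝ] ℝ
  contMDiff_eval : ∀ α : Fin k → Sec EM F V,
    ContMDiff 𝓘(ℝ, EM) 𝓘(ℝ, ℝ) ∞ (fun x => toFun x (fun i => α i x))

variable [IsManifold 𝓘(ℝ, EM) ∞ M] [ContMDiffVectorBundle ∞ F V 𝓘(ℝ, EM)]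

/-- The sum `∑_{i<j} (-1)^{i+j} θ([α_i, α_j], α_0, …, α̂_i, …, α̂_j, …, α_k)` at the point `x`.
For `k = m + 1`, the pairs `i < j` are written as `j = j' + 1` with `i ≤ j'`. -/
def LieAlgebroid.bracketSum (A : LieAlgebroid EM F V) : ∀ {k : ℕ}
    (_ : ∀ x : M, V x [⋀^Fin k]→ₗ[ℝ] ℝ) (_ : Fin (k + 1) → Sec EM F V) (_ : M), ℝ
  | 0, _, _, _ => 0
  | m + 1, θ, α, x => ∑ i : Fin (m + 2), ∑ j : Fin (m + 1),
      if (i : ℕ) ≤ (j : ℕ) then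
        (-1 : ℝ) ^ ((i : ℕ) + (j : ℕ) + 1) * θ x (Fin.cons (A.bracket (α i) (α j.succ) x)
          (fun l : Fin m => α (i.succAbove (j.succAbove l)) x))
      else 0

/-- The value at `x` of `⟨d_A θ, α_0, …, α_k⟩`. -/
def LieAlgebroid.d (A : LieAlgebroid EM F V) {k : ℕ} (θ : ∀ x : M, V x [⋀^Fin k]→ₗ[ℝ] ℝ)
    (α : Fin (k + 1) → Sec EM F V) (x : M) : ℝ :=
  (∑ i : Fin (k + 1), (-1 : ℝ) ^ (i : ℕ) *
    (show ℝ from mfderiv 𝓘(ℝ, EM) 𝓘(ℝ, ℝ) (fun y => θ y (fun j => α (i.succAbove j) y)) x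
      (A.anchor x (α i x)))) + A.bracketSum θ α x

/-- The vertical lift of `w ∈ V x` at `v ∈ V x`: the velocity of `s ↦ v + s w` at `s = 0`. -/
def vertLift (x : M) (v w : V x) :
    TangentSpace (𝓘(ℝ, EM).prod 𝓘(ℝ, F)) (⟨x, v⟩ : TotalSpace F V) :=
  mfderiv 𝓘(ℝ, ℝ) (𝓘(ℝ, EM).prod 𝓘(ℝ, F))
    (fun s : ℝ => (⟨x, v + s • w⟩ : TotalSpace F V)) 0 (1 : ℝ)

/-- The linear vector field on the total space which is attached to the derivation `[σ, ·]`,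
evaluated at the point `κ(x)`: it is `T_xκ (♯σ(x)) - [σ, κ](x)`, the last term being viewed as a
vertical vector. Its flow `φ` is the one for which `d/dt φ_t^* κ = φ_t^* [σ, κ]`, and its value
depends on `κ` only through `κ(x)`. -/
def LieAlgebroid.adField (A : LieAlgebroid EM F V) (σ κ : Sec EM F V) (x : M) :
    TangentBundle (𝓘(ℝ, EM).prod 𝓘(ℝ, F)) (TotalSpace F V) :=
  ⟨⟨x, κ x⟩,
    mfderiv 𝓘(ℝ, EM) (𝓘(ℝ, EM).prod 𝓘(ℝ, F)) (fun y => (⟨y, κ y⟩ : TotalSpace F V)) x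
      (A.anchor x (σ x)) - vertLift x (κ x) (A.bracket σ κ x)⟩

/-- An `A`-path: a `C^1` curve `a : [0, 1] → A` whose base curve `γ` satisfies `γ' = ♯ a`
(so that `γ` is of class `C^2`). -/
structure LieAlgebroid.Path (A : LieAlgebroid EM F V) where
  /-- The underlying curve. -/
  toFun : Interval → TotalSpace F V
  contMDiff_toFun : ContMDiff (𝓡∂ 1) (𝓘(ℝ, EM).prod 𝓘(ℝ, F)) 1 toFun
  deriv_base : ∀ t : Interval,
    mfderiv (𝓡∂ 1) 𝓘(ℝ, EM) (fun s => (toFun s).proj) t (1 : TangentSpace (𝓡∂ 1) t)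
      = A.anchor (toFun t).proj (toFun t).2

instance (A : LieAlgebroid EM F V) : CoeFun A.Path (fun _ => Interval → TotalSpace F V) :=
  ⟨LieAlgebroid.Path.toFun⟩

/-- The tangent map `Ta : T[0, 1] → TA` of an `A`-path. -/
def LieAlgebroid.Path.tangent {A : LieAlgebroid EM F V} (a : A.Path) :
    C(TangentBundle (𝓡∂ 1) Interval,
      TangentBundle (𝓘(ℝ, EM).prod 𝓘(ℝ, F)) (TotalSpace F V)) :=
  ⟨tangentMap (𝓡∂ 1) (𝓘(ℝ, EM).prod 𝓘(ℝ, F)) a.toFun,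
    a.contMDiff_toFun.continuous_tangentMap le_rfl⟩

/-- `P(A)` carries the `C^1` topology. -/
instance (A : LieAlgebroid EM F V) : TopologicalSpace A.Path :=
  TopologicalSpace.induced LieAlgebroid.Path.tangent inferInstance

end Algebroids

section Concatenation

variable {M : Type*} {F : Type*} {V : M → Type*} [∀ x, AddCommGroup (V x)] [∀ x, Module ℝ (V x)]

/-- Multiplication by the scalar `r` in the fibres of `V`. -/
def fibreSMul (r : ℝ) (v : TotalSpace F V) : TotalSpace F V := ⟨v.proj, r • v.2⟩

/-- The concatenation `a₂ · a₁` of two curves, each being first reparametrized by `τ`, that is,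
replaced by `a^τ(t) = τ'(t) a(τ(t))`: it is `2 a₁^τ(2t)` for `t ≤ 1/2` and `2 a₂^τ(2t - 1)` for
`t > 1/2`. The choice `τ = id` gives the concatenation without reparametrization. -/
def concat (τ : ℝ → ℝ) (a₂ a₁ : Interval → TotalSpace F V) (t : Interval) : TotalSpace F V :=
  if (t : ℝ) ≤ 1 / 2 then
    fibreSMul (2 * deriv τ (2 * t)) (a₁ (Set.projIcc 0 1 zero_le_one (τ (2 * t))))
  else
    fibreSMul (2 * deriv τ (2 * t - 1)) (a₂ (Set.projIcc 0 1 zero_le_one (τ (2 * t - 1))))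

/-- Cut-off functions, used as reparametrizations which make concatenations of paths `C^1`. -/
structure IsCutoff (τ : ℝ → ℝ) : Prop where
  contDiff : ContDiff ℝ ∞ τ
  eq_zero : ∀ t ≤ 0, τ t = 0
  eq_one : ∀ t, 1 ≤ t → τ t = 1
  deriv_pos : ∀ t ∈ Set.Ioo (0 : ℝ) 1, 0 < deriv τ t

end Concatenation

section Extensions

variable {EX : Type*} [NormedAddCommGroup EX] [NormedSpace ℝ EX]
  {X : Type*} [TopologicalSpace X] [ChartedSpace EX X] [IsManifold 𝓘(ℝ, EX) ∞ X]
  {FE : Type*} [NormedAddCommGroup FE] [NormedSpace ℝ FE]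
  {VE : X → Type*} [TopologicalSpace (TotalSpace FE VE)] [∀ x, TopologicalSpace (VE x)]
  [∀ x, AddCommGroup (VE x)] [∀ x, Module ℝ (VE x)] [FiberBundle FE VE] [VectorBundle ℝ FE VE]
  [ContMDiffVectorBundle ∞ FE VE 𝓘(ℝ, EX)]
  {EB : Type*} [NormedAddCommGroup EB] [NormedSpace ℝ EB]
  {B : Type*} [TopologicalSpace B] [ChartedSpace EB B] [IsManifold 𝓘(ℝ, EB) ∞ B]
  {FB : Type*} [NormedAddCommGroup FB] [NormedSpace ℝ FB]
  {VB : B → Type*} [TopologicalSpace (TotalSpace FB VB)] [∀ b, TopologicalSpace (VB b)]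
  [∀ b, AddCommGroup (VB b)] [∀ b, Module ℝ (VB b)] [FiberBundle FB VB] [VectorBundle ℝ FB VB]
  [ContMDiffVectorBundle ∞ FB VB 𝓘(ℝ, EB)]

/-- A Lie algebroid morphism `pr` covering `p`: a smooth vector bundle morphism whose pullback of
forms commutes with the differentials. The form `dθ` at `p x` is evaluated on the vectors
`pr(α_i(x))` by means of any sections `β_i` that take these values at `p x`. -/
structure IsMorphism (AE : LieAlgebroid EX FE VE) (AB : LieAlgebroid EB FB VB) (p : X → B)
    (pr : ∀ x, VE x →ₗ[ℝ] VB (p x)) : Prop where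
  contMDiff_base : ContMDiff 𝓘(ℝ, EX) 𝓘(ℝ, EB) ∞ p
  contMDiff_total : ContMDiff (𝓘(ℝ, EX).prod 𝓘(ℝ, FE)) (𝓘(ℝ, EB).prod 𝓘(ℝ, FB)) ∞
    (fun v : TotalSpace FE VE => (⟨p v.1, pr v.1 v.2⟩ : TotalSpace FB VB))
  comm_d : ∀ (k : ℕ) (θ : Form EB FB VB k) (α : Fin (k + 1) → Sec EX FE VE)
    (β : Fin (k + 1) → Sec EB FB VB) (x : X), (∀ i, β i (p x) = pr x (α i x)) →
    AE.d (fun y => (θ.toFun (p y)).compLinearMap (pr y)) α x = AB.d θ.toFun β (p x)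

/-- An extension of Lie algebroids: a fibrewise surjective Lie algebroid morphism `pr : A_E → A_B`
which covers a surjective submersion `p`. -/
structure Extension (AE : LieAlgebroid EX FE VE) (AB : LieAlgebroid EB FB VB) where
  /-- The map of base manifolds. -/
  p : X → B
  /-- The vector bundle morphism. -/
  pr : ∀ x, VE x →ₗ[ℝ] VB (p x)
  isMorphism : IsMorphism AE AB p pr
  isSubmersion : Manifold.IsSubmersion 𝓘(ℝ, EX) 𝓘(ℝ, EB) ∞ p
  surjective_p : Function.Surjective p
  surjective_pr : ∀ x, Function.Surjective (pr x)

variable {AE : LieAlgebroid EX FE VE} {AB : LieAlgebroid EB FB VB}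

/-- The map `pr` on total spaces. -/
def Extension.map (Q : Extension AE AB) (v : TotalSpace FE VE) : TotalSpace FB VB :=
  ⟨Q.p v.proj, Q.pr v.proj v.2⟩

/-- `P(K)` for the Lie subalgebroid `K = ker pr` of `A_E`, whose anchor is the restriction of the
anchor of `A_E`: the `A_E`-paths that take values in `K`. It carries the `C^1` topology (`K` being
an embedded submanifold of `A_E`). -/
def Extension.KerPath (Q : Extension AE AB) : Type _ :=
  {a : AE.Path // ∀ t, Q.pr (a t).proj (a t).2 = 0}

instance (Q : Extension AE AB) : TopologicalSpace Q.KerPath := instTopologicalSpaceSubtype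

instance (Q : Extension AE AB) : CoeFun Q.KerPath (fun _ => Interval → TotalSpace FE VE) :=
  ⟨fun a => a.1.toFun⟩

/-- `P(A_B) ⋉_B P(K)`: the pairs `(a_B, a_K)` such that the base path of `a_K` lies in the fibre
of `p` over the initial point of the base path of `a_B`. -/
def Extension.SplitPath (Q : Extension AE AB) : Type _ :=
  {q : AB.Path × Q.KerPath // ∀ t, Q.p (q.2 t).proj = (q.1 0).proj}

instance (Q : Extension AE AB) : TopologicalSpace Q.SplitPath := instTopologicalSpaceSubtype

/-- The component in `P(A_B)`. -/
def Extension.SplitPath.base {Q : Extension AE AB} (q : Q.SplitPath) : AB.Path := q.1.1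

/-- The component in `P(K)`. -/
def Extension.SplitPath.ker {Q : Extension AE AB} (q : Q.SplitPath) : Q.KerPath := q.1.2

/-- An Ehresmann connection: a smooth vector subbundle `H` of `A_E` complementary to `ker pr`. -/
structure Extension.Connection (Q : Extension AE AB) where
  /-- The horizontal distribution. -/
  H : ∀ x, Submodule ℝ (VE x)
  /-- Near every point, `H` is spanned by linearly independent smooth sections. -/
  smooth : ∀ x₀ : X, ∃ (n : ℕ) (s : Fin n → Sec EX FE VE), ∀ᶠ x in 𝓝 x₀,
    LinearIndependent ℝ (fun i => s i x) ∧ Submodule.span ℝ (Set.range fun i => s i x) = H x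
  isCompl : ∀ x, IsCompl (LinearMap.ker (Q.pr x)) (H x)

variable {Q : Extension AE AB}

/-- `σ` is the horizontal lift `h(α)` of `α`: the section of `H` that projects to `α`. -/
def Extension.Connection.IsHorizontalLift (C : Q.Connection) (σ : Sec EX FE VE)
    (α : Sec EB FB VB) : Prop :=
  ∀ x, σ x ∈ C.H x ∧ Q.pr x (σ x) = α (Q.p x)

/-- The projection `A_E = K ⊕ H → K`, so that `a_V = vert ∘ a` for an `A_E`-path `a`. -/
def Extension.Connection.vert (C : Q.Connection) (v : TotalSpace FE VE) : TotalSpace FE VE :=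
  ⟨v.proj, Submodule.projection _ _ (C.isCompl v.proj) v.2⟩

/-- `c` is an integral curve in `K`, over the base curve of `a`, of the time-dependent linear
vector field attached to `D_α = [h(α), ·]`, where `α` is any time-dependent extension of the
`A_B`-path `a`; that is, `c(t) = Φ^a_{t,s}(c(s))`. At time `t` and on the fibre over the base point
of `a(t)` this field depends on `α` only through `a(t)`, so at each time we use the sections
`α` of `A_B` that pass through `a(t)` and the sections `κ` of `K` that pass through `c(t)`. -/
structure Extension.Connection.IsParallel (C : Q.Connection) (a : Interval → TotalSpace FB VB)
    (c : Interval → TotalSpace FE VE) : Prop where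
  mdifferentiable : MDifferentiable (𝓡∂ 1) (𝓘(ℝ, EX).prod 𝓘(ℝ, FE)) c
  lies_over : ∀ t, Q.p (c t).proj = (a t).proj
  mem_ker : ∀ t, Q.pr (c t).proj (c t).2 = 0
  deriv_eq : ∀ (t : Interval) (α : Sec EB FB VB) (σ κ : Sec EX FE VE),
    C.IsHorizontalLift σ α → (∀ x, Q.pr x (κ x) = 0) →
    (⟨Q.p (c t).proj, α (Q.p (c t).proj)⟩ : TotalSpace FB VB) = a t →
    κ (c t).proj = (c t).2 →
    (⟨c t, mfderiv (𝓡∂ 1) (𝓘(ℝ, EX).prod 𝓘(ℝ, FE)) c t (1 : TangentSpace (𝓡∂ 1) t)⟩ :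
      TangentBundle (𝓘(ℝ, EX).prod 𝓘(ℝ, FE)) (TotalSpace FE VE)) = AE.adField σ κ (c t).proj

/-- The connection is complete: parallel transport along any `A_B`-path, starting at any point of
`K` over the initial point, is defined on the whole interval. -/
def Extension.Connection.IsComplete (C : Q.Connection) : Prop :=
  ∀ (a : AB.Path) (v : TotalSpace FE VE), Q.p v.proj = (a 0).proj → Q.pr v.proj v.2 = 0 →
    ∃ c : Interval → TotalSpace FE VE, C.IsParallel a c ∧ c 0 = v

open Classical in
/-- Parallel transport `Φ^a_{t,s}(v)` along `a`, from time `s` to time `t`: the value at time `t`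
of the parallel curve that passes through `v` at time `s` (and `v` if there is no such curve). -/
def Extension.Connection.transport (C : Q.Connection) (a : Interval → TotalSpace FB VB)
    (t s : Interval) (v : TotalSpace FE VE) : TotalSpace FE VE :=
  if h : ∃ c : Interval → TotalSpace FE VE, C.IsParallel a c ∧ c s = v then h.choose t else v

end Extensions

end

end AlgebroidSplitting

open AlgebroidSplitting

namespace AlgebroidSplitting

open Set Filter Metric Asymptotics

/-! ### Gronwall estimates, continuous dependence and linear ordinary differential equations. -/

section ODE

/-! The inverse map is explicit: a pair `(a_B, a_K)` goes to `t ↦ Φ_{t,0}(a_K(t)) + h(a_B(t))`, and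
the two maps undo each other because `Φ_{0,t}` and `Φ_{t,0}` do. The content is that both formulas
give algebroid paths, and do so continuously for the `C^1` topologies.

Both formulas, and the transported path in the concatenation rule, involve a curve `t ↦
Φ_{θ₁(t),θ₀(t)}(b(t))` with affine times `θ₀`, `θ₁`. Let `ϑ(t,s)` interpolate affinely from `θ₀(t)`
to `θ₁(t)`, and put `δ = ∂ϑ/∂s`, `σ = ∂ϑ/∂t`. For fixed `t`, the transported point `u(t,s)` is
parallel in `s` along `δ a_B(ϑ)`. The claim is that the condition "the base velocity in `t` is `♯(u
+ h(σ a_B(ϑ)))`" passes from `s = 0` to `s = 1`. In coordinates the parallel equation is `u' = G(β,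
u)` with `G` linear in `β`, and the `t`-derivative of `u` solves the linearized equation. The defect
of the anchor condition then solves a homogeneous linear equation in `s`, for three reasons: the
anchor preserves brackets, so that `♯[h(α), κ] = [♯h(α), ♯κ]`; the mixed derivatives agree, `∂_t(δ
a_B(ϑ)) = ∂_s(σ a_B(ϑ))`; and both driving vectors are multiples of one vector, so that no curvature
appears. This is `linearized_anchor_eq`; it is globalized in `strictAt_and_isAnchored` and
specialized to moving times in `strictAt_transport`.

Regularity is handled by one notion, strict differentiability in `t` of a family of curves, locally
uniformly in the parameter (`StrictAt`). It is local, stable under `C^1` maps, and equivalent to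
continuity into `P(A)` when it holds at all points (`LieAlgebroid.continuous_path_iff`). Thus
smoothness of single paths and continuity of the two maps are proved together, by differentiable
dependence of solutions on parameters.

The concatenation rule is the flow property once more: transport from a time `t > 1/2` back to `0`
passes through `1/2`, where transport along `a_B²` ends and transport along all of `a_B¹` begins
(`kerPart_concat`). -/

theorem gronwallBound_mul (c δ K ε x : ℝ) :
    gronwallBound (c * δ) K (c * ε) x = c * gronwallBound δ K ε x := by
  unfold gronwallBound
  split_ifs <;> ring

theorem gronwallBound_le_one {δ K ε x : ℝ} (hδ : 0 ≤ δ) (hK : 0 ≤ K) (hε : 0 ≤ ε)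
    (hx : x ≤ 1) : gronwallBound δ K ε x ≤ gronwallBound δ K ε 1 :=
  gronwallBound_mono hδ hε hK hx

theorem gronwallBound_one_nonneg {δ K ε : ℝ} (hδ : 0 ≤ δ) (hK : 0 ≤ K) (hε : 0 ≤ ε) :
    0 ≤ gronwallBound δ K ε 1 := by
  have := gronwallBound_mono hδ hε hK (zero_le_one (α := ℝ))
  rw [gronwallBound_x0] at this
  linarith

/-- The bound is linear in the pair (initial error, defect), so a small common value of both makes
it small on all of `x ≤ 1`. -/
theorem exists_gronwallBound_lt {K ε : ℝ} (hK : 0 ≤ K) (hε : 0 < ε) :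
    ∃ δ > 0, ∀ x ≤ (1 : ℝ), gronwallBound δ K δ x < ε := by
  have h1 := gronwallBound_one_nonneg zero_le_one hK (zero_le_one (α := ℝ))
  refine ⟨ε / (gronwallBound 1 K 1 1 + 1), by positivity, fun x hx => ?_⟩
  have hpos : 0 < ε / (gronwallBound 1 K 1 1 + 1) := by positivity
  refine (gronwallBound_le_one hpos.le hK hpos.le hx).trans_lt ?_
  have := gronwallBound_mul (ε / (gronwallBound 1 K 1 1 + 1)) 1 K 1 1
  rw [mul_one] at this
  rw [this, div_mul_eq_mul_div, div_lt_iff₀ (by positivity)]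
  nlinarith

/-- A curve which satisfies an a priori estimate never leaves the set it is estimated in. -/
theorem forall_mem_of_apriori {Z : Type*} [TopologicalSpace Z] {c : ℝ → Z} (hc : Continuous c)
    {C O : Set Z} (hC : IsClosed C) (hO : IsOpen O) (hOC : O ⊆ C) (h0 : c 0 ∈ O)
    (hap : ∀ b ∈ Icc (0 : ℝ) 1, (∀ s ∈ Icc 0 b, c s ∈ C) → c b ∈ O) :
    ∀ s ∈ Icc (0 : ℝ) 1, c s ∈ O := by
  suffices h : Icc (0 : ℝ) 1 ⊆ {b | ∀ s ∈ Icc (0 : ℝ) b, c s ∈ C} from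
    fun s hs => hap s hs (h hs)
  refine IsClosed.Icc_subset_of_forall_exists_gt ?_ ?_ ?_
  -- Closedness becomes visible once the condition at all `s ≤ b` is written as a condition on `c
  -- (min x b)` for each fixed `x`.
  · have : {b | ∀ s ∈ Icc (0 : ℝ) b, c s ∈ C} ∩ Icc 0 1 =
        (⋂ x ∈ Icc (0 : ℝ) 1, {b | c (min x b) ∈ C}) ∩ Icc 0 1 := by
      ext b
      simp only [mem_inter_iff, mem_ofPred_eq, mem_iInter]
      refine and_congr_left fun hb => ⟨fun h x hx => h _ ⟨le_min hx.1 hb.1, min_le_right _ _⟩,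
        fun h s hs => ?_⟩
      have := h s ⟨hs.1, hs.2.trans hb.2⟩
      rwa [min_eq_left hs.2] at this
    rw [this]
    refine IsClosed.inter (isClosed_biInter fun x _ => hC.preimage (by fun_prop)) isClosed_Icc
  · intro s hs
    have : s = 0 := le_antisymm hs.2 hs.1
    exact this ▸ hOC h0
  · rintro b ⟨hb, hb01⟩ y hy
    have hbO : c b ∈ O := hap b ⟨hb01.1, hb01.2.le⟩ hb
    have : c ⁻¹' O ∈ 𝓝[≥] b := mem_nhdsWithin_of_mem_nhds (hc.continuousAt (hO.mem_nhds hbO))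
    obtain ⟨u, hu, hsub⟩ := mem_nhdsGE_iff_exists_Icc_subset.1 this
    refine ⟨min u y, ?_, lt_min hu hy, min_le_right _ _⟩
    intro s hs
    rcases le_total s b with h | h
    · exact hb s ⟨hs.1, h⟩
    · exact hOC (hsub ⟨h, hs.2.trans (min_le_left _ _)⟩)

/-- Continuous dependence of solutions of an ordinary differential equation `u' = μ G(b, u)` in a
chart of a manifold, in terms of arbitrary filters. -/
theorem exists_nhds_tendsto_of_ode {Z E FB : Type*} [TopologicalSpace Z] [T2Space Z]
    [NormedAddCommGroup E] [NormedSpace ℝ E] [FiniteDimensional ℝ E]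
    [NormedAddCommGroup FB] [NormedSpace ℝ FB]
    (χ : OpenPartialHomeomorph Z E) {G : FB × E → E} {β : FB} {z : Z} (hz : z ∈ χ.source)
    (hG : ContDiffAt ℝ 1 G (β, χ z)) {O : Set Z} (hO : O ∈ 𝓝 z) :
    ∃ W ∈ 𝓝 z, ∃ V ∈ 𝓝 β, W ⊆ O ∩ χ.source ∧ ∀ {P : Type*} (l : Filter P) (v : P → ℝ → Z)
      (b : P → ℝ → FB) (v₀ : ℝ → Z) (b₀ : ℝ → FB) (μ : ℝ), (∀ p, Continuous (v p)) →
      Continuous v₀ → (∀ s ∈ Icc (0 : ℝ) 1, v₀ s ∈ W) → (∀ s ∈ Icc (0 : ℝ) 1, b₀ s ∈ V) →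
      TendstoUniformlyOn b b₀ l (Icc 0 1) → Tendsto (fun p => v p 0) l (𝓝 (v₀ 0)) →
      (∀ᶠ p in l, ∀ s ∈ Icc (0 : ℝ) 1, v p s ∈ O →
        HasDerivWithinAt (fun s => χ (v p s)) (μ • G (b p s, χ (v p s))) (Icc 0 1) s) →
      (∀ s ∈ Icc (0 : ℝ) 1,
        HasDerivWithinAt (fun s => χ (v₀ s)) (μ • G (b₀ s, χ (v₀ s))) (Icc 0 1) s) →
      ∀ ε > 0, ∀ᶠ p in l, ∀ s ∈ Icc (0 : ℝ) 1, v p s ∈ O ∩ χ.source ∧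
        dist (χ (v p s)) (χ (v₀ s)) < ε := by
  obtain ⟨K, S, hS, hK⟩ := hG.exists_lipschitzOnWith
  have hO' : χ.target ∩ χ.symm ⁻¹' (interior O) ∈ 𝓝 (χ z) := by
    refine inter_mem (χ.open_target.mem_nhds (χ.map_source hz)) ?_
    refine (χ.continuousAt_symm (χ.map_source hz)) ?_
    rw [χ.left_inv hz]
    exact interior_mem_nhds.2 hO
  obtain ⟨S₁, hS₁, S₂, hS₂, hSS⟩ := mem_nhds_prod_iff.1 hS
  obtain ⟨ρ, hρ, hρS⟩ := Metric.mem_nhds_iff.1 hS₁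
  obtain ⟨r, hr, hrS⟩ := nhds_basis_closedBall.mem_iff.1 (inter_mem hS₂ hO')
  have hLip : LipschitzOnWith K G (ball β ρ ×ˢ closedBall (χ z) r) :=
    hK.mono ((prod_mono hρS fun x hx => (hrS hx).1).trans hSS)
  have hballT : closedBall (χ z) r ⊆ χ.target := fun x hx => (hrS hx).2.1
  -- The reference solution is kept in the ball of half the radius; the other half is room for the
  -- perturbed solutions. The same is done with `ρ` for the driving curves.
  refine ⟨χ.source ∩ χ ⁻¹' (ball (χ z) (r / 2)), χ.isOpen_inter_preimage isOpen_ball |>.mem_nhds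
    ⟨hz, mem_ball_self (by positivity)⟩, ball β (ρ / 2), ball_mem_nhds _ (by positivity), ?_, ?_⟩
  · rintro x ⟨hx, hx'⟩
    have := (hrS (ball_subset_closedBall (ball_subset_ball (by linarith) hx'))).2.2
    rw [mem_preimage, χ.left_inv hx] at this
    exact ⟨interior_subset this, hx⟩
  intro P l v b v₀ b₀ μ hv hv₀ hv₀W hb₀V hbb hv0 hode hode₀ ε hε
  -- The image of a compact ball is closed in the whole Hausdorff space, so a solution cannot slip
  -- out of it by leaving the chart.
  set C : Set Z := χ.symm '' closedBall (χ z) r with hC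
  have hCc : IsClosed C := ((isCompact_closedBall _ _).image_of_continuousOn
    (χ.continuousOn_symm.mono hballT)).isClosed
  have hCO : ∀ x ∈ C, x ∈ O ∧ x ∈ χ.source ∧ χ x ∈ closedBall (χ z) r := by
    rintro _ ⟨x, hx, rfl⟩
    exact ⟨interior_subset (hrS hx).2.2, χ.map_target (hballT hx), by
      rwa [χ.right_inv (hballT hx)]⟩
  set U : Set Z := χ.source ∩ χ ⁻¹' (ball (χ z) r) with hU
  have hUC : U ⊆ C := fun x hx => ⟨χ x, ball_subset_closedBall hx.2, χ.left_inv hx.1⟩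
  set K' : ℝ := (((|μ|).toNNReal * K : NNReal) : ℝ)
  have hK' : K' = |μ| * K := by simp [K']
  -- The bound `ε` gives the conclusion, and `r / 2` keeps the perturbed solution in the ball of
  -- radius `r`.
  obtain ⟨δ, hδ, hδε⟩ := exists_gronwallBound_lt (K := K') (by positivity)
    (lt_min hε (show 0 < r / 2 by positivity))
  obtain ⟨η, hη, hηρ, hηδ⟩ : ∃ η > 0, η ≤ ρ / 2 ∧ |μ| * (K * η) ≤ δ := by
    refine ⟨min (ρ / 2) (δ / (|μ| * K + 1)), by positivity, min_le_left _ _, ?_⟩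
    have h1 : |μ| * K * min (ρ / 2) (δ / (|μ| * K + 1)) ≤ |μ| * K * (δ / (|μ| * K + 1)) := by
      gcongr
      exact min_le_right _ _
    have h2 : |μ| * K * (δ / (|μ| * K + 1)) ≤ δ := by
      rw [mul_div_assoc', div_le_iff₀ (by positivity)]
      nlinarith [show 0 ≤ |μ| * K by positivity]
    linarith
  have h0U : ∀ᶠ p in l, v p 0 ∈ U ∧ dist (χ (v p 0)) (χ (v₀ 0)) ≤ δ := by
    have hW0 := hv₀W 0 (by simp)
    have hU0 : U ∈ 𝓝 (v₀ 0) := (χ.isOpen_inter_preimage isOpen_ball).mem_nhds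
      ⟨hW0.1, ball_subset_ball (by linarith) hW0.2⟩
    filter_upwards [hv0 hU0, ((χ.continuousAt hW0.1).tendsto.comp hv0)
      (closedBall_mem_nhds _ hδ)] with p h1 h2 using ⟨h1, h2⟩
  filter_upwards [hode, h0U, Metric.tendstoUniformlyOn_iff.1 hbb η hη] with p hp h0 hbp
  have key : ∀ a ∈ Icc (0 : ℝ) 1, (∀ s ∈ Icc 0 a, v p s ∈ C) →
      dist (χ (v p a)) (χ (v₀ a)) < min ε (r / 2) := by
    intro a ha hva
    have hsub : Icc 0 a ⊆ Icc (0 : ℝ) 1 := Icc_subset_Icc_right ha.2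
    have hIco : ∀ s ∈ Ico 0 a, s ∈ Icc (0 : ℝ) 1 := fun s hs => hsub (Ico_subset_Icc_self hs)
    have hnear : ∀ s ∈ Ico 0 a, Icc (0 : ℝ) 1 ∈ 𝓝[≥] s := fun s hs =>
      Filter.mem_of_superset (Icc_mem_nhdsGE (hs.2.trans_le ha.2)) (Icc_subset_Icc_left hs.1)
    refine lt_of_le_of_lt ?_ (hδε a ha.2)
    have hb₀ : ∀ s ∈ Ico 0 a, b₀ s ∈ ball β ρ := fun s hs =>
      ball_subset_ball (by linarith) (hb₀V s (hIco s hs))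
    have hbb' : ∀ s ∈ Ico 0 a, b p s ∈ ball β ρ := fun s hs => by
      have h1 := hbp s (hIco s hs)
      have h2 := hb₀V s (hIco s hs)
      rw [mem_ball] at h2 ⊢
      rw [dist_comm] at h1
      linarith [dist_triangle (b p s) (b₀ s) β]
    -- The field is the one driven by `b₀`: the reference curve solves it exactly, the perturbed
    -- curve with a defect that comes from replacing `b p` by `b₀`.
    have := dist_le_of_approx_trajectories_ODE_of_mem (E := E)
      (v := fun s x => μ • G (b₀ s, x)) (s := fun _ => closedBall (χ z) r)
      (K := (|μ|).toNNReal * K) (f := fun s => χ (v p s)) (g := fun s => χ (v₀ s))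
      (f' := fun s => μ • G (b p s, χ (v p s))) (g' := fun s => μ • G (b₀ s, χ (v₀ s)))
      (a := 0) (b := a) (εf := δ) (εg := 0) (δ := δ) ?_ ?_ ?_ ?_ ?_ ?_ ?_ ?_ ?_ ?_ a
      ⟨ha.1, le_rfl⟩
    · simpa [K'] using this
    · intro s hs
      refine LipschitzOnWith.of_dist_le_mul fun x hx y hy => ?_
      have := hLip.dist_le_mul (b₀ s, x) ⟨hb₀ s hs, hx⟩ (b₀ s, y) ⟨hb₀ s hs, hy⟩
      rw [dist_smul₀, NNReal.coe_mul, Real.coe_toNNReal _ (abs_nonneg _), mul_assoc,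
        Real.norm_eq_abs]
      gcongr
      refine this.trans (le_of_eq ?_)
      simp [Prod.dist_eq]
    · intro s hs
      exact ((χ.continuousAt (hCO _ (hva s hs)).2.1).comp (hv p).continuousAt).continuousWithinAt
    · intro s hs
      exact (hp s (hIco s hs) (hCO _ (hva s (Ico_subset_Icc_self hs))).1).mono_of_mem_nhdsWithin
        (hnear s hs)
    · intro s hs
      have := hLip.dist_le_mul (b p s, χ (v p s)) ⟨hbb' s hs, (hCO _ (hva s
        (Ico_subset_Icc_self hs))).2.2⟩ (b₀ s, χ (v p s)) ⟨hb₀ s hs, (hCO _ (hva s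
        (Ico_subset_Icc_self hs))).2.2⟩
      rw [dist_smul₀, Real.norm_eq_abs]
      refine le_trans ?_ hηδ
      gcongr
      refine this.trans ?_
      gcongr
      simp only [Prod.dist_eq, dist_self]
      rw [max_eq_left dist_nonneg, dist_comm]
      exact (hbp s (hIco s hs)).le
    · intro s hs
      exact (hCO _ (hva s (Ico_subset_Icc_self hs))).2.2
    · intro s hs
      exact ((χ.continuousAt (hv₀W s (hsub hs)).1).comp hv₀.continuousAt).continuousWithinAt
    · intro s hs
      exact (hode₀ s (hIco s hs)).mono_of_mem_nhdsWithin (hnear s hs)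
    · intro s hs
      simp
    · intro s hs
      exact ball_subset_closedBall (ball_subset_ball (by linarith) (hv₀W s (hIco s hs)).2)
    · exact h0.2
  have hall : ∀ s ∈ Icc (0 : ℝ) 1, v p s ∈ U := by
    refine forall_mem_of_apriori (hv p) hCc (χ.isOpen_inter_preimage isOpen_ball) hUC h0.1 ?_
    intro a ha hva
    refine ⟨(hCO _ (hva a ⟨ha.1, le_rfl⟩)).2.1, ?_⟩
    have h1 := (key a ha hva).trans_le (min_le_right _ _)
    have h2 := (hv₀W a ha).2
    rw [mem_preimage, mem_ball] at h2 ⊢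
    linarith [dist_triangle (χ (v p a)) (χ (v₀ a)) (χ z)]
  intro s hs
  have hsC := hCO _ (hUC (hall s hs))
  exact ⟨⟨hsC.1, hsC.2.1⟩, (key s hs fun s' hs' => hUC (hall s'
    ⟨hs'.1, hs'.2.trans hs.2⟩)).trans_le (min_le_left _ _)⟩

/-- Inhomogeneous linear equations with small coefficients are solvable on the unit interval. -/
theorem exists_linear_ode {E : Type*} [NormedAddCommGroup E] [NormedSpace ℝ E] [CompleteSpace E]
    {A : ℝ → E →L[ℝ] E} {r : ℝ → E} (hA : ContinuousOn A (Icc 0 1)) (hr : ContinuousOn r (Icc 0 1))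
    (hA' : ∀ s ∈ Icc (0 : ℝ) 1, ‖A s‖ ≤ 1 / 2) (w₀ : E) :
    ∃ w : ℝ → E, w 0 = w₀ ∧ ∀ s ∈ Icc (0 : ℝ) 1, HasDerivWithinAt w (A s (w s) + r s) (Icc 0 1) s := by
  obtain ⟨R, hR⟩ := isCompact_Icc.exists_bound_of_continuousOn hr
  have hR0 : 0 ≤ R := (norm_nonneg _).trans (hR 0 (by simp))
  -- This `a` serves both as radius and as bound of the field: on the ball of radius `a` about `w₀`
  -- the field is at most `(‖w₀‖ + a) / 2 + R`, when `‖A s‖ ≤ 1/2`, and this equals `a`. Hence the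
  -- solution lasts for time one.
  set a : ℝ := ‖w₀‖ + 2 * R with ha
  have ha0 : 0 ≤ a := by positivity
  have := IsPicardLindelof.exists_eq_forall_mem_Icc_hasDerivWithinAt₀ (E := E)
    (f := fun s w => A s w + r s) (tmin := 0) (tmax := 1) (t₀ := ⟨0, by simp⟩) (x₀ := w₀)
    (a := ⟨a, ha0⟩) (L := ⟨a, ha0⟩) (K := 1 / 2) ⟨?_, ?_, ?_, ?_⟩
  · exact this
  · intro s hs
    refine LipschitzOnWith.of_dist_le_mul fun x _ y _ => ?_
    rw [dist_add_right, dist_eq_norm, dist_eq_norm, ← map_sub]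
    refine (A s).le_of_opNorm_le ?_ _
    simpa using hA' s hs
  · intro x _
    fun_prop
  · intro s hs x hx
    have hx' : ‖x‖ ≤ ‖w₀‖ + a := by
      have : ‖x - w₀‖ ≤ a := mem_closedBall_iff_norm.1 hx
      have := norm_le_norm_add_norm_sub' x w₀
      linarith
    have h1 := (A s).le_of_opNorm_le (hA' s hs) x
    have h2 := norm_add_le (A s x) (r s)
    have h3 := hR s hs
    change _ ≤ a
    linarith
  · simp

end ODE

/-! ### Strictly differentiable families of curves, and differentiation of solutions in a parameter.
-/

section StrictFamilies

variable {Y Y' E E' : Type*} [NormedAddCommGroup E] [NormedSpace ℝ E]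
  [NormedAddCommGroup E'] [NormedSpace ℝ E']

/-- The derivative of a curve on the unit interval. -/
def HasDerivAtI (u : Interval → E) (D : E) (t : Interval) : Prop :=
  HasDerivWithinAt (fun s : ℝ => u (projIcc 0 1 zero_le_one s)) D (Icc 0 1) t

/-- Strict differentiability at `t₀` of a family of curves on the unit interval, locally uniformly
in the parameter. -/
def HasStrictDerivFam (u : Y → Interval → E) (l : Filter Y) (t₀ : Interval) (D : E) : Prop :=
  (fun p : Y × Interval × Interval => u p.1 p.2.2 - u p.1 p.2.1 - ((p.2.2 : ℝ) - p.2.1) • D)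
    =o[l ×ˢ 𝓝 t₀ ×ˢ 𝓝 t₀] fun p => (p.2.2 : ℝ) - p.2.1

variable {u : Y → Interval → E} {l : Filter Y} {t₀ : Interval} {D : E}

theorem HasStrictDerivFam.comp_tendsto (h : HasStrictDerivFam u l t₀ D) {l' : Filter Y'}
    {k : Y' → Y} (hk : Tendsto k l' l) : HasStrictDerivFam (fun y => u (k y)) l' t₀ D :=
  IsLittleO.comp_tendsto h
    (k := fun p : Y' × Interval × Interval => (k p.1, p.2)) (hk.prodMap tendsto_id)

theorem HasStrictDerivFam.congr (h : HasStrictDerivFam u l t₀ D) {v : Y → Interval → E}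
    (huv : ∀ᶠ p in l ×ˢ 𝓝 t₀, u p.1 p.2 = v p.1 p.2) : HasStrictDerivFam v l t₀ D := by
  have h1 : ∀ᶠ p in l ×ˢ 𝓝 t₀ ×ˢ 𝓝 t₀, u p.1 p.2.1 = v p.1 p.2.1 :=
    (tendsto_fst.prodMk (tendsto_fst.comp tendsto_snd)).eventually huv
  have h2 : ∀ᶠ p in l ×ˢ 𝓝 t₀ ×ˢ 𝓝 t₀, u p.1 p.2.2 = v p.1 p.2.2 :=
    (tendsto_fst.prodMk (tendsto_snd.comp tendsto_snd)).eventually huv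
  refine IsLittleO.congr' h ?_ EventuallyEq.rfl
  filter_upwards [h1, h2] with p h1 h2
  rw [h1, h2]

/-- The increments of `u` are `O(t' - t)` uniformly in the parameter, so the `o`-term of the strict
derivative of `f` remains `o(t' - t)`. -/
theorem HasStrictDerivFam.comp_strictFDeriv (h : HasStrictDerivFam u l t₀ D) {x : E} {f : E → E'}
    {f' : E →L[ℝ] E'} (hf : HasStrictFDerivAt f f' x)
    (hu : Tendsto (fun p : Y × Interval => u p.1 p.2) (l ×ˢ 𝓝 t₀) (𝓝 x)) :
    HasStrictDerivFam (fun y t => f (u y t)) l t₀ (f' D) := by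
  have h1 : Tendsto (fun p : Y × Interval × Interval => (u p.1 p.2.2, u p.1 p.2.1))
      (l ×ˢ 𝓝 t₀ ×ˢ 𝓝 t₀) (𝓝 (x, x)) := by
    rw [nhds_prod_eq]
    exact (hu.comp (tendsto_fst.prodMk (tendsto_snd.comp tendsto_snd))).prodMk
      (hu.comp (tendsto_fst.prodMk (tendsto_fst.comp tendsto_snd)))
  have hO : (fun p : Y × Interval × Interval => u p.1 p.2.2 - u p.1 p.2.1)
      =O[l ×ˢ 𝓝 t₀ ×ˢ 𝓝 t₀] fun p => (p.2.2 : ℝ) - p.2.1 := by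
    have h2 : (fun p : Y × Interval × Interval => ((p.2.2 : ℝ) - p.2.1) • D)
        =O[l ×ˢ 𝓝 t₀ ×ˢ 𝓝 t₀] fun p => (p.2.2 : ℝ) - p.2.1 := by
      refine IsBigO.of_bound ‖D‖ (Eventually.of_forall fun p => ?_)
      rw [norm_smul, mul_comm]
    simpa using (IsLittleO.isBigO h).add h2
  have h3 := (hf.isLittleO.comp_tendsto h1).trans_isBigO hO
  have h4 : (fun p : Y × Interval × Interval =>
      f' (u p.1 p.2.2 - u p.1 p.2.1 - ((p.2.2 : ℝ) - p.2.1) • D))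
      =o[l ×ˢ 𝓝 t₀ ×ˢ 𝓝 t₀] fun p => (p.2.2 : ℝ) - p.2.1 :=
    (f'.isBigO_comp _ _).trans_isLittleO h
  refine (h3.add h4).congr_left fun p => ?_
  simp only [Function.comp_apply, map_sub, map_smul]
  abel

theorem HasStrictDerivFam.prodMk (h : HasStrictDerivFam u l t₀ D) {v : Y → Interval → E'} {D' : E'}
    (h' : HasStrictDerivFam v l t₀ D') :
    HasStrictDerivFam (fun y t => (u y t, v y t)) l t₀ (D, D') :=
  IsLittleO.prod_left h h'

theorem HasStrictDerivFam.comp_reparam (h : HasStrictDerivFam u l t₀ D) {l' : Filter Y'}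
    {k : Y' → Y} (hk : Tendsto k l' l) {θ : Y' → Interval → Interval} {t₁ : Interval}
    {m : ℝ} (hθ : HasStrictDerivFam (fun y t => (θ y t : ℝ)) l' t₁ m)
    (hθ' : Tendsto (fun p : Y' × Interval => θ p.1 p.2) (l' ×ˢ 𝓝 t₁) (𝓝 t₀)) :
    HasStrictDerivFam (fun y t => u (k y) (θ y t)) l' t₁ (m • D) := by
  have hT : Tendsto (fun p : Y' × Interval × Interval => (k p.1, θ p.1 p.2.1, θ p.1 p.2.2))
      (l' ×ˢ 𝓝 t₁ ×ˢ 𝓝 t₁) (l ×ˢ 𝓝 t₀ ×ˢ 𝓝 t₀) :=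
    (hk.comp tendsto_fst).prodMk
      ((hθ'.comp (tendsto_fst.prodMk (tendsto_fst.comp tendsto_snd))).prodMk
      (hθ'.comp (tendsto_fst.prodMk (tendsto_snd.comp tendsto_snd))))
  have h1 := IsLittleO.comp_tendsto h hT
  have hO : (fun p : Y' × Interval × Interval => ((θ p.1 p.2.2 : ℝ) - θ p.1 p.2.1))
      =O[l' ×ˢ 𝓝 t₁ ×ˢ 𝓝 t₁] fun p => (p.2.2 : ℝ) - p.2.1 := by
    have h2 : (fun p : Y' × Interval × Interval => ((p.2.2 : ℝ) - p.2.1) • m)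
        =O[l' ×ˢ 𝓝 t₁ ×ˢ 𝓝 t₁] fun p => (p.2.2 : ℝ) - p.2.1 := by
      refine IsBigO.of_bound ‖m‖ (Eventually.of_forall fun p => ?_)
      rw [norm_smul, mul_comm]
    simpa using (IsLittleO.isBigO hθ).add h2
  have h2 := h1.trans_isBigO hO
  have h3 : (fun p : Y' × Interval × Interval =>
      (((θ p.1 p.2.2 : ℝ) - θ p.1 p.2.1) - ((p.2.2 : ℝ) - p.2.1) • m) • D)
      =o[l' ×ˢ 𝓝 t₁ ×ˢ 𝓝 t₁] fun p => (p.2.2 : ℝ) - p.2.1 := by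
    refine IsBigO.trans_isLittleO ?_ hθ
    refine IsBigO.of_bound ‖D‖ (Eventually.of_forall fun p => ?_)
    rw [norm_smul, mul_comm]
  refine (h2.add h3).congr_left fun p => ?_
  simp only [Function.comp_apply, sub_smul, smul_smul, smul_eq_mul]
  abel

theorem HasStrictDerivFam.hasDerivAtI (h : HasStrictDerivFam u l t₀ D) {y : Y} (hy : pure y ≤ l) :
    HasDerivAtI (u y) D t₀ := by
  have hT : Tendsto (fun s : ℝ => ((y, t₀, projIcc 0 1 zero_le_one s) : Y × Interval × Interval))
      (𝓝[Icc 0 1] (t₀ : ℝ)) (l ×ˢ 𝓝 t₀ ×ˢ 𝓝 t₀) := by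
    refine Tendsto.prodMk (tendsto_const_pure.mono_right hy) (tendsto_const_nhds.prodMk ?_)
    have : Tendsto (projIcc (0 : ℝ) 1 zero_le_one) (𝓝 (t₀ : ℝ)) (𝓝 t₀) := by
      have h := (continuous_projIcc (a := (0 : ℝ)) (b := 1) (h := zero_le_one)).tendsto (t₀ : ℝ)
      rwa [projIcc_val] at h
    exact this.mono_left nhdsWithin_le_nhds
  have := IsLittleO.comp_tendsto h hT
  refine HasDerivWithinAt.congr (f := fun s : ℝ => u y (projIcc 0 1 zero_le_one s)) ?_
    (fun _ _ => rfl) rfl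
  rw [hasDerivWithinAt_iff_isLittleO]
  refine this.congr' ?_ ?_
  · filter_upwards [self_mem_nhdsWithin] with s hs
    simp [projIcc_of_mem zero_le_one hs]
  · filter_upwards [self_mem_nhdsWithin] with s hs
    simp [projIcc_of_mem zero_le_one hs]

theorem tendsto_projIcc (t : Interval) :
    Tendsto (projIcc (0 : ℝ) 1 zero_le_one) (𝓝[Icc 0 1] (t : ℝ)) (𝓝 t) := by
  have h := (continuous_projIcc (a := (0 : ℝ)) (b := 1) (h := zero_le_one)).tendsto (t : ℝ)
  rw [projIcc_val] at h
  exact h.mono_left nhdsWithin_le_nhds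

/-- The difference quotients of `v - t D₀` are bounded by `ε`, and `D - D₀` is their limit. This
transfers a strict estimate at one point to derivatives at nearby points. -/
theorem HasDerivAtI.norm_le {v : Interval → E} {t : Interval} (h : HasDerivAtI v D t) {D₀ : E}
    {ε : ℝ} (hε : ∀ᶠ t' in 𝓝 t, ‖v t' - v t - ((t' : ℝ) - t) • D₀‖ ≤ ε * |(t' : ℝ) - t|) :
    ‖D - D₀‖ ≤ ε := by
  have h1 : HasDerivWithinAt (fun s : ℝ => v (projIcc 0 1 zero_le_one s) - s • D₀) (D - D₀)
      (Icc 0 1) t := by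
    have h2 := HasDerivWithinAt.fun_sub (f := fun s : ℝ => v (projIcc 0 1 zero_le_one s)) h
      (((hasDerivAt_id (t : ℝ)).smul_const D₀).hasDerivWithinAt (s := Icc 0 1))
    simpa using h2
  have h3 := hasDerivWithinAt_iff_tendsto_slope.1 h1
  have hne : (𝓝[Icc 0 1 \ {(t : ℝ)}] (t : ℝ)).NeBot :=
    ((uniqueDiffOn_Icc zero_lt_one) _ t.2).accPt.mono (le_refl _) |> fun h => by
      rwa [accPt_principal_iff_nhdsWithin] at h
  refine le_of_tendsto h3.norm ?_
  have := ((tendsto_projIcc t).mono_left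
    (nhdsWithin_mono _ (sdiff_subset (t := {(t : ℝ)})))).eventually hε
  filter_upwards [this, self_mem_nhdsWithin] with s hs hs'
  have hst : s - t ≠ 0 := sub_ne_zero.2 hs'.2
  rw [projIcc_of_mem _ hs'.1] at hs
  simp only [slope, vsub_eq_sub, projIcc_val, projIcc_of_mem _ hs'.1, norm_smul, norm_inv,
    Real.norm_eq_abs]
  rw [inv_mul_le_iff₀ (abs_pos.2 hst), mul_comm]
  refine le_trans (le_of_eq ?_) hs
  congr 1
  rw [sub_smul]
  abel

/-- The strict estimate at `(y₀, t₀)` holds for all nearby `(y, t, t')`; letting `t'` tend to `t`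
bounds the derivative at `(y, t)`. -/
theorem HasStrictDerivFam.tendsto_deriv [TopologicalSpace Y] {y₀ : Y}
    (h : HasStrictDerivFam u (𝓝 y₀) t₀ D) {D' : Y → Interval → E}
    (hD' : ∀ᶠ p in 𝓝 y₀ ×ˢ 𝓝 t₀, HasDerivAtI (u p.1) (D' p.1 p.2) p.2) :
    Tendsto (fun p : Y × Interval => D' p.1 p.2) (𝓝 (y₀, t₀)) (𝓝 D) := by
  rw [nhds_prod_eq, Metric.tendsto_nhds]
  intro ε hε
  have h1 := IsLittleO.def h (half_pos hε)
  rw [← nhds_prod_eq, ← nhds_prod_eq] at h1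
  have h2 := h1.eventually_nhds
  have h3 : Tendsto (fun p : Y × Interval => (p.1, p.2, p.2)) (𝓝 y₀ ×ˢ 𝓝 t₀)
      (𝓝 (y₀, t₀, t₀)) := by
    rw [nhds_prod_eq, nhds_prod_eq]
    exact tendsto_fst.prodMk (tendsto_snd.prodMk tendsto_snd)
  filter_upwards [h3.eventually h2, hD'] with p hp hp'
  rw [dist_eq_norm]
  refine (hp'.norm_le (ε := ε / 2) ?_).trans_lt (half_lt_self hε)
  have h4 : Tendsto (fun t' : Interval => (p.1, p.2, t')) (𝓝 p.2) (𝓝 (p.1, p.2, p.2)) := by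
    rw [nhds_prod_eq, nhds_prod_eq]
    exact tendsto_const_nhds.prodMk (tendsto_const_nhds.prodMk tendsto_id)
  exact h4.eventually hp

/-- The mean value inequality on a small interval, applied to `u y s - s D`, whose derivative is
small there. -/
theorem HasStrictDerivFam.of_hasDerivAtI {D' : Y → Interval → E}
    (hD' : ∀ᶠ p in l ×ˢ 𝓝 t₀, HasDerivAtI (u p.1) (D' p.1 p.2) p.2)
    (hD : Tendsto (fun p : Y × Interval => D' p.1 p.2) (l ×ˢ 𝓝 t₀) (𝓝 D)) :
    HasStrictDerivFam u l t₀ D := by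
  refine IsLittleO.of_bound fun ε hε => ?_
  have h1 := (Metric.tendsto_nhds.1 hD ε hε).and hD'
  obtain ⟨p, hp, q, hq, hpq⟩ := eventually_prod_iff.1 h1
  obtain ⟨δ, hδ, hδq⟩ := Metric.eventually_nhds_iff_ball.1 hq
  have hball := ball_mem_nhds t₀ hδ
  filter_upwards [(tendsto_fst.eventually hp), (tendsto_fst.comp tendsto_snd).eventually hball,
    (tendsto_snd.comp tendsto_snd).eventually hball] with ⟨y, t, t'⟩ hy ht ht'
  simp only [Function.comp_apply] at ht ht'
  have hconv : Convex ℝ (ball (t₀ : ℝ) δ ∩ Icc 0 1) := (convex_ball _ _).inter (convex_Icc 0 1)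
  have := hconv.norm_image_sub_le_of_norm_hasDerivWithin_le
    (f := fun s : ℝ => u y (projIcc 0 1 zero_le_one s) - s • D)
    (f' := fun s => D' y (projIcc 0 1 zero_le_one s) - D) (C := ε) (x := t) (y := t') ?_ ?_
    ⟨ht, t.2⟩ ⟨ht', t'.2⟩
  · simp only [projIcc_val] at this
    refine le_trans (le_of_eq ?_) this
    congr 1
    rw [sub_smul]
    abel
  · rintro s ⟨hs, hs'⟩
    have h2 := (hpq hy (hδq ⟨s, hs'⟩ hs)).2
    have h3 := HasDerivWithinAt.fun_sub (f := fun s : ℝ => u y (projIcc 0 1 zero_le_one s)) h2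
      (((hasDerivAt_id s).smul_const D).hasDerivWithinAt (s := Icc 0 1))
    rw [projIcc_of_mem _ hs']
    exact (by simpa using h3 : HasDerivWithinAt (fun s : ℝ =>
      u y (projIcc 0 1 zero_le_one s) - s • D) _ (Icc 0 1) s).mono inter_subset_right
  · rintro s ⟨hs, hs'⟩
    have h2 := (hpq hy (hδq ⟨s, hs'⟩ hs)).1
    rw [projIcc_of_mem _ hs', ← dist_eq_norm]
    exact le_of_lt h2

/-- A first order expansion of `G`, uniform along a compact curve. Near each `s₀` one half of `η`
pays for strict differentiability at `x s₀`, the other for replacing the derivative at `x s₀` by the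
one at `x s`; compactness patches the local statements. -/
theorem eventually_forall_norm_sub_sub_le {P X E : Type*} [NormedAddCommGroup X] [NormedSpace ℝ X]
    [NormedAddCommGroup E] [NormedSpace ℝ E] {l : Filter P} {G : X → E} {x : ℝ → X}
    {K : Set ℝ} (hK : IsCompact K) (hx : ContinuousOn x K) (hG : ∀ s ∈ K, ContDiffAt ℝ 1 G (x s))
    {x₁ x₂ : P → ℝ → X} (h₁ : TendstoUniformlyOn x₁ x l K) (h₂ : TendstoUniformlyOn x₂ x l K)
    {η : ℝ} (hη : 0 < η) :
    ∀ᶠ p in l, ∀ s ∈ K, ‖G (x₂ p s) - G (x₁ p s) - fderiv ℝ G (x s) (x₂ p s - x₁ p s)‖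
      ≤ η * ‖x₂ p s - x₁ p s‖ := by
  have hD : ContinuousOn (fun s => fderiv ℝ G (x s)) K := fun s hs =>
    ((hG s hs).continuousAt_fderiv one_ne_zero).comp_continuousWithinAt (hx s hs)
  suffices h : ∀ᶠ p in l, ∀ s ∈ K, s ∈ K → ‖G (x₂ p s) - G (x₁ p s) -
      fderiv ℝ G (x s) (x₂ p s - x₁ p s)‖ ≤ η * ‖x₂ p s - x₁ p s‖ from
    h.mono fun p hp s hs => hp s hs hs
  refine hK.induction_on (p := fun S => ∀ᶠ p in l, ∀ s ∈ S, s ∈ K → ‖G (x₂ p s) - G (x₁ p s) -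
      fderiv ℝ G (x s) (x₂ p s - x₁ p s)‖ ≤ η * ‖x₂ p s - x₁ p s‖) (by simp)
    (fun S T hST hT => hT.mono fun p hp s hs => hp s (hST hs))
    (fun S T hS hT => ?_) (fun s₀ hs₀ => ?_)
  · filter_upwards [hS, hT] with p h1 h2 s hs
    exact hs.elim (h1 s) (h2 s)
  · have hstr := ((hG s₀ hs₀).hasStrictFDerivAt one_ne_zero).isLittleO.def (half_pos hη)
    obtain ⟨ρ, hρ, hball⟩ := Metric.eventually_nhds_iff_ball.1 hstr
    refine ⟨{s | dist (x s) (x s₀) < ρ / 2 ∧ dist (fderiv ℝ G (x s)) (fderiv ℝ G (x s₀)) < η / 2},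
      (Metric.tendsto_nhds.1 (hx s₀ hs₀) _ (half_pos hρ)).and
        (Metric.tendsto_nhds.1 (hD s₀ hs₀) _ (half_pos hη)), ?_⟩
    filter_upwards [Metric.tendstoUniformlyOn_iff.1 h₁ _ (half_pos hρ),
      Metric.tendstoUniformlyOn_iff.1 h₂ _ (half_pos hρ)] with p hp₁ hp₂ s hs hsK
    have e1 : dist (x₁ p s) (x s₀) < ρ := by
      have := hp₁ s hsK
      rw [dist_comm] at this
      linarith [dist_triangle (x₁ p s) (x s) (x s₀), hs.1]
    have e2 : dist (x₂ p s) (x s₀) < ρ := by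
      have := hp₂ s hsK
      rw [dist_comm] at this
      linarith [dist_triangle (x₂ p s) (x s) (x s₀), hs.1]
    have e3 := hball (x₂ p s, x₁ p s) (by
      rw [mem_ball, Prod.dist_eq]
      exact max_lt e2 e1)
    have e4 : ‖(fderiv ℝ G (x s₀) - fderiv ℝ G (x s)) (x₂ p s - x₁ p s)‖
        ≤ η / 2 * ‖x₂ p s - x₁ p s‖ := by
      refine ContinuousLinearMap.le_of_opNorm_le _ ?_ _
      rw [← dist_eq_norm, dist_comm]
      exact hs.2.le
    calc _ = ‖(G (x₂ p s) - G (x₁ p s) - fderiv ℝ G (x s₀) (x₂ p s - x₁ p s)) +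
        (fderiv ℝ G (x s₀) - fderiv ℝ G (x s)) (x₂ p s - x₁ p s)‖ := by
          congr 1
          simp only [sub_apply]
          abel
      _ ≤ _ := norm_add_le _ _
      _ ≤ η / 2 * ‖x₂ p s - x₁ p s‖ + η / 2 * ‖x₂ p s - x₁ p s‖ := add_le_add e3 e4
      _ = _ := by ring

theorem tendstoUniformlyOn_pair {P T X X' : Type*} [PseudoMetricSpace X] [PseudoMetricSpace X']
    {l : Filter P} {f : P → T → X} {f' : P → T → X'} {g : T → X} {g' : T → X'} {K : Set T}
    (h : TendstoUniformlyOn f g l K) (h' : TendstoUniformlyOn f' g' l K) :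
    TendstoUniformlyOn (fun p t => (f p t, f' p t)) (fun t => (g t, g' t)) l K := by
  rw [Metric.tendstoUniformlyOn_iff] at *
  intro ε hε
  filter_upwards [h ε hε, h' ε hε] with p h1 h2 t ht
  exact max_lt (h1 t ht) (h2 t ht)

/-- Differentiable dependence of the solutions of `u' = μ G(b, u)` on parameters: the difference
of two solutions is given, to first order, by the solution of the linearized equation. -/
theorem eventually_norm_sub_le_of_linearized_ode {P FB E : Type*}
    [NormedAddCommGroup FB] [NormedSpace ℝ FB] [NormedAddCommGroup E] [NormedSpace ℝ E]
    {l : Filter P} {G : FB × E → E} {b b' : ℝ → FB} {u w : ℝ → E} {μ : ℝ}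
    (hb : ContinuousOn b (Icc 0 1)) (hb' : ContinuousOn b' (Icc 0 1))
    (hu : ContinuousOn u (Icc 0 1)) (hG : ∀ s ∈ Icc (0 : ℝ) 1, ContDiffAt ℝ 1 G (b s, u s))
    {u₁ u₂ : P → ℝ → E} {b₁ b₂ : P → ℝ → FB} {h : P → ℝ}
    (hode₁ : ∀ᶠ p in l, ∀ s ∈ Icc (0 : ℝ) 1,
      HasDerivWithinAt (u₁ p) (μ • G (b₁ p s, u₁ p s)) (Icc 0 1) s)
    (hode₂ : ∀ᶠ p in l, ∀ s ∈ Icc (0 : ℝ) 1,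
      HasDerivWithinAt (u₂ p) (μ • G (b₂ p s, u₂ p s)) (Icc 0 1) s)
    (hu₁ : TendstoUniformlyOn u₁ u l (Icc 0 1)) (hu₂ : TendstoUniformlyOn u₂ u l (Icc 0 1))
    (hb₁ : TendstoUniformlyOn b₁ b l (Icc 0 1)) (hb₂ : TendstoUniformlyOn b₂ b l (Icc 0 1))
    (hbb : ∀ ε > 0, ∀ᶠ p in l, ∀ s ∈ Icc (0 : ℝ) 1,
      ‖b₂ p s - b₁ p s - h p • b' s‖ ≤ ε * |h p|)
    (hw : ∀ s ∈ Icc (0 : ℝ) 1,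
      HasDerivWithinAt w (μ • fderiv ℝ G (b s, u s) (b' s, w s)) (Icc 0 1) s)
    (hw0 : (fun p => u₂ p 0 - u₁ p 0 - h p • w 0) =o[l] h) :
    ∀ ε > 0, ∀ᶠ p in l, ∀ s ∈ Icc (0 : ℝ) 1, ‖u₂ p s - u₁ p s - h p • w s‖ ≤ ε * |h p| := by
  intro ε hε
  have hx : ContinuousOn (fun s => (b s, u s)) (Icc 0 1) := hb.prodMk hu
  have hD : ContinuousOn (fun s => fderiv ℝ G (b s, u s)) (Icc 0 1) := fun s hs =>
    ((hG s hs).continuousAt_fderiv one_ne_zero).comp_continuousWithinAt (f := fun s => (b s, u s))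
      (hx s hs)
  have hwc : ContinuousOn w (Icc 0 1) := fun s hs => (hw s hs).continuousWithinAt
  obtain ⟨C, hC⟩ := isCompact_Icc.exists_bound_of_continuousOn hD
  obtain ⟨B, hB⟩ := isCompact_Icc.exists_bound_of_continuousOn hb'
  obtain ⟨R, hR⟩ := isCompact_Icc.exists_bound_of_continuousOn hwc
  have hC0 : 0 ≤ C := (norm_nonneg _).trans (hC 0 (by simp))
  have hB0 : 0 ≤ B := (norm_nonneg _).trans (hB 0 (by simp))
  have hR0 : 0 ≤ R := (norm_nonneg _).trans (hR 0 (by simp))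
  -- The error `d` of the solutions will satisfy `‖d'‖ ≤ |μ| (η + C) ‖d‖ + …`, and `η ≤ 1`.
  set K : ℝ := |μ| * (1 + C) with hK
  have hK0 : 0 ≤ K := by positivity
  obtain ⟨δ, hδ, hδε⟩ := exists_gronwallBound_lt hK0 hε
  set S : ℝ := |μ| * (1 + B + R + C) + 1 with hS
  have hS1 : 0 < S := by positivity
  -- The accuracy is chosen so that all remaining terms of the defect add up to at most `δ |h p|`.
  set η : ℝ := min 1 (δ / S) with hη
  have hη0 : 0 < η := by positivity
  have hηS : |μ| * (η * (1 + B + R + C)) ≤ δ := by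
    have h1 : η * S ≤ δ := by
      rw [← le_div_iff₀ hS1]
      exact min_le_right _ _
    have h2 : 0 ≤ η := hη0.le
    calc _ = η * (S - 1) := by rw [hS]; ring
      _ ≤ η * S := by gcongr; linarith
      _ ≤ δ := h1
  have hunif := eventually_forall_norm_sub_sub_le isCompact_Icc hx hG
    (x₁ := fun p s => (b₁ p s, u₁ p s)) (x₂ := fun p s => (b₂ p s, u₂ p s))
    (tendstoUniformlyOn_pair hb₁ hu₁) (tendstoUniformlyOn_pair hb₂ hu₂) hη0
  filter_upwards [hunif, hode₁, hode₂, hbb η hη0, hw0.def (show 0 < δ from hδ)] with p hp h1 h2 hbp h0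
  rw [Real.norm_eq_abs] at h0
  have hIco : ∀ s ∈ Ico (0 : ℝ) 1, s ∈ Icc (0 : ℝ) 1 := fun s hs => Ico_subset_Icc_self hs
  have hder : ∀ s ∈ Icc (0 : ℝ) 1, HasDerivWithinAt (fun s => u₂ p s - u₁ p s - h p • w s)
      (μ • G (b₂ p s, u₂ p s) - μ • G (b₁ p s, u₁ p s) -
        h p • μ • fderiv ℝ G (b s, u s) (b' s, w s)) (Icc 0 1) s := fun s hs =>
    ((h2 s hs).fun_sub (h1 s hs)).fun_sub ((hw s hs).fun_const_smul (h p))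
  have := norm_le_gronwallBound_of_norm_deriv_right_le
    (f := fun s => u₂ p s - u₁ p s - h p • w s) (δ := |h p| * δ) (K := K) (ε := |h p| * δ)
    (a := 0) (b := 1) (fun s hs => (hder s hs).continuousWithinAt)
    (fun s hs => (hder s (hIco s hs)).mono_of_mem_nhdsWithin
      (Filter.mem_of_superset (Icc_mem_nhdsGE hs.2) (Icc_subset_Icc_left hs.1)))
    (by rw [mul_comm]; exact h0) ?_
  · intro s hs
    refine (this s hs).trans ?_
    rw [gronwallBound_mul, mul_comm, sub_zero]
    gcongr
    exact (hδε s hs.2).le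
  · intro s hs
    have hs' := hIco s hs
    set d := u₂ p s - u₁ p s - h p • w s with hd
    set e := b₂ p s - b₁ p s - h p • b' s with he
    have e1 : ‖u₂ p s - u₁ p s‖ ≤ ‖d‖ + |h p| * R := by
      calc _ = ‖d + h p • w s‖ := by rw [hd]; congr 1; abel
        _ ≤ ‖d‖ + ‖h p • w s‖ := norm_add_le _ _
        _ ≤ _ := by
          rw [norm_smul, Real.norm_eq_abs]
          gcongr
          exact hR s hs'
    have e2 : ‖b₂ p s - b₁ p s‖ ≤ |h p| * (1 + B) := by
      calc _ = ‖e + h p • b' s‖ := by rw [he]; congr 1; abel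
        _ ≤ ‖e‖ + ‖h p • b' s‖ := norm_add_le _ _
        _ ≤ 1 * |h p| + |h p| * B := by
          rw [norm_smul, Real.norm_eq_abs]
          gcongr
          · exact (hbp s hs').trans (by gcongr; exact min_le_left _ _)
          · exact hB s hs'
        _ = _ := by ring
    have e3 : ‖(e, d)‖ ≤ η * |h p| + ‖d‖ := by
      rw [Prod.norm_def]
      refine max_le ((hbp s hs').trans (by simp)) (by simp; positivity)
    have e4 : ‖(b₂ p s, u₂ p s) - (b₁ p s, u₁ p s)‖ ≤ ‖d‖ + |h p| * (1 + B + R) := by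
      rw [Prod.mk_sub_mk, Prod.norm_def]
      refine max_le (e2.trans ?_) (e1.trans ?_)
      · nlinarith [norm_nonneg d, mul_nonneg (abs_nonneg (h p)) hR0]
      · nlinarith [mul_nonneg (abs_nonneg (h p)) hB0, abs_nonneg (h p)]
    -- The derivative of the error splits into the first order remainder of `G` and the
    -- linearization applied to the errors `e` of the driving curve and `d` of the solution.
    have e5 : μ • G (b₂ p s, u₂ p s) - μ • G (b₁ p s, u₁ p s) -
        h p • μ • fderiv ℝ G (b s, u s) (b' s, w s) =
        μ • ((G (b₂ p s, u₂ p s) - G (b₁ p s, u₁ p s) -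
          fderiv ℝ G (b s, u s) ((b₂ p s, u₂ p s) - (b₁ p s, u₁ p s))) +
          fderiv ℝ G (b s, u s) (e, d)) := by
      have : (e, d) = ((b₂ p s, u₂ p s) - (b₁ p s, u₁ p s)) - h p • (b' s, w s) := by
        simp [he, hd]
      rw [this, smul_comm (h p) μ]
      simp only [map_sub, map_smul, smul_add, smul_sub]
      abel
    rw [e5, norm_smul, Real.norm_eq_abs]
    have e6 := hp s hs'
    have e7 := (fderiv ℝ G (b s, u s)).le_of_opNorm_le (hC s hs') (e, d)
    calc |μ| * ‖_ + _‖ ≤ |μ| * (η * (‖d‖ + |h p| * (1 + B + R)) + C * (η * |h p| + ‖d‖)) := by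
          gcongr
          refine (norm_add_le _ _).trans (add_le_add (e6.trans ?_) (e7.trans ?_))
          · gcongr
          · gcongr
      _ = |μ| * (η + C) * ‖d‖ + |h p| * (|μ| * (η * (1 + B + R + C))) := by ring
      _ ≤ K * ‖d‖ + |h p| * δ := by
          rw [hK]
          gcongr
          exact min_le_left _ _

end StrictFamilies

/-! ### Velocities and strict differentiability of families of curves in manifolds. -/

section StrictAt

variable {Y : Type*} {E E' H H' : Type*} [NormedAddCommGroup E] [NormedSpace ℝ E]
  [NormedAddCommGroup E'] [NormedSpace ℝ E'] [TopologicalSpace H] [TopologicalSpace H']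
  {I : ModelWithCorners ℝ E H} {I' : ModelWithCorners ℝ E' H'}
  {Z Z' : Type*} [TopologicalSpace Z] [ChartedSpace H Z]
  [TopologicalSpace Z'] [ChartedSpace H' Z']

theorem HasDerivAtI.unique {u : Interval → E} {t : Interval} {D D' : E} (h : HasDerivAtI u D t)
    (h' : HasDerivAtI u D' t) : D = D' :=
  (uniqueDiffOn_Icc zero_lt_one t t.2).eq_deriv _ h h'

variable (I) in
/-- The velocity of a curve, as a curve in the tangent bundle. -/
noncomputable def velocity (c : Interval → Z) (t : Interval) : TangentBundle I Z :=
  ⟨c t, mfderiv (𝓡∂ 1) I c t (1 : TangentSpace (𝓡∂ 1) t)⟩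

/-- The derivative of a vector valued function along a tangent vector. -/
noncomputable def tderiv (ψ : Z → E') (v : TangentBundle I Z) : E' :=
  mfderiv I 𝓘(ℝ, E') ψ v.1 v.2

theorem tderiv_extChartAt [IsManifold I 1 Z] {z : Z} {v : TangentBundle I Z}
    (hv : v.1 ∈ (chartAt H z).source) :
    tderiv (extChartAt I z) v = (trivializationAt E (TangentSpace I) z v).2 := by
  have h1 : tderiv (extChartAt I z) v =
      (trivializationAt E (TangentSpace I) z).continuousLinearMapAt ℝ v.1 v.2 := by
    rw [TangentBundle.continuousLinearMapAt_trivializationAt (I := I) (M := Z) hv]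
    rfl
  rw [h1, Trivialization.continuousLinearMapAt_apply, Trivialization.coe_linearMapAt_of_mem]
  simpa using hv

theorem tderiv_extChartAt_self [IsManifold I 1 Z] (v : TangentBundle I Z) :
    tderiv (extChartAt I v.1) v = v.2 := by
  unfold tderiv
  rw [mfderiv_extChartAt_self]
  rfl

theorem hasDerivAtI_of_mdifferentiableAt {c : Interval → E} {t : Interval}
    (h : MDifferentiableAt (𝓡∂ 1) 𝓘(ℝ, E) c t) :
    HasDerivAtI c (show E from mfderiv (𝓡∂ 1) 𝓘(ℝ, E) c t (1 : TangentSpace (𝓡∂ 1) t)) t := by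
  have h1 := mdifferentiableWithinAt_comp_projIcc_iff.2 h
  rw [mdifferentiableWithinAt_iff_differentiableWithinAt] at h1
  have h2 := h1.hasDerivWithinAt
  have h3 := mfderivWithin_comp_projIcc_one (I := 𝓘(ℝ, E)) (f := c) (w := t)
  rw [mfderivWithin_eq_fderivWithin] at h3
  have h4 : derivWithin (c ∘ projIcc 0 1 zero_le_one) (Icc 0 1) (t : ℝ) =
      (show E from mfderiv (𝓡∂ 1) 𝓘(ℝ, E) c t (1 : TangentSpace (𝓡∂ 1) t)) := h3
  rw [h4] at h2
  exact h2

theorem hasDerivAtI_comp {c : Interval → Z} {t : Interval} (h : MDifferentiableAt (𝓡∂ 1) I c t)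
    {ψ : Z → E'} (hψ : MDifferentiableAt I 𝓘(ℝ, E') ψ (c t)) :
    HasDerivAtI (fun s => ψ (c s)) (tderiv ψ (velocity I c t)) t := by
  have h1 := hasDerivAtI_of_mdifferentiableAt (MDifferentiableAt.comp t hψ h)
  rw [mfderiv_comp t hψ h] at h1
  exact h1

/-- The chart centred at `c t` has derivative the identity there, so the coordinate derivative is
the velocity itself. -/
theorem mdifferentiableAt_of_hasDerivAtI [IsManifold I 1 Z] {c : Interval → Z} {t : Interval}
    (hc : ContinuousAt c t) {D : E} (h : HasDerivAtI (fun s => extChartAt I (c t) (c s)) D t) :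
    MDifferentiableAt (𝓡∂ 1) I c t ∧
      mfderiv (𝓡∂ 1) I c t (1 : TangentSpace (𝓡∂ 1) t) = D := by
  have h1 : MDifferentiableAt (𝓡∂ 1) I c t := by
    rw [← mdifferentiableWithinAt_comp_projIcc_iff, mdifferentiableWithinAt_iff_target]
    constructor
    · have : ContinuousAt (c ∘ projIcc 0 1 zero_le_one) (t : ℝ) := by
        refine ContinuousAt.comp ?_ continuous_projIcc.continuousAt
        rwa [projIcc_val]
      exact this.continuousWithinAt
    · have := h.differentiableWithinAt
      rw [mdifferentiableWithinAt_iff_differentiableWithinAt]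
      simpa only [Function.comp_def, projIcc_val] using this
  refine ⟨h1, ?_⟩
  have h2 := hasDerivAtI_comp h1 (mdifferentiableAt_extChartAt (I := I) (mem_chart_source H (c t)))
  exact (tderiv_extChartAt_self (velocity I c t)).symm.trans (h2.unique h)

variable [TopologicalSpace Y]

variable (I) in
/-- Strict differentiability of a continuous family of curves in a manifold. -/
def StrictAt (u : Y → Interval → Z) (y₀ : Y) (t₀ : Interval) : Prop :=
  ContinuousAt (fun p : Y × Interval => u p.1 p.2) (y₀, t₀) ∧
    ∃ D, HasStrictDerivFam (fun y t => extChartAt I (u y₀ t₀) (u y t)) (𝓝 y₀) t₀ D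

variable {u : Y → Interval → Z} {y₀ : Y} {t₀ : Interval}

theorem ContinuousAt.apply_right (h : ContinuousAt (fun p : Y × Interval => u p.1 p.2) (y₀, t₀)) :
    ContinuousAt (u y₀) t₀ :=
  h.comp (f := fun t => (y₀, t)) (by fun_prop)

theorem StrictAt.mdifferentiableAt [IsManifold I 1 Z] (h : StrictAt I u y₀ t₀) :
    MDifferentiableAt (𝓡∂ 1) I (u y₀) t₀ := by
  obtain ⟨hc, D, hD⟩ := h
  exact (mdifferentiableAt_of_hasDerivAtI hc.apply_right (hD.hasDerivAtI (pure_le_nhds y₀))).1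

variable [I.Boundaryless] [IsManifold I 1 Z]

omit [IsManifold I 1 Z] in
theorem contDiffAt_comp_extChartAt_symm {ψ : Z → E'} {n : WithTop ℕ∞} [IsManifold I n Z] {z z₁ : Z}
    (hz : z ∈ (chartAt H z₁).source) (hψ : ContMDiffAt I 𝓘(ℝ, E') n ψ z) :
    ContDiffAt ℝ n (fun x => ψ ((extChartAt I z₁).symm x)) (extChartAt I z₁ z) := by
  rw [← contMDiffAt_iff_contDiffAt]
  have hz' : z ∈ (extChartAt I z₁).source := by rwa [extChartAt_source]
  have h1 : ContMDiffAt 𝓘(ℝ, E) I n (extChartAt I z₁).symm (extChartAt I z₁ z) :=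
    (contMDiffOn_extChartAt_symm z₁).contMDiffAt
      ((isOpen_extChartAt_target z₁).mem_nhds ((extChartAt I z₁).map_source hz'))
  refine ContMDiffAt.comp (I' := I) _ ?_ h1
  rwa [(extChartAt I z₁).left_inv hz']

theorem HasStrictDerivFam.comp_contMDiffAt {z₁ : Z} {D : E}
    (hc : ContinuousAt (fun p : Y × Interval => u p.1 p.2) (y₀, t₀))
    (hz : u y₀ t₀ ∈ (chartAt H z₁).source)
    (h : HasStrictDerivFam (fun y t => extChartAt I z₁ (u y t)) (𝓝 y₀) t₀ D) {ψ : Z → E'}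
    (hψ : ContMDiffAt I 𝓘(ℝ, E') 1 ψ (u y₀ t₀)) :
    ∃ D', HasStrictDerivFam (fun y t => ψ (u y t)) (𝓝 y₀) t₀ D' := by
  have h1 := (contDiffAt_comp_extChartAt_symm hz hψ).hasStrictFDerivAt one_ne_zero
  have hc1 : Tendsto (fun p : Y × Interval => extChartAt I z₁ (u p.1 p.2)) (𝓝 y₀ ×ˢ 𝓝 t₀)
      (𝓝 (extChartAt I z₁ (u y₀ t₀))) := by
    rw [← nhds_prod_eq]
    exact (continuousAt_extChartAt' (by rwa [extChartAt_source])).tendsto.comp hc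
  refine ⟨_, (h.comp_strictFDeriv h1 hc1).congr ?_⟩
  rw [← nhds_prod_eq]
  filter_upwards [hc ((chartAt H z₁).open_source.mem_nhds hz)] with p hp
  rw [(extChartAt I z₁).left_inv (by rwa [extChartAt_source])]

/-- Strict differentiability may be tested in any chart around the point, not only in the preferred
one. -/
theorem StrictAt.of_chart {z₁ : Z} {D : E}
    (hc : ContinuousAt (fun p : Y × Interval => u p.1 p.2) (y₀, t₀))
    (hz : u y₀ t₀ ∈ (chartAt H z₁).source)
    (h : HasStrictDerivFam (fun y t => extChartAt I z₁ (u y t)) (𝓝 y₀) t₀ D) :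
    StrictAt I u y₀ t₀ :=
  ⟨hc, HasStrictDerivFam.comp_contMDiffAt hc hz h contMDiffAt_extChartAt⟩

/-- The strict derivative exists by composition; it is identified by uniqueness of the ordinary
derivative of the single curve `u y₀`. -/
theorem StrictAt.hasStrictDerivFam (h : StrictAt I u y₀ t₀) {ψ : Z → E'}
    (hψ : ContMDiffAt I 𝓘(ℝ, E') 1 ψ (u y₀ t₀)) :
    HasStrictDerivFam (fun y t => ψ (u y t)) (𝓝 y₀) t₀ (tderiv ψ (velocity I (u y₀) t₀)) := by
  obtain ⟨D', hD'⟩ := HasStrictDerivFam.comp_contMDiffAt h.1 (mem_chart_source H _)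
    h.2.choose_spec hψ
  have := (hD'.hasDerivAtI (pure_le_nhds y₀)).unique
    (hasDerivAtI_comp h.mdifferentiableAt (hψ.mdifferentiableAt one_ne_zero))
  rwa [this] at hD'

omit [I.Boundaryless] [IsManifold I 1 Z] in
theorem ContinuousAt.comp_fam {F : Z → Z'} (hF : ContinuousAt F (u y₀ t₀))
    (h : ContinuousAt (fun p : Y × Interval => u p.1 p.2) (y₀, t₀)) :
    ContinuousAt (fun p : Y × Interval => F (u p.1 p.2)) (y₀, t₀) :=
  ContinuousAt.comp (g := F) (f := fun p : Y × Interval => u p.1 p.2) hF h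

theorem StrictAt.comp_contMDiffAt [I'.Boundaryless] [IsManifold I' 1 Z'] (h : StrictAt I u y₀ t₀)
    {F : Z → Z'} (hF : ContMDiffAt I I' 1 F (u y₀ t₀)) :
    StrictAt I' (fun y t => F (u y t)) y₀ t₀ :=
  ⟨ContinuousAt.comp_fam hF.continuousAt h.1, _,
    h.hasStrictDerivFam (ContMDiffAt.comp _ contMDiffAt_extChartAt hF)⟩

/-- In the trivialization of the tangent bundle at the central point the velocity is a coordinate
derivative, which converges by `HasStrictDerivFam.tendsto_deriv`. With its converse
`strictAt_of_continuous_velocity`, this makes strict differentiability everywhere the same as joint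
continuity of velocities. -/
theorem StrictAt.continuousAt_velocity (h : ∀ᶠ p in 𝓝 (y₀, t₀), StrictAt I u p.1 p.2) :
    ContinuousAt (fun p : Y × Interval => velocity I (u p.1) p.2) (y₀, t₀) := by
  have h0 := h.self_of_nhds
  rw [FiberBundle.continuousAt_totalSpace]
  refine ⟨h0.1, ?_⟩
  have hsrc : ∀ᶠ p in 𝓝 (y₀, t₀), u p.1 p.2 ∈ (chartAt H (u y₀ t₀)).source :=
    h0.1 ((chartAt H _).open_source.mem_nhds (mem_chart_source H _))
  have h1 := (h0.hasStrictDerivFam (contMDiffAt_extChartAt (n := 1))).tendsto_deriv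
    (D' := fun y t => (trivializationAt E (TangentSpace I) (u y₀ t₀) (velocity I (u y) t)).2) ?_
  · refine Tendsto.congr' EventuallyEq.rfl (h1.mono_right (le_of_eq ?_))
    congr 1
    exact tderiv_extChartAt (mem_chart_source H (u y₀ t₀))
  · rw [← nhds_prod_eq]
    filter_upwards [h, hsrc] with p hp hps
    have h2 := hasDerivAtI_comp hp.mdifferentiableAt (mdifferentiableAt_extChartAt (I := I) hps)
    rwa [tderiv_extChartAt hps] at h2

omit [I.Boundaryless] in
theorem strictAt_of_continuous_velocity
    (h : ∀ y t, MDifferentiableAt (𝓡∂ 1) I (u y) t)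
    (hv : Continuous (fun p : Y × Interval => velocity I (u p.1) p.2)) : StrictAt I u y₀ t₀ := by
  have hv0 := hv.continuousAt (x := (y₀, t₀))
  rw [FiberBundle.continuousAt_totalSpace] at hv0
  have hc : ContinuousAt (fun p : Y × Interval => u p.1 p.2) (y₀, t₀) := hv0.1
  have hsrc : ∀ᶠ p in 𝓝 (y₀, t₀), u p.1 p.2 ∈ (chartAt H (u y₀ t₀)).source :=
    hc ((chartAt H _).open_source.mem_nhds (mem_chart_source H _))
  rw [nhds_prod_eq] at hsrc
  refine ⟨hc, (trivializationAt E (TangentSpace I) (u y₀ t₀) (velocity I (u y₀) t₀)).2,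
    HasStrictDerivFam.of_hasDerivAtI (D' := fun y t =>
    (trivializationAt E (TangentSpace I) (u y₀ t₀) (velocity I (u y) t)).2) ?_ ?_⟩
  rotate_left
  · rw [← nhds_prod_eq]
    exact hv0.2
  · filter_upwards [hsrc] with p hps
    have h2 := hasDerivAtI_comp (h p.1 p.2) (mdifferentiableAt_extChartAt (I := I) hps)
    rwa [tderiv_extChartAt hps] at h2

theorem StrictAt.continuous_velocity (h : ∀ y t, StrictAt I u y t) :
    Continuous (fun p : Y × Interval => velocity I (u p.1) p.2) :=
  continuous_iff_continuousAt.2 fun _ =>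
    StrictAt.continuousAt_velocity (Eventually.of_forall fun p => h p.1 p.2)

omit [I.Boundaryless] in
-- Read in a chart, the derivative is the fibre component of the velocity in a trivialization, hence
-- continuous near `t`.
theorem contMDiff_of_continuous_velocity {c : Interval → Z}
    (h : ∀ t, MDifferentiableAt (𝓡∂ 1) I c t) (hv : Continuous (velocity I c)) :
    ContMDiff (𝓡∂ 1) I 1 c := by
  intro t
  have hc : Continuous c := continuous_iff_continuousAt.2 fun t => (h t).continuousAt
  rw [← contMDiffWithinAt_comp_projIcc_iff, contMDiffWithinAt_iff_target]
  refine ⟨(hc.comp continuous_projIcc).continuousWithinAt, ?_⟩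
  set D : ℝ → E := fun s => (trivializationAt E (TangentSpace I) (c t)
    (velocity I c (projIcc 0 1 zero_le_one s))).2
  set O : Set ℝ := {s | c (projIcc 0 1 zero_le_one s) ∈ (chartAt H (c t)).source}
  have hO : IsOpen O := (chartAt H (c t)).open_source.preimage (hc.comp continuous_projIcc)
  have htO : (t : ℝ) ∈ O := by
    change c (projIcc 0 1 zero_le_one (t : ℝ)) ∈ (chartAt H (c t)).source
    rw [projIcc_val]
    exact mem_chart_source H _
  have hD : ContinuousOn D O := by
    have h1 : ContinuousOn (trivializationAt E (TangentSpace I) (c t))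
        (trivializationAt E (TangentSpace I) (c t)).source := Trivialization.continuousOn _
    refine continuous_snd.comp_continuousOn (h1.comp
      (hv.comp continuous_projIcc).continuousOn ?_)
    intro s hs
    rw [Trivialization.mem_source]
    simpa [velocity] using mem_ofPred.1 hs
  have hder : ∀ s ∈ O ∩ Icc 0 1, HasDerivWithinAt
      (fun s => extChartAt I (c t) (c (projIcc 0 1 zero_le_one s))) (D s) (O ∩ Icc 0 1) s := by
    rintro s ⟨hs, hs'⟩
    have hs1 : c ⟨s, hs'⟩ ∈ (chartAt H (c t)).source := by
      have h3 : c (projIcc 0 1 zero_le_one s) ∈ (chartAt H (c t)).source := hs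
      rwa [projIcc_of_mem zero_le_one hs'] at h3
    have h2 := hasDerivAtI_comp (h ⟨s, hs'⟩) (mdifferentiableAt_extChartAt (I := I) hs1)
    rw [tderiv_extChartAt (by exact hs1)] at h2
    have h4 : D s = (trivializationAt E (TangentSpace I) (c t) (velocity I c ⟨s, hs'⟩)).2 := by
      simp only [D]
      rw [projIcc_of_mem zero_le_one hs']
    rw [h4]
    exact HasDerivWithinAt.mono h2 inter_subset_right
  have key : ContDiffWithinAt ℝ 1
      (fun s => extChartAt I (c t) (c (projIcc 0 1 zero_le_one s))) (Icc 0 1) t := by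
    have : ContDiffWithinAt ℝ (0 + 1)
      (fun s => extChartAt I (c t) (c (projIcc 0 1 zero_le_one s))) (Icc 0 1) t := by
      rw [contDiffWithinAt_succ_iff_hasFDerivWithinAt (by simp)]
      refine ⟨O ∩ Icc 0 1, ?_, by simp, fun s => ContinuousLinearMap.toSpanSingleton ℝ (D s),
        fun s hs => hder s hs, ?_⟩
      · rw [insert_eq_of_mem t.2]
        exact inter_mem (mem_nhdsWithin_of_mem_nhds (hO.mem_nhds htO)) self_mem_nhdsWithin
      · refine ContDiffOn.contDiffWithinAt (s := O ∩ Icc 0 1) ?_ ⟨htO, t.2⟩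
        rw [contDiffOn_zero]
        exact (ContinuousLinearMap.toSpanSingletonCLE (𝕜 := ℝ)
          (E := E)).continuous.comp_continuousOn (hD.mono inter_subset_left)
    simpa using this
  rw [contMDiffWithinAt_iff_contDiffWithinAt]
  simpa only [Function.comp_def, projIcc_val] using key

end StrictAt

/-! ### Fibrewise multiplication and separation in vector bundles. -/

section FibreSMul

variable {E H : Type*} [NormedAddCommGroup E] [NormedSpace ℝ E] [TopologicalSpace H]
  {I : ModelWithCorners ℝ E H} {M : Type*} [TopologicalSpace M] [ChartedSpace H M]
  {F : Type*} [NormedAddCommGroup F] [NormedSpace ℝ F]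
  {V : M → Type*} [TopologicalSpace (TotalSpace F V)] [∀ x, TopologicalSpace (V x)]
  [∀ x, AddCommGroup (V x)] [∀ x, Module ℝ (V x)] [FiberBundle F V] [VectorBundle ℝ F V]

omit [(x : M) → TopologicalSpace (V x)] [FiberBundle F V] [VectorBundle ℝ F V] in
theorem trivialization_fibreSMul (e : Trivialization F (π F V)) [e.IsLinear ℝ] (r : ℝ)
    {v : TotalSpace F V} (hv : v.proj ∈ e.baseSet) : (e (fibreSMul r v)).2 = r • (e v).2 :=
  ((e.linear ℝ hv).map_smul r v.2)

theorem continuous_fibreSMul :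
    Continuous (fun p : ℝ × TotalSpace F V => fibreSMul p.1 p.2) := by
  rw [continuous_iff_continuousAt]
  rintro ⟨r, v⟩
  rw [FiberBundle.continuousAt_totalSpace]
  have hproj : Continuous (fun p : ℝ × TotalSpace F V => p.2.proj) :=
    (FiberBundle.continuous_proj F V).comp continuous_snd
  refine ⟨hproj.continuousAt, ?_⟩
  set e := trivializationAt F V v.proj with he
  have h1 : ContinuousAt (fun p : ℝ × TotalSpace F V => p.1 • (e p.2).2) (r, v) :=
    continuousAt_fst.smul (continuousAt_snd.comp ((e.continuousAt (x := v)
      (e.mem_source.2 (FiberBundle.mem_baseSet_trivializationAt' _))).comp continuousAt_snd))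
  refine h1.congr ?_
  filter_upwards [hproj.continuousAt (e.open_baseSet.mem_nhds
    (FiberBundle.mem_baseSet_trivializationAt' v.proj))] with p hp
  exact (trivialization_fibreSMul e p.1 hp).symm

theorem contMDiff_fibreSMul {n : WithTop ℕ∞} [ContMDiffVectorBundle n F V I] [IsManifold I n M] :
    ContMDiff (𝓘(ℝ, ℝ).prod (I.prod 𝓘(ℝ, F))) (I.prod 𝓘(ℝ, F)) n
      (fun p : ℝ × TotalSpace F V => fibreSMul p.1 p.2) := by
  rintro ⟨r, v⟩
  have hproj : ContMDiff (𝓘(ℝ, ℝ).prod (I.prod 𝓘(ℝ, F))) I n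
      (fun p : ℝ × TotalSpace F V => p.2.proj) := (contMDiff_proj V).comp contMDiff_snd
  rw [contMDiffAt_totalSpace]
  refine ⟨hproj.contMDiffAt, ?_⟩
  set e := trivializationAt F V v.proj with he
  have h2 : ContMDiffAt (I.prod 𝓘(ℝ, F)) 𝓘(ℝ, F) n (fun v : TotalSpace F V => (e v).2) v :=
    (contMDiffAt_totalSpace.1 contMDiffAt_id).2
  have h1 : ContMDiffAt (𝓘(ℝ, ℝ).prod (I.prod 𝓘(ℝ, F))) 𝓘(ℝ, F) n
      (fun p : ℝ × TotalSpace F V => p.1 • (e p.2).2) (r, v) :=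
    contMDiffAt_fst.smul (ContMDiffAt.comp (I' := I.prod 𝓘(ℝ, F)) (r, v)
      (g := fun v : TotalSpace F V => (e v).2) (f := Prod.snd) h2 contMDiffAt_snd)
  refine h1.congr_of_eventuallyEq ?_
  filter_upwards [hproj.continuous.continuousAt (e.open_baseSet.mem_nhds
    (FiberBundle.mem_baseSet_trivializationAt' v.proj))] with p hp
  exact trivialization_fibreSMul e p.1 hp

omit [(x : M) → AddCommGroup (V x)] in
omit [NormedSpace ℝ F] [(x : M) → Module ℝ (V x)] [VectorBundle ℝ F V] in
-- Points of one fibre are separated in a trivialization, points of different fibres in the base.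
-- This is needed for uniqueness of parallel curves.
theorem t2Space_totalSpace [T2Space M] : T2Space (TotalSpace F V) := by
  refine ⟨fun v w hvw => ?_⟩
  by_cases h : v.proj = w.proj
  · set e := trivializationAt F V v.proj
    have hv : v ∈ e.source := e.mem_source.2 (FiberBundle.mem_baseSet_trivializationAt' _)
    have hw : w ∈ e.source := e.mem_source.2 (h ▸ FiberBundle.mem_baseSet_trivializationAt' _)
    obtain ⟨s, t, hs, ht, hvs, hwt, hst⟩ := t2_separation (fun h => hvw (e.injOn hv hw h))
    exact ⟨_, _, e.toOpenPartialHomeomorph.isOpen_inter_preimage hs,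
      e.toOpenPartialHomeomorph.isOpen_inter_preimage ht, ⟨hv, hvs⟩, ⟨hw, hwt⟩,
      (hst.preimage e).mono inter_subset_right inter_subset_right⟩
  · obtain ⟨s, t, hs, ht, hvs, hwt, hst⟩ := t2_separation h
    exact ⟨_, _, hs.preimage (FiberBundle.continuous_proj F V),
      ht.preimage (FiberBundle.continuous_proj F V), hvs, hwt, hst.preimage _⟩

end FibreSMul

/-! ### The `C^1` topology on algebroid paths in terms of velocities. -/

section PathTopology

/-- The unit field on `[0, 1]` is the image of the unit field of the line under the tangent map of
the projection to the interval, also at the end points. -/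
theorem continuous_unitTangent :
    Continuous (fun t : Interval => (⟨t, 1⟩ : TangentBundle (𝓡∂ 1) Interval)) := by
  have h1 : ContinuousOn (tangentMapWithin 𝓘(ℝ, ℝ) (𝓡∂ 1) (projIcc (0 : ℝ) 1 zero_le_one) (Icc 0 1))
      (π ℝ (TangentSpace 𝓘(ℝ, ℝ)) ⁻¹' Icc 0 1) :=
    (contMDiffOn_projIcc (x := (0 : ℝ)) (y := 1) (n := 1)).continuousOn_tangentMapWithin le_rfl
      (uniqueDiffOn_Icc zero_lt_one).uniqueMDiffOn
  have h2 : Continuous (fun t : Interval => (⟨(t : ℝ), (1 : ℝ)⟩ : TangentBundle 𝓘(ℝ, ℝ) ℝ)) :=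
    (tangentBundleModelSpaceHomeomorph 𝓘(ℝ, ℝ)).symm.continuous.comp
      (continuous_subtype_val.prodMk continuous_const)
  have h3 := h1.comp_continuous h2 (fun t => t.2)
  refine h3.congr fun t => ?_
  have h4 : projIcc (0 : ℝ) 1 zero_le_one t = t := projIcc_val _ t
  have h5 : (mfderivWithin 𝓘(ℝ, ℝ) (𝓡∂ 1) (projIcc (0 : ℝ) 1 zero_le_one) (Icc 0 1) (t : ℝ)
      (1 : TangentSpace 𝓘(ℝ, ℝ) (t : ℝ)) : TangentSpace (𝓡∂ 1) (projIcc (0 : ℝ) 1 zero_le_one t))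
      = 1 := mfderivWithin_projIcc_one t.2
  change (⟨projIcc (0 : ℝ) 1 zero_le_one t, mfderivWithin 𝓘(ℝ, ℝ) (𝓡∂ 1)
    (projIcc (0 : ℝ) 1 zero_le_one) (Icc 0 1) (t : ℝ) (1 : TangentSpace 𝓘(ℝ, ℝ) (t : ℝ))⟩ :
      TangentBundle (𝓡∂ 1) Interval) = _
  rw [h5]
  rw [h4]

/-- The coefficient is the derivative of the inclusion into the line. It allows the whole tangent
map of a curve to be recovered from its velocity. -/
theorem exists_continuous_tangent_eq_smul : ∃ r : TangentBundle (𝓡∂ 1) Interval → ℝ,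
    Continuous r ∧ ∀ ξ, ξ.2 = r ξ • (1 : TangentSpace (𝓡∂ 1) ξ.1) := by
  refine ⟨fun ξ => (tangentMap (𝓡∂ 1) 𝓘(ℝ, ℝ) (Subtype.val : Interval → ℝ) ξ).2, ?_, ?_⟩
  · have h1 := (contMDiff_subtypeVal_Icc (x := (0 : ℝ)) (y := 1) (n := 1)).continuous_tangentMap
      le_rfl
    exact (contMDiff_snd_tangentBundle_modelSpace ℝ 𝓘(ℝ, ℝ) (n := 1)).continuous.comp h1
  · rintro ⟨t, ξ⟩
    have h1 : mfderiv (𝓡∂ 1) 𝓘(ℝ, ℝ) (Subtype.val : Interval → ℝ) t 1 = (1 : ℝ) :=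
      mfderiv_subtypeVal_Icc_one t
    have h0 : (1 : TangentSpace (𝓡∂ 1) t) ≠ 0 := by
      intro h
      have h2 : (0 : ℝ) = 1 := by
        rw [← h1, h, map_zero]
        rfl
      exact zero_ne_one h2
    have hfin : Module.finrank ℝ (TangentSpace (𝓡∂ 1) t) = 1 :=
      finrank_euclideanSpace_fin (𝕜 := ℝ) (n := 1)
    obtain ⟨c, hc⟩ := (finrank_eq_one_iff_of_nonzero' _ h0).1 hfin ξ
    have h2 : (tangentMap (𝓡∂ 1) 𝓘(ℝ, ℝ) (Subtype.val : Interval → ℝ) ⟨t, ξ⟩).2 = c := by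
      change mfderiv (𝓡∂ 1) 𝓘(ℝ, ℝ) (Subtype.val : Interval → ℝ) t ξ = c
      rw [← hc, map_smul, h1]
      exact mul_one c
    simp only
    rw [h2]
    exact hc.symm

variable {EM : Type*} [NormedAddCommGroup EM] [NormedSpace ℝ EM]
  {M : Type*} [TopologicalSpace M] [ChartedSpace EM M]
  {F : Type*} [NormedAddCommGroup F] [NormedSpace ℝ F]
  {V : M → Type*} [TopologicalSpace (TotalSpace F V)] [∀ x, TopologicalSpace (V x)]
  [∀ x, AddCommGroup (V x)] [∀ x, Module ℝ (V x)] [FiberBundle F V] [VectorBundle ℝ F V]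
  [IsManifold 𝓘(ℝ, EM) ∞ M] [ContMDiffVectorBundle ∞ F V 𝓘(ℝ, EM)] {A : LieAlgebroid EM F V}
  {Y : Type*} [TopologicalSpace Y]

instance isManifold_totalSpace_one : IsManifold (𝓘(ℝ, EM).prod 𝓘(ℝ, F)) 1 (TotalSpace F V) :=
  IsManifold.of_le (n := ∞) (by simp)

theorem LieAlgebroid.Path.mdifferentiable (a : A.Path) :
    MDifferentiable (𝓡∂ 1) (𝓘(ℝ, EM).prod 𝓘(ℝ, F)) a :=
  a.contMDiff_toFun.mdifferentiable one_ne_zero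

/-- The compact-open topology on tangent maps is uncurried. Restriction to the unit field gives the
velocities; multiplying velocities by the coefficient of a tangent vector gives back the tangent
maps. -/
theorem LieAlgebroid.continuous_path_iff_velocity {g : Y → A.Path} :
    Continuous g ↔ Continuous (fun p : Y × Interval =>
      velocity (𝓘(ℝ, EM).prod 𝓘(ℝ, F)) (g p.1) p.2) := by
  constructor
  · intro hg
    have h1 : Continuous (fun y => (g y).tangent) := continuous_induced_dom.comp hg
    have h2 : Continuous (fun y => (g y).tangent.comp ⟨_, continuous_unitTangent⟩) :=
      (ContinuousMap.continuous_precomp _).comp h1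
    exact ContinuousMap.continuous_uncurry_of_continuous ⟨_, h2⟩
  · intro hg
    rw [continuous_induced_rng]
    refine ContinuousMap.continuous_of_continuous_uncurry _ ?_
    obtain ⟨r, hr, hr'⟩ := exists_continuous_tangent_eq_smul
    have hproj : Continuous (fun ξ : TangentBundle (𝓡∂ 1) Interval => ξ.1) :=
      FiberBundle.continuous_proj _ _
    have h1 : Continuous (fun p : Y × TangentBundle (𝓡∂ 1) Interval =>
        fibreSMul (r p.2) (velocity (𝓘(ℝ, EM).prod 𝓘(ℝ, F)) (g p.1) p.2.1)) :=
      (continuous_fibreSMul (F := EM × F)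
        (V := TangentSpace (𝓘(ℝ, EM).prod 𝓘(ℝ, F)) (M := TotalSpace F V))).comp
        ((hr.comp continuous_snd).prodMk (hg.comp
          (continuous_fst.prodMk (hproj.comp continuous_snd))))
    refine h1.congr fun p => ?_
    obtain ⟨y, t, ξ⟩ := p
    have h2 := congrArg (mfderiv (𝓡∂ 1) (𝓘(ℝ, EM).prod 𝓘(ℝ, F)) (g y).toFun t) (hr' ⟨t, ξ⟩)
    exact TotalSpace.ext rfl (heq_of_eq ((map_smul _ _ _).symm.trans h2.symm))

/-- This replaces continuity into a path space by a condition at each parameter and time, which can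
be checked in charts and is stable under `C^1` maps. -/
theorem LieAlgebroid.continuous_path_iff {g : Y → A.Path} :
    Continuous g ↔ ∀ y t, StrictAt (𝓘(ℝ, EM).prod 𝓘(ℝ, F)) (fun y => (g y).toFun) y t := by
  rw [LieAlgebroid.continuous_path_iff_velocity]
  exact ⟨fun h y t => strictAt_of_continuous_velocity (fun y => (g y).mdifferentiable) h,
    fun h => StrictAt.continuous_velocity h⟩

theorem LieAlgebroid.Path.continuous (a : A.Path) : Continuous a.toFun :=
  a.contMDiff_toFun.continuous

theorem LieAlgebroid.Path.ext' {a b : A.Path} (h : ∀ t, a t = b t) : a = b := by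
  cases a
  cases b
  congr
  exact funext h

end PathTopology

/-! ### Global sections with prescribed germs, and locality of the bracket. -/

section Sections

variable {EM : Type*} [NormedAddCommGroup EM] [NormedSpace ℝ EM] [FiniteDimensional ℝ EM]
  {M : Type*} [TopologicalSpace M] [ChartedSpace EM M] [T2Space M] [IsManifold 𝓘(ℝ, EM) ∞ M]
  {F : Type*} [NormedAddCommGroup F] [NormedSpace ℝ F]
  {V : M → Type*} [TopologicalSpace (TotalSpace F V)] [∀ x, TopologicalSpace (V x)]
  [∀ x, AddCommGroup (V x)] [∀ x, Module ℝ (V x)] [FiberBundle F V] [VectorBundle ℝ F V]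
  [ContMDiffVectorBundle ∞ F V 𝓘(ℝ, EM)]

omit [ContMDiffVectorBundle ∞ F V 𝓘(ℝ, EM)] in
omit [FiniteDimensional ℝ EM] [T2Space M] [IsManifold 𝓘(ℝ, EM) ∞ M] in
@[simp]
theorem Sec.smul_apply (f : C^∞⟮𝓘(ℝ, EM), M; ℝ⟯) (s : Sec EM F V) (x : M) :
    Sec.smul f s x = f x • s x :=
  rfl

omit [ContMDiffVectorBundle ∞ F V 𝓘(ℝ, EM)] in
omit [FiniteDimensional ℝ EM] [T2Space M] [IsManifold 𝓘(ℝ, EM) ∞ M] in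
theorem Sec.sum_apply {ι : Type*} (S : Finset ι) (s : ι → Sec EM F V) (x : M) :
    (∑ i ∈ S, s i) x = ∑ i ∈ S, s i x := by
  classical
  induction S using Finset.induction_on with
  | empty => rfl
  | insert i S hi h => rw [Finset.sum_insert hi, Finset.sum_insert hi, ← h]; rfl

omit [ContMDiffVectorBundle ∞ F V 𝓘(ℝ, EM)] [∀ x, TopologicalSpace (V x)] [FiberBundle F V]
  [VectorBundle ℝ F V] [TopologicalSpace (TotalSpace F V)] [∀ x, AddCommGroup (V x)]
  [∀ x, Module ℝ (V x)] [NormedAddCommGroup F] [NormedSpace ℝ F] in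
theorem exists_bump {x : M} {u : Set M} (hu : u ∈ 𝓝 x) :
    ∃ ψ : C^∞⟮𝓘(ℝ, EM), M; ℝ⟯, tsupport ψ ⊆ u ∧ ∀ᶠ y in 𝓝 x, ψ y = 1 := by
  obtain ⟨f, -, hf⟩ := (SmoothBumpFunction.nhds_basis_tsupport (I := 𝓘(ℝ, EM)) x).mem_iff.1 hu
  exact ⟨⟨f, f.contMDiff⟩, hf, f.eventuallyEq_one⟩

omit [ContMDiffVectorBundle ∞ F V 𝓘(ℝ, EM)] in
theorem exists_sec_eventuallyEq {x : M} {u : Set M} (hu : u ∈ 𝓝 x) {s : ∀ x, V x}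
    (hs : ContMDiffOn 𝓘(ℝ, EM) (𝓘(ℝ, EM).prod 𝓘(ℝ, F)) ∞ (fun y => TotalSpace.mk' F y (s y)) u) :
    ∃ s' : Sec EM F V, ∀ᶠ y in 𝓝 x, s' y = s y := by
  obtain ⟨ψ, hψ, hψ1⟩ := exists_bump (EM := EM) (interior_mem_nhds.2 hu)
  refine ⟨⟨_, ContMDiffOn.smul_section_of_tsupport (I := 𝓘(ℝ, EM)) (n := ∞) (F := F) (ψ := ψ)
    ψ.contMDiff.contMDiffOn isOpen_interior hψ (hs.mono interior_subset)⟩, ?_⟩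
  filter_upwards [hψ1] with y hy
  change ψ y • s y = s y
  rw [hy, one_smul]

omit [ContMDiffVectorBundle ∞ F V 𝓘(ℝ, EM)] [∀ x, TopologicalSpace (V x)] [FiberBundle F V]
  [VectorBundle ℝ F V] [TopologicalSpace (TotalSpace F V)] [∀ x, AddCommGroup (V x)]
  [∀ x, Module ℝ (V x)] [NormedAddCommGroup F] [NormedSpace ℝ F] in
theorem exists_contMDiffMap_eventuallyEq {x : M} {u : Set M} (hu : u ∈ 𝓝 x) {f : M → ℝ}
    (hf : ContMDiffOn 𝓘(ℝ, EM) 𝓘(ℝ, ℝ) ∞ f u) :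
    ∃ f' : C^∞⟮𝓘(ℝ, EM), M; ℝ⟯, ∀ᶠ y in 𝓝 x, f' y = f y := by
  obtain ⟨ψ, hψ, hψ1⟩ := exists_bump (EM := EM) (interior_mem_nhds.2 hu)
  refine ⟨⟨fun y => ψ y * f y, contMDiff_of_tsupport fun y hy => ?_⟩, ?_⟩
  · have hy' : y ∈ interior u := hψ (closure_mono (fun z hz => left_ne_zero_of_mul hz) hy)
    exact (ψ.contMDiff y).mul ((hf.mono interior_subset).contMDiffAt
      (isOpen_interior.mem_nhds hy'))
  · filter_upwards [hψ1] with y hy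
    change ψ y * f y = f y
    rw [hy, one_mul]

/-- The bracket is only given on global sections, so local frames are realized as germs of global
ones. -/
theorem exists_sec_trivialization_eq (x : M) (w : F) :
    ∃ s : Sec EM F V, ∀ᶠ y in 𝓝 x, (trivializationAt F V x ⟨y, s y⟩).2 = w := by
  set e := trivializationAt F V x
  have hx : x ∈ e.baseSet := FiberBundle.mem_baseSet_trivializationAt' x
  obtain ⟨u, hu, hs⟩ := FiberBundle.exists_contMDiffOn_extend 𝓘(ℝ, EM) F (k := ∞) (e.symm x w)
  obtain ⟨s, hs⟩ := exists_sec_eventuallyEq hu hs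
  refine ⟨s, ?_⟩
  filter_upwards [hs, e.open_baseSet.mem_nhds hx] with y hy hy'
  rw [hy]
  simp only [FiberBundle.extend]
  rw [e.apply_mk_symm hy', e.apply_mk_symm hx]

theorem exists_sec_apply_eq {x : M} (v : V x) : ∃ s : Sec EM F V, s x = v := by
  obtain ⟨u, hu, hs⟩ := FiberBundle.exists_contMDiffOn_extend 𝓘(ℝ, EM) F (k := ∞) v
  obtain ⟨s, hs⟩ := exists_sec_eventuallyEq hu hs
  exact ⟨s, by rw [hs.self_of_nhds, FiberBundle.extend_apply_self]⟩

omit [T2Space M] [FiniteDimensional ℝ EM] [IsManifold 𝓘(ℝ, EM) ∞ M] in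
theorem Sec.contMDiffAt_trivialization (s : Sec EM F V) (e : Trivialization F (π F V))
    [MemTrivializationAtlas e] {x : M} (hx : x ∈ e.baseSet) :
    ContMDiffAt 𝓘(ℝ, EM) 𝓘(ℝ, F) ∞ (fun y => (e ⟨y, s y⟩).2) x :=
  (e.contMDiffAt_section_iff hx).1 (s.contMDiff x)

omit [(x : M) → TopologicalSpace (V x)] [FiberBundle F V] [VectorBundle ℝ F V] in
omit [T2Space M] [FiniteDimensional ℝ EM] [IsManifold 𝓘(ℝ, EM) ∞ M]
  [ContMDiffVectorBundle ∞ F V 𝓘(ℝ, EM)] in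
theorem trivialization_sum (e : Trivialization F (π F V)) [e.IsLinear ℝ] {x : M}
    (hx : x ∈ e.baseSet) {ι : Type*} (S : Finset ι) (v : ι → V x) :
    (e ⟨x, ∑ i ∈ S, v i⟩).2 = ∑ i ∈ S, (e ⟨x, v i⟩).2 :=
  map_sum (IsLinearMap.mk' _ (e.linear ℝ hx)) v S

omit [(x : M) → TopologicalSpace (V x)] [FiberBundle F V] [VectorBundle ℝ F V] in
omit [T2Space M] [FiniteDimensional ℝ EM] [IsManifold 𝓘(ℝ, EM) ∞ M]
  [ContMDiffVectorBundle ∞ F V 𝓘(ℝ, EM)] in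
theorem trivialization_add (e : Trivialization F (π F V)) [e.IsLinear ℝ] {x : M}
    (hx : x ∈ e.baseSet) (v w : V x) :
    (e ⟨x, v + w⟩).2 = (e ⟨x, v⟩).2 + (e ⟨x, w⟩).2 :=
  (e.linear ℝ hx).map_add v w

omit [(x : M) → TopologicalSpace (V x)] [FiberBundle F V] [VectorBundle ℝ F V] in
omit [T2Space M] [FiniteDimensional ℝ EM] [IsManifold 𝓘(ℝ, EM) ∞ M]
  [ContMDiffVectorBundle ∞ F V 𝓘(ℝ, EM)] in
theorem trivialization_smul (e : Trivialization F (π F V)) [e.IsLinear ℝ] {x : M}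
    (hx : x ∈ e.baseSet) (r : ℝ) (v : V x) : (e ⟨x, r • v⟩).2 = r • (e ⟨x, v⟩).2 :=
  (e.linear ℝ hx).map_smul r v

omit [(x : M) → TopologicalSpace (V x)] [FiberBundle F V] [VectorBundle ℝ F V] in
omit [T2Space M] [FiniteDimensional ℝ EM] [IsManifold 𝓘(ℝ, EM) ∞ M]
  [ContMDiffVectorBundle ∞ F V 𝓘(ℝ, EM)] in
theorem trivialization_injective (e : Trivialization F (π F V)) [e.IsLinear ℝ] {x : M}
    (hx : x ∈ e.baseSet) {v w : V x} (h : (e ⟨x, v⟩).2 = (e ⟨x, w⟩).2) : v = w := by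
  refine (e.linearEquivAt ℝ x hx).injective ?_
  simpa using h

omit [(x : M) → TopologicalSpace (V x)] [FiberBundle F V] [VectorBundle ℝ F V] in
omit [T2Space M] [FiniteDimensional ℝ EM] [IsManifold 𝓘(ℝ, EM) ∞ M]
  [ContMDiffVectorBundle ∞ F V 𝓘(ℝ, EM)] in
/-- Expansion of a vector in a frame which is constant in a trivialization. -/
theorem eq_sum_repr_smul (e : Trivialization F (π F V)) [e.IsLinear ℝ] {x : M}
    (hx : x ∈ e.baseSet) {ι : Type*} [Fintype ι] (b : Module.Basis ι ℝ F) {ε : ι → V x}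
    (hε : ∀ j, (e ⟨x, ε j⟩).2 = b j) (v : V x) :
    v = ∑ j, b.repr (e ⟨x, v⟩).2 j • ε j := by
  refine trivialization_injective e hx ?_
  rw [trivialization_sum e hx]
  simp only [trivialization_smul e hx, hε]
  exact (b.sum_repr _).symm

variable (A : LieAlgebroid EM F V)

omit [FiniteDimensional ℝ EM] [T2Space M] in
theorem LieAlgebroid.bracket_zero (σ : Sec EM F V) : A.bracket σ 0 = 0 := by
  have := A.bracket_smul 0 σ 0
  simpa using this

omit [FiniteDimensional ℝ EM] [T2Space M] in
theorem LieAlgebroid.bracket_sum {ι : Type*} (S : Finset ι) (σ : Sec EM F V)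
    (s : ι → Sec EM F V) : A.bracket σ (∑ i ∈ S, s i) = ∑ i ∈ S, A.bracket σ (s i) := by
  classical
  induction S using Finset.induction_on with
  | empty => simpa using A.bracket_zero σ
  | insert i S hi h => rw [Finset.sum_insert hi, Finset.sum_insert hi, ← h, A.bracket_add]

omit [FiniteDimensional ℝ EM] [T2Space M] in
theorem LieAlgebroid.sum_smul_bracket {ι : Type*} (S : Finset ι) (r : ι → ℝ)
    (s : ι → Sec EM F V) (κ : Sec EM F V) :
    A.bracket (∑ i ∈ S, r i • s i) κ = ∑ i ∈ S, r i • A.bracket (s i) κ := by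
  rw [A.bracket_skew, A.bracket_sum, ← Finset.sum_neg_distrib]
  refine Finset.sum_congr rfl fun i _ => ?_
  rw [A.bracket_smul, A.bracket_skew κ, smul_neg, neg_neg]

/-- With a bump function `ψ` supported where the sections agree, `ψ (κ - κ')` vanishes identically.
The Leibniz rule at `x`, where `ψ = 1` and `κ - κ' = 0`, then gives `[σ, κ - κ'](x) = 0`. -/
theorem LieAlgebroid.bracket_congr (σ : Sec EM F V) {κ κ' : Sec EM F V} {x : M}
    (h : ∀ᶠ y in 𝓝 x, κ y = κ' y) : A.bracket σ κ x = A.bracket σ κ' x := by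
  obtain ⟨ψ, hψ, hψ1⟩ := exists_bump (EM := EM) h
  have h0 : Sec.smul ψ (κ - κ') = 0 := by
    ext y
    by_cases hy : y ∈ tsupport ψ
    · have : κ y = κ' y := hψ hy
      change ψ y • (κ y - κ' y) = 0
      rw [this, sub_self, smul_zero]
    · change ψ y • (κ y - κ' y) = 0
      rw [image_eq_zero_of_notMem_tsupport hy, zero_smul]
  have h1 := A.leibniz ψ σ (κ - κ') x
  have h2 : (κ - κ') x = 0 := sub_eq_zero.2 h.self_of_nhds
  rw [h0, A.bracket_zero, h2, smul_zero, add_zero, hψ1.self_of_nhds, one_smul] at h1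
  have h3 : A.bracket σ κ = A.bracket σ κ' + A.bracket σ (κ - κ') := by
    rw [← A.bracket_add, add_sub_cancel]
  rw [h3]
  change A.bracket σ κ' x + A.bracket σ (κ - κ') x = _
  rw [← h1]
  exact add_zero _

/-- The bracket with a section, read in a trivialization. -/
theorem LieAlgebroid.trivialization_bracket {e : Trivialization F (π F V)}
    [MemTrivializationAtlas e] {x : M} (hx : x ∈ e.baseSet) {ι : Type*} [Fintype ι]
    [FiniteDimensional ℝ F]
    (b : Module.Basis ι ℝ F) {ε : ι → Sec EM F V}
    (hε : ∀ᶠ y in 𝓝 x, ∀ j, (e ⟨y, ε j y⟩).2 = b j) (σ κ : Sec EM F V) :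
    (e ⟨x, A.bracket σ κ x⟩).2 =
      (show F from mfderiv 𝓘(ℝ, EM) 𝓘(ℝ, F) (fun y => (e ⟨y, κ y⟩).2) x (A.anchor x (σ x)))
      + ∑ j, b.repr (e ⟨x, κ x⟩).2 j • (e ⟨x, A.bracket σ (ε j) x⟩).2 := by
  set k : M → F := fun y => (e ⟨y, κ y⟩).2 with hk
  have hkx := (κ.contMDiffAt_trivialization e hx).mdifferentiableAt (by simp)
  have hco (j : ι) : ContMDiff 𝓘(ℝ, F) 𝓘(ℝ, ℝ) ∞ (fun w : F => b.repr w j) :=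
    (LinearMap.toContinuousLinearMap (b.coord j)).contMDiff
  have hkj (j : ι) : ContMDiffOn 𝓘(ℝ, EM) 𝓘(ℝ, ℝ) ∞ (fun y => b.repr (k y) j) e.baseSet :=
    fun y hy => ((hco j).contMDiffAt.comp y
      (κ.contMDiffAt_trivialization e hy)).contMDiffWithinAt
  choose f hf using fun j => exists_contMDiffMap_eventuallyEq (e.open_baseSet.mem_nhds hx) (hkj j)
  -- By locality `κ` may be replaced by its frame expansion with global coefficient functions, to
  -- which the Leibniz rule applies.
  have h1 : ∀ᶠ y in 𝓝 x, κ y = (∑ j, Sec.smul (f j) (ε j)) y := by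
    filter_upwards [hε, e.open_baseSet.mem_nhds hx, eventually_all.2 hf] with y h1 h2 h3
    rw [Sec.sum_apply, eq_sum_repr_smul e h2 b h1 (κ y)]
    simp only [Sec.smul_apply, h3]
    rfl
  have hder (j : ι) : (show ℝ from mfderiv 𝓘(ℝ, EM) 𝓘(ℝ, ℝ) (f j) x (A.anchor x (σ x))) =
      b.repr (show F from mfderiv 𝓘(ℝ, EM) 𝓘(ℝ, F) k x (A.anchor x (σ x))) j := by
    have h2 : (f j : M → ℝ) =ᶠ[𝓝 x] (fun w : F => b.repr w j) ∘ k := hf j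
    rw [h2.mfderiv_eq, mfderiv_comp x ((hco j).contMDiffAt.mdifferentiableAt (by simp)) hkx]
    have h3 : mfderiv 𝓘(ℝ, F) 𝓘(ℝ, ℝ) (fun w : F => b.repr w j) (k x) =
      LinearMap.toContinuousLinearMap (b.coord j) := by
      rw [mfderiv_eq_fderiv]
      exact (LinearMap.toContinuousLinearMap (b.coord j)).fderiv
    rw [h3]
    rfl
  have hεx := hε.self_of_nhds
  rw [A.bracket_congr σ h1, A.bracket_sum, Sec.sum_apply, trivialization_sum e hx]
  simp only [A.leibniz, trivialization_add e hx, trivialization_smul e hx,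
    (hf _).self_of_nhds]
  rw [Finset.sum_add_distrib, add_comm]
  congr 1
  refine Eq.trans (Finset.sum_congr rfl fun j _ => ?_) (b.sum_repr _)
  rw [← hder, ← hεx]
  exact trivialization_smul e hx _ _

end Sections

/-! ### Lie brackets of vector fields in charts. -/

section VectorFields

variable {EM : Type*} [NormedAddCommGroup EM] [NormedSpace ℝ EM]
  {M : Type*} [TopologicalSpace M] [ChartedSpace EM M] [IsManifold 𝓘(ℝ, EM) ∞ M]

/-- A vector field read in the chart at `x₀`. -/
noncomputable def chartField (x₀ : M) (U : ∀ x : M, TangentSpace 𝓘(ℝ, EM) x) (ξ : EM) : EM :=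
  tderiv (extChartAt 𝓘(ℝ, EM) x₀) (⟨_, U ((extChartAt 𝓘(ℝ, EM) x₀).symm ξ)⟩ :
    TangentBundle 𝓘(ℝ, EM) M)

theorem contMDiffAt_tderiv_extChartAt {x₀ x : M} {U : ∀ x : M, TangentSpace 𝓘(ℝ, EM) x}
    (hx : x ∈ (chartAt EM x₀).source)
    (hU : ContMDiffAt 𝓘(ℝ, EM) 𝓘(ℝ, EM).tangent 1
      (fun y => (⟨y, U y⟩ : TangentBundle 𝓘(ℝ, EM) M)) x) :
    ContMDiffAt 𝓘(ℝ, EM) 𝓘(ℝ, EM) 1 (fun y => tderiv (extChartAt 𝓘(ℝ, EM) x₀)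
      (⟨y, U y⟩ : TangentBundle 𝓘(ℝ, EM) M)) x := by
  have h1 := ((trivializationAt EM (TangentSpace 𝓘(ℝ, EM)) x₀).contMDiffAt_section_iff
    (IB := 𝓘(ℝ, EM)) (n := 1) (s := U) (by simpa using hx)).1 hU
  refine h1.congr_of_eventuallyEq ?_
  filter_upwards [(chartAt EM x₀).open_source.mem_nhds hx] with y hy
  exact tderiv_extChartAt hy

theorem contDiffAt_chartField {x₀ x : M} {U : ∀ x : M, TangentSpace 𝓘(ℝ, EM) x}
    (hx : x ∈ (chartAt EM x₀).source)
    (hU : ContMDiffAt 𝓘(ℝ, EM) 𝓘(ℝ, EM).tangent 1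
      (fun y => (⟨y, U y⟩ : TangentBundle 𝓘(ℝ, EM) M)) x) :
    ContDiffAt ℝ 1 (chartField x₀ U) (extChartAt 𝓘(ℝ, EM) x₀ x) :=
  contDiffAt_comp_extChartAt_symm hx (contMDiffAt_tderiv_extChartAt hx hU)

theorem mpullback_extChartAt_symm {x₀ : M} (U : ∀ x : M, TangentSpace 𝓘(ℝ, EM) x) {ξ : EM}
    (hξ : ξ ∈ (extChartAt 𝓘(ℝ, EM) x₀).target) :
    VectorField.mpullback 𝓘(ℝ, EM) 𝓘(ℝ, EM) (extChartAt 𝓘(ℝ, EM) x₀).symm U ξ =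
      chartField x₀ U ξ := by
  have h1 := mfderiv_extChartAt_comp_mfderivWithin_extChartAt_symm hξ
  have h2 := mfderivWithin_extChartAt_symm_comp_mfderiv_extChartAt hξ
  rw [ModelWithCorners.range_eq_univ, mfderivWithin_univ] at h1 h2
  rw [VectorField.mpullback_apply, ContinuousLinearMap.inverse_eq h2 h1]
  rfl

/-- Naturality of the Lie bracket under pull-back by the inverse chart, where it becomes the usual
coordinate formula. -/
theorem tderiv_mlieBracket [CompleteSpace EM] {x₀ x : M}
    {U W : ∀ x : M, TangentSpace 𝓘(ℝ, EM) x} (hx : x ∈ (chartAt EM x₀).source)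
    (hU : ContMDiffAt 𝓘(ℝ, EM) 𝓘(ℝ, EM).tangent 1
      (fun y => (⟨y, U y⟩ : TangentBundle 𝓘(ℝ, EM) M)) x)
    (hW : ContMDiffAt 𝓘(ℝ, EM) 𝓘(ℝ, EM).tangent 1
      (fun y => (⟨y, W y⟩ : TangentBundle 𝓘(ℝ, EM) M)) x) :
    tderiv (extChartAt 𝓘(ℝ, EM) x₀)
      (⟨x, VectorField.mlieBracket 𝓘(ℝ, EM) U W x⟩ : TangentBundle 𝓘(ℝ, EM) M) =
      fderiv ℝ (chartField x₀ W) (extChartAt 𝓘(ℝ, EM) x₀ x)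
        (chartField x₀ U (extChartAt 𝓘(ℝ, EM) x₀ x)) -
      fderiv ℝ (chartField x₀ U) (extChartAt 𝓘(ℝ, EM) x₀ x)
        (chartField x₀ W (extChartAt 𝓘(ℝ, EM) x₀ x)) := by
  have hx' : x ∈ (extChartAt 𝓘(ℝ, EM) x₀).source := by rwa [extChartAt_source]
  have hξ := (extChartAt 𝓘(ℝ, EM) x₀).map_source hx'
  have hopen := (isOpen_extChartAt_target (I := 𝓘(ℝ, EM)) x₀).mem_nhds hξ
  have hs : ContMDiffAt 𝓘(ℝ, EM) 𝓘(ℝ, EM) 2 (extChartAt 𝓘(ℝ, EM) x₀).symm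
      (extChartAt 𝓘(ℝ, EM) x₀ x) := (contMDiffOn_extChartAt_symm x₀).contMDiffAt hopen
  have hUx : MDifferentiableAt 𝓘(ℝ, EM) 𝓘(ℝ, EM).tangent
      (fun y => (⟨y, U y⟩ : TangentBundle 𝓘(ℝ, EM) M))
      ((extChartAt 𝓘(ℝ, EM) x₀).symm (extChartAt 𝓘(ℝ, EM) x₀ x)) := by
    rw [(extChartAt 𝓘(ℝ, EM) x₀).left_inv hx']
    exact hU.mdifferentiableAt one_ne_zero
  have hWx : MDifferentiableAt 𝓘(ℝ, EM) 𝓘(ℝ, EM).tangent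
      (fun y => (⟨y, W y⟩ : TangentBundle 𝓘(ℝ, EM) M))
      ((extChartAt 𝓘(ℝ, EM) x₀).symm (extChartAt 𝓘(ℝ, EM) x₀ x)) := by
    rw [(extChartAt 𝓘(ℝ, EM) x₀).left_inv hx']
    exact hW.mdifferentiableAt one_ne_zero
  have : IsManifold 𝓘(ℝ, EM) (minSmoothness ℝ 2) M := by
    rw [minSmoothness_of_isRCLikeNormedField]
    infer_instance
  have h1 := VectorField.mpullback_mlieBracket (I := 𝓘(ℝ, EM)) (I' := 𝓘(ℝ, EM)) (n := 2)
    hUx hWx hs (by simp)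
  rw [mpullback_extChartAt_symm _ hξ] at h1
  have h2 (U : ∀ x : M, TangentSpace 𝓘(ℝ, EM) x) :
      VectorField.mpullback 𝓘(ℝ, EM) 𝓘(ℝ, EM) (extChartAt 𝓘(ℝ, EM) x₀).symm U
      =ᶠ[𝓝 (extChartAt 𝓘(ℝ, EM) x₀ x)] chartField x₀ U := by
    filter_upwards [hopen] with ξ hξ
    exact mpullback_extChartAt_symm U hξ
  have h3 (U W : ∀ ξ : EM, TangentSpace 𝓘(ℝ, EM) ξ) : VectorField.mlieBracket 𝓘(ℝ, EM) U W =
      VectorField.lieBracket ℝ U W := by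
    rw [← VectorField.mlieBracketWithin_univ, VectorField.mlieBracketWithin_eq_lieBracketWithin]
    exact VectorField.lieBracketWithin_univ
  have h4 := h1.trans (((h2 U).mlieBracket_vectorField_eq (h2 W)).trans (congrFun (h3 _ _) _))
  refine Eq.trans ?_ h4
  unfold chartField
  rw [(extChartAt 𝓘(ℝ, EM) x₀).left_inv hx']

end VectorFields

/-! ### Vertical lifts and coordinates on total spaces. -/

section VerticalLift

variable {EM : Type*} [NormedAddCommGroup EM] [NormedSpace ℝ EM]
  {M : Type*} [TopologicalSpace M] [ChartedSpace EM M] [IsManifold 𝓘(ℝ, EM) ∞ M]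
  {F : Type*} [NormedAddCommGroup F] [NormedSpace ℝ F]
  {V : M → Type*} [TopologicalSpace (TotalSpace F V)] [∀ x, TopologicalSpace (V x)]
  [∀ x, AddCommGroup (V x)] [∀ x, Module ℝ (V x)] [FiberBundle F V] [VectorBundle ℝ F V]
  [ContMDiffVectorBundle ∞ F V 𝓘(ℝ, EM)]
  {E' : Type*} [NormedAddCommGroup E'] [NormedSpace ℝ E']

omit [IsManifold 𝓘(ℝ, EM) ∞ M] [ContMDiffVectorBundle ∞ F V 𝓘(ℝ, EM)] in
theorem mfderiv_vertLift {x : M} (v w : V x) {ψ : TotalSpace F V → E'}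
    (hψ : MDifferentiableAt (𝓘(ℝ, EM).prod 𝓘(ℝ, F)) 𝓘(ℝ, E') ψ ⟨x, v⟩) :
    mfderiv (𝓘(ℝ, EM).prod 𝓘(ℝ, F)) 𝓘(ℝ, E') ψ ⟨x, v⟩ (vertLift (EM := EM) x v w) =
      deriv (fun s : ℝ => ψ ⟨x, v + s • w⟩) 0 := by
  have hx : x ∈ (trivializationAt F V x).baseSet := FiberBundle.mem_baseSet_trivializationAt' x
  have h1 : ContMDiffAt 𝓘(ℝ, ℝ) (𝓘(ℝ, EM).prod 𝓘(ℝ, F)) ∞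
      (fun s : ℝ => (⟨x, v + s • w⟩ : TotalSpace F V)) 0 := by
    rw [contMDiffAt_totalSpace]
    refine ⟨contMDiffAt_const, ?_⟩
    simp only [trivialization_add _ hx, trivialization_smul _ hx]
    have : ContDiff ℝ ∞ (fun s : ℝ => (trivializationAt F V x ⟨x, v⟩).2 +
      s • (trivializationAt F V x ⟨x, w⟩).2) := by fun_prop
    exact this.contMDiff.contMDiffAt
  have h0 : (⟨x, v⟩ : TotalSpace F V) = ⟨x, v + (0 : ℝ) • w⟩ := by rw [zero_smul, add_zero]
  have h2 := mfderiv_comp_of_eq (x := (0 : ℝ)) (f := fun s : ℝ =>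
    (⟨x, v + s • w⟩ : TotalSpace F V)) hψ (h1.mdifferentiableAt (by simp)) h0.symm
  have h3 := congrArg (fun L => L (1 : ℝ)) h2
  rw [mfderiv_eq_fderiv] at h3
  -- The base points `⟨x, v⟩` and `⟨x, v + 0 • w⟩` are equal but not definitionally so; the
  -- derivative, viewed with values in a fixed space, is moved from one to the other.
  let Φ : TotalSpace F V → (EM × F →L[ℝ] E') :=
    fun z => mfderiv (𝓘(ℝ, EM).prod 𝓘(ℝ, F)) 𝓘(ℝ, E') ψ z
  have h4 : Φ ⟨x, v⟩ = Φ ⟨x, v + (0 : ℝ) • w⟩ := congrArg Φ h0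
  exact (congrArg (fun L : EM × F →L[ℝ] E' => L (vertLift (EM := EM) x v w)) h4).trans
    (h3.symm.trans (fderiv_apply_one_eq_deriv (𝕜 := ℝ)
      (f := fun s : ℝ => ψ ⟨x, v + s • w⟩) (x := 0)))

end VerticalLift


section ChartTotalSpace

variable {EM : Type*} [NormedAddCommGroup EM] [NormedSpace ℝ EM]
  {M : Type*} [TopologicalSpace M] [ChartedSpace EM M]
  {F : Type*} [NormedAddCommGroup F] [NormedSpace ℝ F]
  {V : M → Type*} [TopologicalSpace (TotalSpace F V)] [∀ x, TopologicalSpace (V x)]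
  [∀ x, AddCommGroup (V x)] [∀ x, Module ℝ (V x)] [FiberBundle F V] [VectorBundle ℝ F V]

omit [(x : M) → AddCommGroup (V x)] in
omit [(x : M) → Module ℝ (V x)] [VectorBundle ℝ F V] in
theorem extChartAt_totalSpace_apply {z v : TotalSpace F V}
    (hv : v.proj ∈ (trivializationAt F V z.proj).baseSet) :
    extChartAt (𝓘(ℝ, EM).prod 𝓘(ℝ, F)) z v =
      (extChartAt 𝓘(ℝ, EM) z.proj v.proj, (trivializationAt F V z.proj v).2) := by
  rw [FiberBundle.extChartAt]
  change (extChartAt 𝓘(ℝ, EM) z.proj (trivializationAt F V z.proj v).1, _) = _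
  rw [(trivializationAt F V z.proj).coe_fst' hv]
  rfl

end ChartTotalSpace

/-- The coordinate expression of adding a horizontal lift, `(v, b) ↦ v + h(b)`. -/
theorem contDiffAt_add_clm_apply {E₁ E₂ E₃ : Type*} [NormedAddCommGroup E₁] [NormedSpace ℝ E₁]
    [NormedAddCommGroup E₂] [NormedSpace ℝ E₂] [NormedAddCommGroup E₃] [NormedSpace ℝ E₃]
    {L : E₁ → E₃ →L[ℝ] E₂} {q : (E₁ × E₂) × E₃} {n : WithTop ℕ∞} (hL : ContDiffAt ℝ n L q.1.1) :
    ContDiffAt ℝ n (fun q : (E₁ × E₂) × E₃ => (q.1.1, q.1.2 + L q.1.1 q.2)) q := by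
  have h2 : ContDiffAt ℝ n (fun q : (E₁ × E₂) × E₃ => L q.1.1) q :=
    ContDiffAt.comp (g := L) (f := fun q : (E₁ × E₂) × E₃ => q.1.1) q hL
      contDiffAt_fst.fst
  exact contDiffAt_fst.fst.prodMk (contDiffAt_fst.snd.add (h2.clm_apply contDiffAt_snd))

/-! ### Horizontal lifts, the vertical projection, and compatibility with anchors. -/

section Lift

variable {EX : Type*} [NormedAddCommGroup EX] [NormedSpace ℝ EX]
  {X : Type*} [TopologicalSpace X] [ChartedSpace EX X] [IsManifold 𝓘(ℝ, EX) ∞ X]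
  {FE : Type*} [NormedAddCommGroup FE] [NormedSpace ℝ FE]
  {VE : X → Type*} [TopologicalSpace (TotalSpace FE VE)] [∀ x, TopologicalSpace (VE x)]
  [∀ x, AddCommGroup (VE x)] [∀ x, Module ℝ (VE x)] [FiberBundle FE VE] [VectorBundle ℝ FE VE]
  [ContMDiffVectorBundle ∞ FE VE 𝓘(ℝ, EX)]
  {EB : Type*} [NormedAddCommGroup EB] [NormedSpace ℝ EB]
  {B : Type*} [TopologicalSpace B] [ChartedSpace EB B] [IsManifold 𝓘(ℝ, EB) ∞ B]
  {FB : Type*} [NormedAddCommGroup FB] [NormedSpace ℝ FB]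
  {VB : B → Type*} [TopologicalSpace (TotalSpace FB VB)] [∀ b, TopologicalSpace (VB b)]
  [∀ b, AddCommGroup (VB b)] [∀ b, Module ℝ (VB b)] [FiberBundle FB VB] [VectorBundle ℝ FB VB]
  [ContMDiffVectorBundle ∞ FB VB 𝓘(ℝ, EB)]
  {AE : LieAlgebroid EX FE VE} {AB : LieAlgebroid EB FB VB} {Q : Extension AE AB}

theorem Extension.contMDiff_map (Q : Extension AE AB) :
    ContMDiff (𝓘(ℝ, EX).prod 𝓘(ℝ, FE)) (𝓘(ℝ, EB).prod 𝓘(ℝ, FB)) ∞ Q.map :=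
  Q.isMorphism.contMDiff_total

theorem Extension.continuous_p (Q : Extension AE AB) : Continuous Q.p :=
  Q.isMorphism.contMDiff_base.continuous

namespace Extension.Connection

variable (C : Q.Connection)

theorem bijective_domRestrict (x : X) :
    Function.Bijective ((Q.pr x).domRestrict (C.H x)) := by
  constructor
  · rw [← LinearMap.ker_eq_bot, LinearMap.ker_eq_bot']
    rintro ⟨v, hv⟩ h
    have h1 : v ∈ LinearMap.ker (Q.pr x) ⊓ C.H x := ⟨h, hv⟩
    rw [(C.isCompl x).inf_eq_bot] at h1
    exact Subtype.ext h1
  · intro b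
    obtain ⟨v, rfl⟩ := Q.surjective_pr x b
    have h1 : v ∈ LinearMap.ker (Q.pr x) ⊔ C.H x := by
      rw [(C.isCompl x).sup_eq_top]
      trivial
    obtain ⟨k, hk, h, hh, rfl⟩ := Submodule.mem_sup.1 h1
    refine ⟨⟨h, hh⟩, ?_⟩
    change Q.pr x h = _
    rw [map_add, LinearMap.mem_ker.1 hk, zero_add]

/-- The horizontal lift of vectors. -/
noncomputable def lift (x : X) : VB (Q.p x) →ₗ[ℝ] VE x :=
  (C.H x).subtype ∘ₗ (LinearEquiv.ofBijective ((Q.pr x).domRestrict (C.H x))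
    (C.bijective_domRestrict x)).symm.toLinearMap

theorem lift_mem (x : X) (b : VB (Q.p x)) : C.lift x b ∈ C.H x :=
  Subtype.mem _

@[simp]
theorem pr_lift (x : X) (b : VB (Q.p x)) : Q.pr x (C.lift x b) = b :=
  LinearEquiv.apply_ofBijective_symm_apply ((Q.pr x).domRestrict (C.H x))
    (h := C.bijective_domRestrict x) b

variable {C} in
theorem eq_lift {x : X} {v : VE x} (hv : v ∈ C.H x) : v = C.lift x (Q.pr x v) := by
  have h1 : v - C.lift x (Q.pr x v) ∈ LinearMap.ker (Q.pr x) ⊓ C.H x :=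
    ⟨by simp, sub_mem hv (C.lift_mem x _)⟩
  rw [(C.isCompl x).inf_eq_bot] at h1
  exact sub_eq_zero.1 h1

theorem vert_eq (v : TotalSpace FE VE) :
    C.vert v = ⟨v.proj, v.2 - C.lift v.proj (Q.pr v.proj v.2)⟩ := by
  unfold vert
  congr 1
  have h1 : v.2 = (v.2 - C.lift v.proj (Q.pr v.proj v.2)) + C.lift v.proj (Q.pr v.proj v.2) := by
    simp
  have hk : v.2 - C.lift v.proj (Q.pr v.proj v.2) ∈ LinearMap.ker (Q.pr v.proj) := by simp
  conv_lhs => rw [h1]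
  rw [map_add, Submodule.projection_apply_of_mem_left _ hk,
    (Submodule.projection_apply_eq_zero_iff _).2 (C.lift_mem _ _), add_zero]

theorem pr_vert (v : TotalSpace FE VE) : Q.pr (C.vert v).proj (C.vert v).2 = 0 := by
  rw [vert_eq]
  simp

variable [FiniteDimensional ℝ FB]

omit [FiniteDimensional ℝ FB] in
/-- Horizontal lifts depend smoothly on the point. -/
theorem exists_trivialization_lift (x₀ : X) : ∃ L : X → FB →L[ℝ] FE,
    ContMDiffAt 𝓘(ℝ, EX) 𝓘(ℝ, FB →L[ℝ] FE) ∞ L x₀ ∧ ∀ᶠ x in 𝓝 x₀, ∀ b : VB (Q.p x),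
      (trivializationAt FE VE x₀ ⟨x, C.lift x b⟩).2 =
        L x (trivializationAt FB VB (Q.p x₀) ⟨Q.p x, b⟩).2 := by
  obtain ⟨n, s, hs⟩ := C.smooth x₀
  set eE := trivializationAt FE VE x₀ with heE
  set eB := trivializationAt FB VB (Q.p x₀) with heB
  have hEx : x₀ ∈ eE.baseSet := FiberBundle.mem_baseSet_trivializationAt' x₀
  have hBx : Q.p x₀ ∈ eB.baseSet := FiberBundle.mem_baseSet_trivializationAt' _
  let pj (i : Fin n) : (Fin n → ℝ) →L[ℝ] ℝ := ContinuousLinearMap.proj i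
  -- `S` is the frame of `H` in the trivialization of `A_E` and `P` its image in that of `A_B`.
  -- Since the projection is bijective on `H`, the lift is `S P⁻¹`, and inversion is smooth.
  let S (x : X) : (Fin n → ℝ) →L[ℝ] FE := ∑ i, (pj i).smulRight (eE ⟨x, s i x⟩).2
  let P (x : X) : (Fin n → ℝ) →L[ℝ] FB := ∑ i, (pj i).smulRight (eB ⟨Q.p x, Q.pr x (s i x)⟩).2
  have hS : ContMDiffAt 𝓘(ℝ, EX) 𝓘(ℝ, (Fin n → ℝ) →L[ℝ] FE) ∞ S x₀ := by
    refine contMDiffAt_finsetSum fun i _ => ?_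
    exact (ContinuousLinearMap.smulRightL ℝ (Fin n → ℝ) FE (pj i)).contMDiff.contMDiffAt.comp x₀
      ((s i).contMDiffAt_trivialization eE hEx)
  have hP : ContMDiffAt 𝓘(ℝ, EX) 𝓘(ℝ, (Fin n → ℝ) →L[ℝ] FB) ∞ P x₀ := by
    refine contMDiffAt_finsetSum fun i _ => ?_
    have h1 : ContMDiffAt 𝓘(ℝ, EX) (𝓘(ℝ, EB).prod 𝓘(ℝ, FB)) ∞
        (fun x => Q.map ⟨x, s i x⟩) x₀ :=
      (Q.contMDiff_map _).comp x₀ ((s i).contMDiff x₀)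
    exact (ContinuousLinearMap.smulRightL ℝ (Fin n → ℝ) FB (pj i)).contMDiff.contMDiffAt.comp x₀
      (contMDiffAt_totalSpace.1 h1).2
  have hev : ∀ᶠ x in 𝓝 x₀, x ∈ eE.baseSet ∧ Q.p x ∈ eB.baseSet ∧
      LinearIndependent ℝ (fun i => s i x) ∧
      Submodule.span ℝ (Set.range fun i => s i x) = C.H x := by
    filter_upwards [eE.open_baseSet.mem_nhds hEx,
      Q.continuous_p.continuousAt (eB.open_baseSet.mem_nhds hBx), hs] with x h1 h2 h3
    exact ⟨h1, h2, h3⟩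
  have hSx {x : X} (hx : x ∈ eE.baseSet) (c : Fin n → ℝ) :
      S x c = (eE ⟨x, ∑ i, c i • s i x⟩).2 := by
    rw [trivialization_sum eE hx]
    simp only [trivialization_smul eE hx, S, pj, sum_apply,
      ContinuousLinearMap.smulRight_apply, ContinuousLinearMap.proj_apply]
  have hPx {x : X} (hx : Q.p x ∈ eB.baseSet) (c : Fin n → ℝ) :
      P x c = (eB ⟨Q.p x, Q.pr x (∑ i, c i • s i x)⟩).2 := by
    rw [map_sum, trivialization_sum eB hx]
    simp only [map_smul, trivialization_smul eB hx, P, pj, sum_apply,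
      ContinuousLinearMap.smulRight_apply, ContinuousLinearMap.proj_apply]
  have hinv : ∀ᶠ x in 𝓝 x₀, (P x).IsInvertible := by
    filter_upwards [hev] with x ⟨h1, h2, h3, h4⟩
    have hinj : Function.Injective (P x) := by
      rw [injective_iff_map_eq_zero]
      intro c hc
      rw [hPx h2] at hc
      have h5 : Q.pr x (∑ i, c i • s i x) = 0 := by
        refine trivialization_injective eB h2 (hc.trans ?_)
        have := trivialization_smul eB h2 0 (0 : VB (Q.p x))
        rw [zero_smul, zero_smul] at this
        exact this.symm
      have h6 : (∑ i, c i • s i x) ∈ C.H x := by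
        rw [← h4]
        exact Submodule.mem_span_range_iff_exists_fun ℝ |>.2 ⟨c, rfl⟩
      have h7 := eq_lift h6
      rw [h5, map_zero] at h7
      exact funext (Fintype.linearIndependent_iff.1 h3 c h7)
    have hsurj : Function.Surjective (P x) := by
      intro w
      have h5 := C.lift_mem x (eB.symm (Q.p x) w)
      rw [← h4, Submodule.mem_span_range_iff_exists_fun] at h5
      obtain ⟨c, hc⟩ := h5
      refine ⟨c, ?_⟩
      rw [hPx h2, hc, pr_lift, eB.apply_mk_symm h2]
    refine ⟨(LinearEquiv.ofBijective (P x).toLinearMap ⟨hinj, hsurj⟩).toContinuousLinearEquiv, ?_⟩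
    ext c
    rfl
  refine ⟨fun x => (S x).comp (P x).inverse, ?_, ?_⟩
  · exact hS.clm_comp ((hinv.self_of_nhds.contDiffAt_map_inverse (n := ∞)).contMDiffAt.comp x₀ hP)
  · filter_upwards [hev, hinv] with x ⟨h1, h2, h3, h4⟩ h5 b
    have h6 := C.lift_mem x b
    rw [← h4, Submodule.mem_span_range_iff_exists_fun] at h6
    obtain ⟨c, hc⟩ := h6
    have h7 : (P x).inverse (eB ⟨Q.p x, b⟩).2 = c := by
      rw [h5.inverse_apply_eq, hPx h2, hc, pr_lift]
    rw [ContinuousLinearMap.comp_apply, h7, hSx h1, hc]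

omit [FiniteDimensional ℝ FB] in
/-- The horizontal lift of a section. -/
theorem exists_isHorizontalLift (α : Sec EB FB VB) :
    ∃ σ : Sec EX FE VE, C.IsHorizontalLift σ α := by
  refine ⟨⟨fun x => C.lift x (α (Q.p x)), fun x₀ => ?_⟩, fun x => ⟨C.lift_mem _ _, C.pr_lift _ _⟩⟩
  rw [contMDiffAt_section]
  obtain ⟨L, hL, hL'⟩ := C.exists_trivialization_lift x₀
  have h1 := (α.contMDiffAt_trivialization (trivializationAt FB VB (Q.p x₀))
    (FiberBundle.mem_baseSet_trivializationAt' _)).comp x₀ (Q.isMorphism.contMDiff_base x₀)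
  refine (hL.clm_apply h1).congr_of_eventuallyEq ?_
  filter_upwards [hL'] with x hx
  exact hx _

omit [FiniteDimensional ℝ FB] in
variable {C} in
theorem IsHorizontalLift.eq_lift {α : Sec EB FB VB} {σ : Sec EX FE VE}
    (h : C.IsHorizontalLift σ α) (x : X) : σ x = C.lift x (α (Q.p x)) := by
  rw [← (h x).2]
  exact Connection.eq_lift (h x).1

omit [FiniteDimensional ℝ FB] in
theorem contMDiff_vert :
    ContMDiff (𝓘(ℝ, EX).prod 𝓘(ℝ, FE)) (𝓘(ℝ, EX).prod 𝓘(ℝ, FE)) ∞ C.vert := by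
  intro v
  rw [contMDiffAt_totalSpace]
  refine ⟨(contMDiff_proj VE) v, ?_⟩
  obtain ⟨L, hL, hL'⟩ := C.exists_trivialization_lift v.proj
  have h1 : ContMDiffAt (𝓘(ℝ, EX).prod 𝓘(ℝ, FE)) 𝓘(ℝ, FE) ∞
      (fun w : TotalSpace FE VE => (trivializationAt FE VE v.proj w).2) v :=
    (contMDiffAt_totalSpace.1 contMDiffAt_id).2
  have h2 := (contMDiffAt_totalSpace.1 (Q.contMDiff_map v)).2
  have h3 : ContMDiffAt (𝓘(ℝ, EX).prod 𝓘(ℝ, FE)) 𝓘(ℝ, FB →L[ℝ] FE) ∞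
      (fun w : TotalSpace FE VE => L w.proj) v := ContMDiffAt.comp v hL ((contMDiff_proj VE) v)
  refine (h1.sub (h3.clm_apply h2)).congr_of_eventuallyEq ?_
  have hcont := (FiberBundle.continuous_proj FE VE).continuousAt (x := v)
  filter_upwards [hcont hL', hcont ((trivializationAt FE VE v.proj).open_baseSet.mem_nhds
    (FiberBundle.mem_baseSet_trivializationAt' _))] with w hw hw'
  change (trivializationAt FE VE v.proj (C.vert w)).2 = _
  rw [vert_eq C w, sub_eq_add_neg, trivialization_add _ hw', ← neg_one_smul ℝ,
    trivialization_smul _ hw', hw, neg_one_smul, ← sub_eq_add_neg]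
  rfl

/-- The horizontal lift to `x` of a vector of `A_B` over `p x`. -/
noncomputable def liftAt (x : X) (b : TotalSpace FB VB) : VE x :=
  open Classical in if h : b.proj = Q.p x then C.lift x (h ▸ b.2) else 0

omit [FiniteDimensional ℝ FB] in
@[simp]
theorem liftAt_mk (x : X) (b : VB (Q.p x)) : C.liftAt x ⟨Q.p x, b⟩ = C.lift x b :=
  dif_pos rfl

omit [FiniteDimensional ℝ FB] in
theorem map_add_liftAt {v : TotalSpace FE VE} {b : TotalSpace FB VB} (h : Q.p v.proj = b.proj)
    (hv : Q.pr v.proj v.2 = 0) : Q.map ⟨v.proj, v.2 + C.liftAt v.proj b⟩ = b := by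
  obtain ⟨y, b⟩ := b
  obtain rfl : Q.p v.proj = y := h
  simp [Extension.map, hv]

omit [FiniteDimensional ℝ FB] in
theorem vert_add_liftAt {v : TotalSpace FE VE} {b : TotalSpace FB VB} (h : Q.p v.proj = b.proj)
    (hv : Q.pr v.proj v.2 = 0) : C.vert ⟨v.proj, v.2 + C.liftAt v.proj b⟩ = v := by
  obtain ⟨y, b⟩ := b
  obtain rfl : Q.p v.proj = y := h
  simp [vert_eq, hv]

omit [FiniteDimensional ℝ FB] in
theorem vert_add_liftAt_map (v : TotalSpace FE VE) :
    (⟨(C.vert v).proj, (C.vert v).2 + C.liftAt (C.vert v).proj (Q.map v)⟩ : TotalSpace FE VE)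
      = v := by
  rw [vert_eq]
  simp [Extension.map]

variable {Y : Type*} [TopologicalSpace Y]

omit [FiniteDimensional ℝ FB] in
-- In coordinates the sum is a `C^1` function of the coordinates of `u` and `b`. The function
-- `liftAt` takes a junk value off the matching fibre, so `h` is needed for all nearby parameters
-- and times.
theorem strictAt_add_liftAt {u : Y → Interval → TotalSpace FE VE}
    {b : Y → Interval → TotalSpace FB VB} {y₀ : Y} {t₀ : Interval}
    (hu : StrictAt (𝓘(ℝ, EX).prod 𝓘(ℝ, FE)) u y₀ t₀)
    (hb : StrictAt (𝓘(ℝ, EB).prod 𝓘(ℝ, FB)) b y₀ t₀)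
    (h : ∀ y t, Q.p (u y t).proj = (b y t).proj) :
    StrictAt (𝓘(ℝ, EX).prod 𝓘(ℝ, FE)) (fun y t =>
      (⟨(u y t).proj, (u y t).2 + C.liftAt (u y t).proj (b y t)⟩ : TotalSpace FE VE)) y₀ t₀ := by
  set x₀ := (u y₀ t₀).proj with hx₀
  set eE := trivializationAt FE VE x₀ with heE
  set eB := trivializationAt FB VB (Q.p x₀) with heB
  have hEx : x₀ ∈ eE.baseSet := FiberBundle.mem_baseSet_trivializationAt' x₀
  obtain ⟨L, hL, hL'⟩ := C.exists_trivialization_lift x₀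
  have hproj : ContinuousAt (fun p : Y × Interval => (u p.1 p.2).proj) (y₀, t₀) :=
    ContinuousAt.comp_fam (FiberBundle.continuous_proj FE VE).continuousAt hu.1
  have hb0 : (b y₀ t₀).proj = Q.p x₀ := (h y₀ t₀).symm
  have hBb : ContMDiffAt (𝓘(ℝ, EB).prod 𝓘(ℝ, FB)) 𝓘(ℝ, FB) 1
      (fun w : TotalSpace FB VB => (eB w).2) (b y₀ t₀) := by
    have := (contMDiffAt_totalSpace (IB := 𝓘(ℝ, EB)) (n := 1)
      (f := fun w : TotalSpace FB VB => w) (x₀ := b y₀ t₀)).1 contMDiffAt_id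
    rw [hb0] at this
    exact this.2
  have hev : ∀ᶠ p : Y × Interval in 𝓝 (y₀, t₀),
      (u p.1 p.2).proj ∈ eE.baseSet ∧ (u p.1 p.2).proj ∈ (extChartAt 𝓘(ℝ, EX) x₀).source ∧
      (eE (⟨(u p.1 p.2).proj, (u p.1 p.2).2 +
        C.liftAt (u p.1 p.2).proj (b p.1 p.2)⟩ : TotalSpace FE VE)).2 =
      (eE (u p.1 p.2)).2 + L (u p.1 p.2).proj (eB (b p.1 p.2)).2 := by
    filter_upwards [hproj hL', hproj (eE.open_baseSet.mem_nhds hEx),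
      hproj (extChartAt_source_mem_nhds (I := 𝓘(ℝ, EX)) x₀)] with p h1 h2 h3
    refine ⟨h2, h3, ?_⟩
    rw [trivialization_add eE h2]
    congr 1
    have h3 := h p.1 p.2
    generalize b p.1 p.2 = w at h3
    obtain ⟨y, w⟩ := w
    obtain rfl : Q.p (u p.1 p.2).proj = y := h3
    rw [liftAt_mk]
    exact h1 w
  have hEu : ContMDiffAt (𝓘(ℝ, EX).prod 𝓘(ℝ, FE)) 𝓘(ℝ, FE) 1
      (fun w : TotalSpace FE VE => (eE w).2) (u y₀ t₀) :=
    (contMDiffAt_totalSpace.1 contMDiffAt_id).2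
  have hφ : ContMDiffAt (𝓘(ℝ, EX).prod 𝓘(ℝ, FE)) 𝓘(ℝ, EX) 1
      (fun w : TotalSpace FE VE => extChartAt 𝓘(ℝ, EX) x₀ w.proj) (u y₀ t₀) :=
    ContMDiffAt.comp (u y₀ t₀) (g := extChartAt 𝓘(ℝ, EX) x₀) contMDiffAt_extChartAt
      ((contMDiff_proj VE) _)
  have hcont : ContinuousAt (fun p : Y × Interval => (⟨(u p.1 p.2).proj, (u p.1 p.2).2 +
      C.liftAt (u p.1 p.2).proj (b p.1 p.2)⟩ : TotalSpace FE VE)) (y₀, t₀) := by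
    rw [FiberBundle.continuousAt_totalSpace]
    refine ⟨hproj, ?_⟩
    have h1 : ContinuousAt (fun p : Y × Interval => (eE (u p.1 p.2)).2 +
        L (u p.1 p.2).proj (eB (b p.1 p.2)).2) (y₀, t₀) :=
      (ContinuousAt.comp_fam hEu.continuousAt hu.1).add
        ((ContinuousAt.comp (g := L) (f := fun p : Y × Interval => (u p.1 p.2).proj)
          hL.continuousAt hproj).clm_apply (ContinuousAt.comp_fam hBb.continuousAt hb.1))
    exact h1.congr (hev.mono fun p hp => hp.2.2.symm)
  refine ⟨hcont, _, ((((hu.hasStrictDerivFam hφ).prodMk (hu.hasStrictDerivFam hEu)).prodMk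
    (hb.hasStrictDerivFam hBb)).comp_strictFDeriv (f := fun q : (EX × FE) × FB =>
      (q.1.1, q.1.2 + L ((extChartAt 𝓘(ℝ, EX) x₀).symm q.1.1) q.2))
    (x := ((extChartAt 𝓘(ℝ, EX) x₀ x₀, (eE (u y₀ t₀)).2), (eB (b y₀ t₀)).2))
    (ContDiffAt.hasStrictFDerivAt (n := 1) ?_ one_ne_zero) ?_).congr ?_⟩
  · exact contDiffAt_add_clm_apply (L := fun ξ => L ((extChartAt 𝓘(ℝ, EX) x₀).symm ξ))
      (q := ((extChartAt 𝓘(ℝ, EX) x₀ x₀, (eE (u y₀ t₀)).2), (eB (b y₀ t₀)).2))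
      (contDiffAt_comp_extChartAt_symm (mem_chart_source EX x₀) (hL.of_le (show (1 : WithTop ℕ∞) ≤ ∞ by simp)))
  · rw [← nhds_prod_eq]
    have h1 : ContinuousAt (fun p : Y × Interval => extChartAt 𝓘(ℝ, EX) x₀ (u p.1 p.2).proj)
        (y₀, t₀) := ContinuousAt.comp (g := extChartAt 𝓘(ℝ, EX) x₀)
      (f := fun p : Y × Interval => (u p.1 p.2).proj) (continuousAt_extChartAt x₀) hproj
    have h2 : ContinuousAt (fun p : Y × Interval => (eE (u p.1 p.2)).2) (y₀, t₀) :=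
      ContinuousAt.comp (g := fun w => (eE w).2)
        (f := fun p : Y × Interval => u p.1 p.2) hEu.continuousAt hu.1
    have h3 : ContinuousAt (fun p : Y × Interval => (eB (b p.1 p.2)).2) (y₀, t₀) :=
      ContinuousAt.comp (g := fun w => (eB w).2)
        (f := fun p : Y × Interval => b p.1 p.2) hBb.continuousAt hb.1
    exact (h1.prodMk h2).prodMk h3
  · rw [← nhds_prod_eq]
    filter_upwards [hev] with p hp
    have h1 := extChartAt_totalSpace_apply (EM := EX) (z := (⟨(u y₀ t₀).proj, (u y₀ t₀).2 +
        C.liftAt (u y₀ t₀).proj (b y₀ t₀)⟩ : TotalSpace FE VE))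
      (v := (⟨(u p.1 p.2).proj, (u p.1 p.2).2 +
        C.liftAt (u p.1 p.2).proj (b p.1 p.2)⟩ : TotalSpace FE VE)) hp.1
    rw [h1]
    refine Prod.ext rfl ?_
    have h2 : (extChartAt 𝓘(ℝ, EX) x₀).symm (extChartAt 𝓘(ℝ, EX) x₀ (u p.1 p.2).proj) =
      (u p.1 p.2).proj := (extChartAt 𝓘(ℝ, EX) x₀).left_inv hp.2.1
    change (eE (u p.1 p.2)).2 + L ((extChartAt 𝓘(ℝ, EX) x₀).symm
      (extChartAt 𝓘(ℝ, EX) x₀ (u p.1 p.2).proj)) (eB (b p.1 p.2)).2 = _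
    rw [h2]
    exact hp.2.2.symm

end Extension.Connection

/-- Degree zero of the morphism condition: `d` commutes with pull-back of functions. It is tested on
functions whose germs are linear functionals of a chart, and such functionals separate tangent
vectors. -/
theorem Extension.mfderiv_anchor [FiniteDimensional ℝ EX] [FiniteDimensional ℝ EB] [T2Space X]
    [T2Space B] (Q : Extension AE AB) (x : X) (v : VE x) :
    mfderiv 𝓘(ℝ, EX) 𝓘(ℝ, EB) Q.p x (AE.anchor x v) = AB.anchor (Q.p x) (Q.pr x v) := by
  obtain ⟨α, hα⟩ := exists_sec_apply_eq (EM := EX) (F := FE) v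
  obtain ⟨β, hβ⟩ := exists_sec_apply_eq (EM := EB) (F := FB) (Q.pr x v)
  set φ := extChartAt 𝓘(ℝ, EB) (Q.p x) with hφ
  have key (ℓ : EB →L[ℝ] ℝ) : ℓ (mfderiv 𝓘(ℝ, EX) 𝓘(ℝ, EB) Q.p x (AE.anchor x v)) =
      ℓ (AB.anchor (Q.p x) (Q.pr x v)) := by
    obtain ⟨f, hf⟩ := exists_contMDiffMap_eventuallyEq (EM := EB)
      ((chartAt EB (Q.p x)).open_source.mem_nhds (mem_chart_source EB (Q.p x)))
      (f := fun y => ℓ (φ y)) (fun y hy => (ℓ.contMDiff.contMDiffAt.comp y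
        (contMDiffAt_extChartAt' hy)).contMDiffWithinAt)
    let θ : Form EB FB VB 0 := ⟨fun y => AlternatingMap.constOfIsEmpty ℝ (VB y) (Fin 0) (f y),
      fun _ => f.contMDiff⟩
    have h1 := Q.isMorphism.comm_d 0 θ (fun _ => α) (fun _ => β) x (fun _ => by rw [hα, hβ])
    simp only [LieAlgebroid.d, LieAlgebroid.bracketSum] at h1
    have h2 : (mfderiv 𝓘(ℝ, EB) 𝓘(ℝ, ℝ) f (Q.p x) : EB →L[ℝ] ℝ) = ℓ := by
      have h3 : (f : B → ℝ) =ᶠ[𝓝 (Q.p x)] ℓ ∘ φ := hf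
      rw [h3.mfderiv_eq, mfderiv_comp (Q.p x)
        ((ℓ.contMDiff (n := 1)).contMDiffAt.mdifferentiableAt one_ne_zero)
        (mdifferentiableAt_extChartAt (mem_chart_source EB _)), mfderiv_extChartAt_self,
        mfderiv_eq_fderiv, ContinuousLinearMap.fderiv]
      rfl
    have h4 : (mfderiv 𝓘(ℝ, EX) 𝓘(ℝ, ℝ) (fun y => f (Q.p y)) x : EX →L[ℝ] ℝ) =
        (mfderiv 𝓘(ℝ, EB) 𝓘(ℝ, ℝ) f (Q.p x)).comp (mfderiv 𝓘(ℝ, EX) 𝓘(ℝ, EB) Q.p x) :=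
      mfderiv_comp x (f.contMDiff.contMDiffAt.mdifferentiableAt (by simp))
        (Q.isMorphism.contMDiff_base.contMDiffAt.mdifferentiableAt (by simp))
    have h5 : (mfderiv 𝓘(ℝ, EX) 𝓘(ℝ, ℝ) (fun y => f (Q.p y)) x : EX →L[ℝ] ℝ)
        (AE.anchor x v) = (mfderiv 𝓘(ℝ, EB) 𝓘(ℝ, ℝ) f (Q.p x) : EB →L[ℝ] ℝ)
        (AB.anchor (Q.p x) (Q.pr x v)) := by
      rw [← hβ]
      conv_lhs => rw [← hα]
      simp only [Fin.val_zero, pow_zero, add_zero, Fin.sum_univ_succ, Finset.univ_eq_empty,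
        Finset.sum_empty] at h1
      exact (one_mul (M := ℝ) _).symm.trans (h1.trans (one_mul (M := ℝ) _))
    rw [h4, h2] at h5
    exact h5
  have h6 (w w' : EB) (h : ∀ ℓ : EB →L[ℝ] ℝ, ℓ w = ℓ w') : w = w' := by
    by_contra hne
    obtain ⟨ℓ, hℓ⟩ := SeparatingDual.exists_ne_zero (R := ℝ) (sub_ne_zero.2 hne)
    exact hℓ ((map_sub ℓ _ _).trans (sub_eq_zero.2 (h ℓ)))
  exact h6 _ _ key

end Lift

/-! ### The vector field of a derivation, tested on functions. -/

section AdField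

variable {EM : Type*} [NormedAddCommGroup EM] [NormedSpace ℝ EM]
  {M : Type*} [TopologicalSpace M] [ChartedSpace EM M] [IsManifold 𝓘(ℝ, EM) ∞ M]
  {F : Type*} [NormedAddCommGroup F] [NormedSpace ℝ F]
  {V : M → Type*} [TopologicalSpace (TotalSpace F V)] [∀ x, TopologicalSpace (V x)]
  [∀ x, AddCommGroup (V x)] [∀ x, Module ℝ (V x)] [FiberBundle F V] [VectorBundle ℝ F V]
  [ContMDiffVectorBundle ∞ F V 𝓘(ℝ, EM)]
  {E' : Type*} [NormedAddCommGroup E'] [NormedSpace ℝ E']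

theorem LieAlgebroid.contMDiff_anchor_sec (A : LieAlgebroid EM F V) (σ : Sec EM F V)
    {n : WithTop ℕ∞} (hn : n ≤ ∞) :
    ContMDiff 𝓘(ℝ, EM) 𝓘(ℝ, EM).tangent n
      (fun y => (⟨y, A.anchor y (σ y)⟩ : TangentBundle 𝓘(ℝ, EM) M)) :=
  (A.contMDiff_anchor.comp σ.contMDiff).of_le hn

theorem LieAlgebroid.tderiv_adField (A : LieAlgebroid EM F V) (σ κ : Sec EM F V) (x : M)
    {ψ : TotalSpace F V → E'}
    (hψ : MDifferentiableAt (𝓘(ℝ, EM).prod 𝓘(ℝ, F)) 𝓘(ℝ, E') ψ ⟨x, κ x⟩) :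
    tderiv ψ (A.adField σ κ x) =
      (show E' from mfderiv 𝓘(ℝ, EM) 𝓘(ℝ, E') (fun y => ψ ⟨y, κ y⟩) x (A.anchor x (σ x)))
      - deriv (fun s : ℝ => ψ ⟨x, κ x + s • A.bracket σ κ x⟩) 0 := by
  have h1 := mfderiv_comp x hψ (κ.contMDiff.contMDiffAt.mdifferentiableAt (by simp))
  rw [← mfderiv_vertLift (EM := EM) (κ x) (A.bracket σ κ x) hψ]
  have h2 : (mfderiv 𝓘(ℝ, EM) 𝓘(ℝ, E') (fun y => ψ ⟨y, κ y⟩) x : EM →L[ℝ] E')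
    (A.anchor x (σ x)) = (mfderiv (𝓘(ℝ, EM).prod 𝓘(ℝ, F)) 𝓘(ℝ, E') ψ ⟨x, κ x⟩ : EM × F →L[ℝ] E')
      (mfderiv 𝓘(ℝ, EM) (𝓘(ℝ, EM).prod 𝓘(ℝ, F)) (fun y => (⟨y, κ y⟩ : TotalSpace F V)) x
        (A.anchor x (σ x))) :=
    congrArg (fun L : EM →L[ℝ] E' => L (A.anchor x (σ x))) h1
  refine Eq.trans ?_ (congrArg (fun w => w - (mfderiv (𝓘(ℝ, EM).prod 𝓘(ℝ, F)) 𝓘(ℝ, E') ψ ⟨x, κ x⟩ :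
    EM × F →L[ℝ] E') (vertLift (EM := EM) x (κ x) (A.bracket σ κ x))) h2.symm)
  exact map_sub (mfderiv (𝓘(ℝ, EM).prod 𝓘(ℝ, F)) 𝓘(ℝ, E') ψ ⟨x, κ x⟩) _ _

theorem hasDerivAtI_of_velocity_eq {A : LieAlgebroid EM F V} {σ κ : Sec EM F V} {x : M}
    {c : Interval → TotalSpace F V} {t : Interval}
    (hc : MDifferentiableAt (𝓡∂ 1) (𝓘(ℝ, EM).prod 𝓘(ℝ, F)) c t)
    (hvel : velocity (𝓘(ℝ, EM).prod 𝓘(ℝ, F)) c t = A.adField σ κ x)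
    (hx : (⟨x, κ x⟩ : TotalSpace F V) = c t) {ψ : TotalSpace F V → E'}
    (hψ : MDifferentiableAt (𝓘(ℝ, EM).prod 𝓘(ℝ, F)) 𝓘(ℝ, E') ψ (c t)) :
    HasDerivAtI (fun s => ψ (c s)) ((show E' from mfderiv 𝓘(ℝ, EM) 𝓘(ℝ, E')
      (fun y => ψ ⟨y, κ y⟩) x (A.anchor x (σ x))) -
      deriv (fun r : ℝ => ψ ⟨x, κ x + r • A.bracket σ κ x⟩) 0) t := by
  have h1 := hasDerivAtI_comp hc hψ
  rw [hvel, A.tderiv_adField] at h1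
  · exact h1
  · rwa [hx]

omit [IsManifold 𝓘(ℝ, EM) ∞ M] in
theorem tderiv_sum_smul {ι : Type*} {I : Finset ι} {x : M} (ψ : M → E') (r : ι → ℝ)
    (v : ι → TangentSpace 𝓘(ℝ, EM) x) :
    tderiv ψ (⟨x, ∑ i ∈ I, r i • v i⟩ : TangentBundle 𝓘(ℝ, EM) M) =
      ∑ i ∈ I, r i • tderiv ψ (⟨x, v i⟩ : TangentBundle 𝓘(ℝ, EM) M) := by
  let L : EM →L[ℝ] E' := mfderiv 𝓘(ℝ, EM) 𝓘(ℝ, E') ψ x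
  exact (map_sum L _ _).trans (Finset.sum_congr rfl fun i _ => map_smul L _ _)

omit [IsManifold 𝓘(ℝ, EM) ∞ M] in
theorem chartField_apply {x₀ x : M} (hx : x ∈ (chartAt EM x₀).source)
    (U : ∀ x : M, TangentSpace 𝓘(ℝ, EM) x) :
    chartField x₀ U (extChartAt 𝓘(ℝ, EM) x₀ x) =
      tderiv (extChartAt 𝓘(ℝ, EM) x₀) (⟨x, U x⟩ : TangentBundle 𝓘(ℝ, EM) M) := by
  unfold chartField
  rw [(extChartAt 𝓘(ℝ, EM) x₀).left_inv (by rwa [extChartAt_source])]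

end AdField

/-- The coordinate form of `♯[h(α), κ] = [♯h(α), ♯κ]` for constant frame coefficients: `U` are the
anchors of the lifted frame, `Y` those of the frame of `A_E`, and `Γ` the components of their
brackets. The vector `ζ` is arbitrary since the function on the right does not involve the fibre
variable. -/
theorem fderiv_frame_identity {ι ι' E F : Type*} [Fintype ι] [Fintype ι'] [NormedAddCommGroup E]
    [NormedSpace ℝ E] [NormedAddCommGroup F] [NormedSpace ℝ F] [FiniteDimensional ℝ F]
    (b : Module.Basis ι' ℝ F) {Y : ι' → E → E} {U : ι → E → E} {Γ : ι → ι' → E → F} {ξ : E}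
    (hY : ∀ j, DifferentiableAt ℝ (Y j) ξ) (hU : ∀ i, DifferentiableAt ℝ (U i) ξ)
    (h : ∀ i k, ∑ j, b.repr (Γ i k ξ) j • Y j ξ =
      fderiv ℝ (Y k) ξ (U i ξ) - fderiv ℝ (U i) ξ (Y k ξ)) (c : ι → ℝ) (z ζ : F) :
    fderiv ℝ (fun u : E × F => ∑ j, b.repr u.2 j • Y j u.1) (ξ, z)
      (∑ i, c i • U i ξ, -∑ i, ∑ j, (c i * b.repr z j) • Γ i j ξ) =
    fderiv ℝ (fun u : E × F => ∑ i, c i • U i u.1) (ξ, z) (∑ j, b.repr z j • Y j ξ, ζ) := by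
  have hR : HasFDerivAt (fun u : E × F => ∑ j, b.repr u.2 j • Y j u.1)
      (∑ j, (b.repr z j • (fderiv ℝ (Y j) ξ).comp
      (ContinuousLinearMap.fst ℝ E F) + ((LinearMap.toContinuousLinearMap (b.coord j)).comp
        (ContinuousLinearMap.snd ℝ E F)).smulRight (Y j ξ))) (ξ, z) := by
    refine HasFDerivAt.fun_sum fun j _ => ?_
    have h1 : HasFDerivAt (fun u : E × F => b.repr u.2 j)
        ((LinearMap.toContinuousLinearMap (b.coord j)).comp
          (ContinuousLinearMap.snd ℝ E F)) (ξ, z) :=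
      ((LinearMap.toContinuousLinearMap (b.coord j)).comp
        (ContinuousLinearMap.snd ℝ E F)).hasFDerivAt
    have h2 : HasFDerivAt (fun u : E × F => Y j u.1) ((fderiv ℝ (Y j) ξ).comp
        (ContinuousLinearMap.fst ℝ E F)) (ξ, z) :=
      HasFDerivAt.comp (ξ, z) (g := Y j) (hY j).hasFDerivAt hasFDerivAt_fst
    exact h1.fun_smul h2
  have hG : HasFDerivAt (fun u : E × F => ∑ i, c i • U i u.1)
      (∑ i, c i • (fderiv ℝ (U i) ξ).comp (ContinuousLinearMap.fst ℝ E F)) (ξ, z) := by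
    refine HasFDerivAt.fun_sum fun i _ => ?_
    have h1 : HasFDerivAt (fun u : E × F => U i u.1) ((fderiv ℝ (U i) ξ).comp
      (ContinuousLinearMap.fst ℝ E F)) (ξ, z) :=
      HasFDerivAt.comp (ξ, z) (g := U i) (hU i).hasFDerivAt hasFDerivAt_fst
    exact h1.fun_const_smul (c i)
  rw [hR.fderiv, hG.fderiv]
  simp only [sum_apply, add_apply, smul_apply, ContinuousLinearMap.comp_apply,
    ContinuousLinearMap.smulRight_apply, ContinuousLinearMap.coe_fst',
    ContinuousLinearMap.coe_snd', Finset.sum_add_distrib]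
  have h4 (w : F) : ∑ j, (LinearMap.toContinuousLinearMap (b.coord j)) w • Y j ξ =
      b.constr ℝ (fun j => Y j ξ) w := (b.constr_apply_fintype ℝ _ w).symm
  have h5 (i k) : b.constr ℝ (fun j => Y j ξ) (Γ i k ξ) =
      fderiv ℝ (Y k) ξ (U i ξ) - fderiv ℝ (U i) ξ (Y k ξ) :=
    (b.constr_apply_fintype ℝ _ _).trans (h i k)
  rw [h4]
  simp only [map_neg, map_sum, map_smul, h5, Finset.smul_sum, smul_smul]
  rw [Finset.sum_comm, ← sub_eq_add_neg, ← Finset.sum_sub_distrib]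
  refine Finset.sum_congr rfl fun i _ => ?_
  rw [← Finset.sum_sub_distrib]
  refine Finset.sum_congr rfl fun j _ => ?_
  rw [smul_sub, mul_comm, sub_sub_cancel]

/-! ### The parallel transport equation in coordinates. -/

section ChartModel

variable {EX : Type*} [NormedAddCommGroup EX] [NormedSpace ℝ EX]
  {X : Type*} [TopologicalSpace X] [ChartedSpace EX X] [IsManifold 𝓘(ℝ, EX) ∞ X]
  {FE : Type*} [NormedAddCommGroup FE] [NormedSpace ℝ FE]
  {VE : X → Type*} [TopologicalSpace (TotalSpace FE VE)] [∀ x, TopologicalSpace (VE x)]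
  [∀ x, AddCommGroup (VE x)] [∀ x, Module ℝ (VE x)] [FiberBundle FE VE] [VectorBundle ℝ FE VE]
  [ContMDiffVectorBundle ∞ FE VE 𝓘(ℝ, EX)]
  {EB : Type*} [NormedAddCommGroup EB] [NormedSpace ℝ EB]
  {B : Type*} [TopologicalSpace B] [ChartedSpace EB B] [IsManifold 𝓘(ℝ, EB) ∞ B]
  {FB : Type*} [NormedAddCommGroup FB] [NormedSpace ℝ FB]
  {VB : B → Type*} [TopologicalSpace (TotalSpace FB VB)] [∀ b, TopologicalSpace (VB b)]
  [∀ b, AddCommGroup (VB b)] [∀ b, Module ℝ (VB b)] [FiberBundle FB VB] [VectorBundle ℝ FB VB]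
  [ContMDiffVectorBundle ∞ FB VB 𝓘(ℝ, EB)]
  {AE : LieAlgebroid EX FE VE} {AB : LieAlgebroid EB FB VB} {Q : Extension AE AB}

/-- The coordinates near the fibre of `A_E` over `x₀`. -/
noncomputable def coord (EX : Type*) [NormedAddCommGroup EX] [NormedSpace ℝ EX]
    {X : Type*} [TopologicalSpace X] [ChartedSpace EX X]
    {FE : Type*} [NormedAddCommGroup FE] [NormedSpace ℝ FE]
    {VE : X → Type*} [TopologicalSpace (TotalSpace FE VE)] [∀ x, TopologicalSpace (VE x)]
    [∀ x, AddCommGroup (VE x)] [FiberBundle FE VE]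
    (x₀ : X) (v : TotalSpace FE VE) : EX × FE :=
  extChartAt (𝓘(ℝ, EX).prod 𝓘(ℝ, FE)) (⟨x₀, 0⟩ : TotalSpace FE VE) v

omit [(x : X) → Module ℝ (VE x)] [VectorBundle ℝ FE VE] in
omit [IsManifold 𝓘(ℝ, EX) ∞ X] [ContMDiffVectorBundle ∞ FE VE 𝓘(ℝ, EX)] in
theorem coord_apply {x₀ : X} {v : TotalSpace FE VE}
    (hv : v.proj ∈ (trivializationAt FE VE x₀).baseSet) :
    coord EX x₀ v = (extChartAt 𝓘(ℝ, EX) x₀ v.proj, (trivializationAt FE VE x₀ v).2) :=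
  extChartAt_totalSpace_apply (z := (⟨x₀, 0⟩ : TotalSpace FE VE)) hv

namespace Extension.Connection

/-- The parallel transport equation `u' = G(β, u)` and the anchor `R` in the coordinates near
`x₀`, where `β` is the coordinate expression of the driving `A_B`-path. -/
structure ChartModel (C : Q.Connection) (x₀ : X) where
  /-- The domain. -/
  N : Set X
  isOpen_N : IsOpen N
  mem_N : x₀ ∈ N
  source : N ⊆ (chartAt EX x₀).source
  baseSet : N ⊆ (trivializationAt FE VE x₀).baseSet
  base : ∀ x ∈ N, Q.p x ∈ (trivializationAt FB VB (Q.p x₀)).baseSet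
  /-- The right hand side of the equation. -/
  G : FB × (EX × FE) → EX × FE
  /-- The anchor. -/
  R : EX × FE → EX
  contDiffAt_G : ∀ β (v : TotalSpace FE VE), v.proj ∈ N → ContDiffAt ℝ 1 G (β, coord EX x₀ v)
  contDiffAt_R : ∀ v : TotalSpace FE VE, v.proj ∈ N → ContDiffAt ℝ 1 R (coord EX x₀ v)
  G_add : ∀ β β' u, G (β + β', u) = G (β, u) + G (β', u)
  G_smul : ∀ (r : ℝ) β u, G (r • β, u) = r • G (β, u)
  G_fibre : ∀ (r : ℝ) β ξ z, G (β, (ξ, r • z)) = ((G (β, (ξ, z))).1, r • (G (β, (ξ, z))).2)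
  anchor_eq : ∀ v : TotalSpace FE VE, v.proj ∈ N → tderiv (extChartAt 𝓘(ℝ, EX) x₀)
    (⟨v.proj, AE.anchor v.proj v.2⟩ : TangentBundle 𝓘(ℝ, EX) X) = R (coord EX x₀ v)
  lift_anchor : ∀ x ∈ N, ∀ (b : VB (Q.p x)) (z : FE), tderiv (extChartAt 𝓘(ℝ, EX) x₀)
    (⟨x, AE.anchor x (C.lift x b)⟩ : TangentBundle 𝓘(ℝ, EX) X) =
      (G ((trivializationAt FB VB (Q.p x₀) ⟨Q.p x, b⟩).2, (extChartAt 𝓘(ℝ, EX) x₀ x, z))).1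
  hasDerivAtI : ∀ a c, C.IsParallel a c → ∀ t, (c t).proj ∈ N →
    HasDerivAtI (fun s => coord EX x₀ (c s))
      (G ((trivializationAt FB VB (Q.p x₀) (a t)).2, coord EX x₀ (c t))) t
  -- Compatibility of anchor and bracket, in the form used to propagate the path condition along
  -- parallel curves.
  fderiv_R : ∀ β (v : TotalSpace FE VE), v.proj ∈ N → ∀ ζ : FE,
    fderiv ℝ R (coord EX x₀ v) (G (β, coord EX x₀ v)) =
      fderiv ℝ (fun u => (G (β, u)).1) (coord EX x₀ v) (R (coord EX x₀ v), ζ)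

variable (C : Q.Connection)

theorem vert_of_pr_eq_zero {v : TotalSpace FE VE} (hv : Q.pr v.proj v.2 = 0) : C.vert v = v := by
  rw [vert_eq, hv, map_zero, sub_zero]

variable [FiniteDimensional ℝ EX] [FiniteDimensional ℝ FE] [FiniteDimensional ℝ EB]
  [FiniteDimensional ℝ FB] [T2Space X] [T2Space B]

omit [FiniteDimensional ℝ FB] in
omit [FiniteDimensional ℝ FE] [FiniteDimensional ℝ EB] [T2Space B] in
-- The equation of a parallel curve is tested on sections of the kernel through its points, so these
-- must exist; any extension is projected by `vert`.
theorem exists_kerSec (C : Q.Connection) {v : TotalSpace FE VE} (hv : Q.pr v.proj v.2 = 0) :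
    ∃ κ : Sec EX FE VE, (∀ x, Q.pr x (κ x) = 0) ∧ κ v.proj = v.2 := by
  obtain ⟨κ, hκ⟩ := exists_sec_apply_eq (EM := EX) (F := FE) v.2
  refine ⟨⟨fun x => (C.vert ⟨x, κ x⟩).2, C.contMDiff_vert.comp κ.contMDiff⟩,
    fun x => C.pr_vert ⟨x, κ x⟩, ?_⟩
  change (C.vert ⟨v.proj, κ v.proj⟩).2 = v.2
  rw [hκ]
  exact eq_of_heq (congr_arg_heq TotalSpace.snd (C.vert_of_pr_eq_zero hv))

set_option maxHeartbeats 800000 in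
-- The equation is written in a frame `e i` of `A_B`, its horizontal lifts `σ i`, and a frame `ε j`
-- of `A_E`. On the domain `N` all these frames are constant in the trivializations, so vectors have
-- constant-coefficient extensions.
theorem nonempty_chartModel (x₀ : X) : Nonempty (C.ChartModel x₀) := by
  set eE := trivializationAt FE VE x₀ with heE
  set eB := trivializationAt FB VB (Q.p x₀) with heB
  set φ := extChartAt 𝓘(ℝ, EX) x₀ with hφ
  set bB := Module.finBasis ℝ FB
  set bF := Module.finBasis ℝ FE
  choose e he using fun i => exists_sec_trivialization_eq (EM := EB) (V := VB) (Q.p x₀) (bB i)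
  choose σ hσ using fun i => C.exists_isHorizontalLift (e i)
  choose ε hε using fun i => exists_sec_trivialization_eq (EM := EX) (V := VE) x₀ (bF i)
  let Xf i : EX → EX := chartField x₀ (fun x => AE.anchor x (σ i x))
  let Yf j : EX → EX := chartField x₀ (fun x => AE.anchor x (ε j x))
  let Γ i j : EX → FE := fun ξ => (eE ⟨φ.symm ξ, AE.bracket (σ i) (ε j) (φ.symm ξ)⟩).2
  let N : Set X := interior {x | x ∈ (chartAt EX x₀).source ∧ x ∈ eE.baseSet ∧
    Q.p x ∈ eB.baseSet ∧ (∀ i, (eB ⟨Q.p x, e i (Q.p x)⟩).2 = bB i) ∧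
    ∀ j, (eE ⟨x, ε j x⟩).2 = bF j}
  have hN {x : X} (hx : x ∈ N) := interior_subset hx
  have hNx : x₀ ∈ N := by
    rw [mem_interior_iff_mem_nhds]
    filter_upwards [(chartAt EX x₀).open_source.mem_nhds (mem_chart_source EX x₀),
      eE.open_baseSet.mem_nhds (FiberBundle.mem_baseSet_trivializationAt' x₀),
      Q.continuous_p.continuousAt (eB.open_baseSet.mem_nhds
        (FiberBundle.mem_baseSet_trivializationAt' (Q.p x₀))),
      Q.continuous_p.continuousAt (eventually_all.2 he), eventually_all.2 hε] with x h1 h2 h3 h4 h5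
    exact ⟨h1, h2, h3, h4, h5⟩
  have hXf i {x : X} (hx : x ∈ N) : ContDiffAt ℝ 1 (Xf i) (φ x) :=
    contDiffAt_chartField (hN hx).1 (AE.contMDiff_anchor_sec (σ i) (by simp) x)
  have hYf j {x : X} (hx : x ∈ N) : ContDiffAt ℝ 1 (Yf j) (φ x) :=
    contDiffAt_chartField (hN hx).1 (AE.contMDiff_anchor_sec (ε j) (by simp) x)
  have hΓ i j {x : X} (hx : x ∈ N) : ContDiffAt ℝ 1 (Γ i j) (φ x) :=
    contDiffAt_comp_extChartAt_symm (hN hx).1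
      (((AE.bracket (σ i) (ε j)).contMDiffAt_trivialization eE (hN hx).2.1).of_le
        (show (1 : WithTop ℕ∞) ≤ ∞ by simp))
  -- The base moves with `♯h(β)`. The fibre part carries a minus sign because the vector field of
  -- the derivation subtracts the bracket.
  let G : FB × (EX × FE) → EX × FE := fun q => (∑ i, bB.repr q.1 i • Xf i q.2.1,
    -∑ i, ∑ j, (bB.repr q.1 i * bF.repr q.2.2 j) • Γ i j q.2.1)
  let R : EX × FE → EX := fun u => ∑ j, bF.repr u.2 j • Yf j u.1
  have hanchor (v : TotalSpace FE VE) (hv : v.proj ∈ N) :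
      tderiv φ (⟨v.proj, AE.anchor v.proj v.2⟩ : TangentBundle 𝓘(ℝ, EX) X) =
        R (coord EX x₀ v) := by
    have h1 := eq_sum_repr_smul eE (hN hv).2.1 bF (hN hv).2.2.2.2 v.2
    change _ = ∑ j, bF.repr (coord EX x₀ v).2 j • Yf j (coord EX x₀ v).1
    rw [coord_apply (hN hv).2.1]
    conv_lhs => rw [h1]
    simp only [map_sum, map_smul]
    rw [tderiv_sum_smul]
    refine Finset.sum_congr rfl fun j _ => ?_
    rw [show Yf j (φ v.proj) = _ from chartField_apply (hN hv).1 _]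
  have hlift (x : X) (hx : x ∈ N) (b : VB (Q.p x)) (z : FE) : tderiv φ
      (⟨x, AE.anchor x (C.lift x b)⟩ : TangentBundle 𝓘(ℝ, EX) X) =
      (G ((eB ⟨Q.p x, b⟩).2, (φ x, z))).1 := by
    have h1 := eq_sum_repr_smul eB (hN hx).2.2.1 bB (hN hx).2.2.2.1 b
    change _ = ∑ i, bB.repr (eB ⟨Q.p x, b⟩).2 i • Xf i (φ x)
    conv_lhs => rw [h1]
    simp only [map_sum, map_smul]
    rw [tderiv_sum_smul]
    refine Finset.sum_congr rfl fun i _ => ?_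
    rw [← (hσ i).eq_lift x, show Xf i (φ x) = _ from chartField_apply (hN hx).1 _]
  have hrB (i) : ContDiff ℝ 1 (fun β : FB => bB.repr β i) :=
    (LinearMap.toContinuousLinearMap (bB.coord i)).contDiff
  have hrF (j) : ContDiff ℝ 1 (fun z : FE => bF.repr z j) :=
    (LinearMap.toContinuousLinearMap (bF.coord j)).contDiff
  refine ⟨⟨N, isOpen_interior, hNx, fun x hx => (hN hx).1, fun x hx => (hN hx).2.1,
    fun x hx => (hN hx).2.2.1, G, R, ?_, ?_, ?_, ?_, ?_, hanchor, hlift, ?_, ?_⟩⟩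
  · intro β v hv
    rw [coord_apply (hN hv).2.1]
    have h1 (i) : ContDiffAt ℝ 1 (fun q : FB × (EX × FE) => bB.repr q.1 i)
        (β, (φ v.proj, (eE v).2)) := (hrB i).contDiffAt.comp _ contDiffAt_fst
    have h2 (j) : ContDiffAt ℝ 1 (fun q : FB × (EX × FE) => bF.repr q.2.2 j)
        (β, (φ v.proj, (eE v).2)) := (hrF j).contDiffAt.comp _ contDiffAt_snd.snd
    refine ContDiffAt.prodMk (ContDiffAt.sum fun i _ => (h1 i).smul
      (ContDiffAt.comp (g := Xf i) _ (hXf i hv) contDiffAt_snd.fst))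
      (ContDiffAt.sum fun i _ => ContDiffAt.sum fun j _ => ((h1 i).mul (h2 j)).smul
        (ContDiffAt.comp (g := Γ i j) _ (hΓ i j hv) contDiffAt_snd.fst)).neg
  · intro v hv
    rw [coord_apply (hN hv).2.1]
    exact ContDiffAt.sum fun j _ => ((hrF j).contDiffAt.comp _ contDiffAt_snd).smul
      (ContDiffAt.comp (g := Yf j) _ (hYf j hv) contDiffAt_fst)
  · intro β β' u
    simp only [G, map_add, Finsupp.add_apply, add_smul, add_mul, Finset.sum_add_distrib,
      neg_add, Prod.mk_add_mk]
  · intro r β u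
    simp only [G, map_smul, Finsupp.smul_apply, smul_eq_mul, mul_smul, Prod.smul_mk, smul_neg,
      Finset.smul_sum]
  · intro r β ξ z
    simp only [G, map_smul, Finsupp.smul_apply, smul_eq_mul, mul_smul, smul_neg,
      Finset.smul_sum]
    refine Prod.ext rfl (congrArg Neg.neg (Finset.sum_congr rfl fun i _ =>
      Finset.sum_congr rfl fun j _ => smul_comm _ _ _))
  · intro a c hc t ht
    set v := c t with hv
    set β := (eB (a t)).2 with hβ
    -- The driving vector at time `t` is extended with constant coefficients in the frame, so that
    -- its horizontal lift is the same combination of the `σ i`.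
    set α : Sec EB FB VB := ∑ i, bB.repr β i • e i with hα
    set s : Sec EX FE VE := ∑ i, bB.repr β i • σ i with hs
    have hsα : C.IsHorizontalLift s α := by
      intro x
      rw [hs, hα, Sec.sum_apply, Sec.sum_apply]
      refine ⟨Submodule.sum_mem _ fun i _ => Submodule.smul_mem _ _ (hσ i x).1, ?_⟩
      rw [map_sum]
      refine Finset.sum_congr rfl fun i _ => ?_
      refine (map_smul (Q.pr x) _ _).trans ?_
      rw [(hσ i x).2]
      rfl
    have hαβ : (eB ⟨Q.p v.proj, α (Q.p v.proj)⟩).2 = β := by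
      rw [hα, Sec.sum_apply, trivialization_sum eB (hN ht).2.2.1]
      refine Eq.trans (Finset.sum_congr rfl fun i _ => ?_) (bB.sum_repr β)
      rw [← (hN ht).2.2.2.1 i]
      exact trivialization_smul eB (hN ht).2.2.1 _ _
    have hαa : (⟨Q.p v.proj, α (Q.p v.proj)⟩ : TotalSpace FB VB) = a t := by
      have h1 : Q.p v.proj = (a t).proj := hc.lies_over t
      have h2 : (a t).proj ∈ eB.baseSet := h1 ▸ (hN ht).2.2.1
      refine eB.injOn (eB.mem_source.2 (hN ht).2.2.1) (eB.mem_source.2 h2) (Prod.ext ?_ hαβ)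
      exact (eB.coe_fst' (x := ⟨Q.p v.proj, α (Q.p v.proj)⟩) (hN ht).2.2.1).trans
        (h1.trans (eB.coe_fst' h2).symm)
    obtain ⟨κ, hκ, hκv⟩ := C.exists_kerSec (hc.mem_ker t)
    have hvel : velocity (𝓘(ℝ, EX).prod 𝓘(ℝ, FE)) c t = AE.adField s κ v.proj :=
      hc.deriv_eq t α s κ hsα hκ hαa hκv
    have hκv' : (⟨v.proj, κ v.proj⟩ : TotalSpace FE VE) = v := by rw [hκv]
    have hφv : ContMDiffAt (𝓘(ℝ, EX).prod 𝓘(ℝ, FE)) 𝓘(ℝ, EX) 1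
        (fun w : TotalSpace FE VE => φ w.proj) v :=
      ContMDiffAt.comp v (g := φ) (contMDiffAt_extChartAt' (hN ht).1) ((contMDiff_proj VE) v)
    have hev : ContMDiffAt (𝓘(ℝ, EX).prod 𝓘(ℝ, FE)) 𝓘(ℝ, FE) 1
        (fun w : TotalSpace FE VE => (eE w).2) v :=
      ((eE.contMDiffAt_iff (f := fun w : TotalSpace FE VE => w)
        (eE.mem_source.2 (hN ht).2.1)).1 contMDiffAt_id).2
    have h1 := hasDerivAtI_of_velocity_eq (hc.mdifferentiable t) hvel hκv' (hφv.mdifferentiableAt one_ne_zero)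
    have h2 := hasDerivAtI_of_velocity_eq (hc.mdifferentiable t) hvel hκv' (hev.mdifferentiableAt one_ne_zero)
    have hcont : ContinuousAt (fun r => c (projIcc 0 1 zero_le_one r)) (t : ℝ) :=
      ContinuousAt.comp (g := c) (by rw [projIcc_val]; exact (hc.mdifferentiable t).continuousAt)
        continuous_projIcc.continuousAt
    have h3 : ∀ᶠ r in 𝓝[Icc 0 1] (t : ℝ), coord EX x₀ (c (projIcc 0 1 zero_le_one r)) =
        (φ (c (projIcc 0 1 zero_le_one r)).proj, (eE (c (projIcc 0 1 zero_le_one r))).2) := by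
      have h4 := ContinuousAt.comp (FiberBundle.continuous_proj FE VE).continuousAt hcont
      have h5 : ∀ᶠ r in 𝓝 (t : ℝ), (c (projIcc 0 1 zero_le_one r)).proj ∈ eE.baseSet :=
        h4.eventually_mem (eE.open_baseSet.mem_nhds (by
        change (c (projIcc 0 1 zero_le_one (t : ℝ))).proj ∈ _
        rw [projIcc_val]
        exact (hN ht).2.1))
      exact (h5.filter_mono nhdsWithin_le_nhds).mono fun r hr => coord_apply hr
    refine HasDerivWithinAt.congr_of_eventuallyEq (HasDerivWithinAt.prodMk h1 h2) h3
      (h3.self_of_nhdsWithin t.2) |>.congr_deriv ?_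
    rw [coord_apply (hN ht).2.1]
    refine Prod.ext ?_ ?_
    · have h4 : tderiv φ (⟨v.proj, AE.anchor v.proj (s v.proj)⟩ : TangentBundle 𝓘(ℝ, EX) X) =
          (G (β, (φ v.proj, (eE v).2))).1 := by
        rw [hsα.eq_lift, hlift _ ht _ (eE v).2, hαβ]
      refine Eq.trans ?_ h4
      change _ - deriv (fun _ : ℝ => φ v.proj) 0 = _
      rw [deriv_const, sub_zero]
      rfl
    · have h4 : deriv (fun r : ℝ => (eE ⟨v.proj, κ v.proj + r • AE.bracket s κ v.proj⟩).2) 0 =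
          (eE ⟨v.proj, AE.bracket s κ v.proj⟩).2 := by
        simp only [trivialization_add eE (hN ht).2.1, trivialization_smul eE (hN ht).2.1]
        have := ((hasDerivAt_id (0 : ℝ)).smul_const
          (eE ⟨v.proj, AE.bracket s κ v.proj⟩).2).const_add (eE ⟨v.proj, κ v.proj⟩).2
        rw [one_smul] at this
        exact this.deriv
      -- The trivialized bracket contains the derivative of `κ` along the anchor. It cancels against
      -- the same derivative in `adField`, leaving an expression in the value of `κ` alone.
      have h5 := AE.trivialization_bracket (e := eE) (hN ht).2.1 bF
        (Filter.mem_of_superset (isOpen_interior.mem_nhds ht) fun y hy => (hN hy).2.2.2.2) s κ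
      have h6 (j) : (eE ⟨v.proj, AE.bracket s (ε j) v.proj⟩).2 =
          ∑ i, bB.repr β i • Γ i j (φ v.proj) := by
        rw [hs, AE.sum_smul_bracket, Sec.sum_apply, trivialization_sum eE (hN ht).2.1]
        refine Finset.sum_congr rfl fun i _ => ?_
        refine (trivialization_smul eE (hN ht).2.1 _ _).trans ?_
        simp only [Γ, hφ]
        rw [(extChartAt 𝓘(ℝ, EX) x₀).left_inv (by rw [extChartAt_source]; exact (hN ht).1)]
      rw [← h4, hκv'] at h5
      have h7 : (∑ j, bF.repr (eE v).2 j • (eE ⟨v.proj, AE.bracket s (ε j) v.proj⟩).2) =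
          ∑ i, ∑ j, (bB.repr β i * bF.repr (eE v).2 j) • Γ i j (φ v.proj) := by
        rw [Finset.sum_comm]
        refine Finset.sum_congr rfl fun j _ => ?_
        rw [h6, Finset.smul_sum]
        refine Finset.sum_congr rfl fun i _ => ?_
        rw [smul_smul, mul_comm]
      rw [h7] at h5
      change _ - deriv (fun r : ℝ => (eE ⟨v.proj, κ v.proj + r • AE.bracket s κ v.proj⟩).2) 0 =
        -∑ i, ∑ j, (bB.repr β i * bF.repr (eE v).2 j) • Γ i j (φ v.proj)
      rw [h5]
      exact sub_add_cancel_left _ _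
  · intro β v hv ζ
    rw [coord_apply (hN hv).2.1]
    refine fderiv_frame_identity bF (fun j => (hYf j hv).differentiableAt one_ne_zero)
      (fun i => (hXf i hv).differentiableAt one_ne_zero) (fun i k => ?_) _ _ ζ
    have h1 := hanchor ⟨v.proj, AE.bracket (σ i) (ε k) v.proj⟩ hv
    rw [AE.anchor_bracket] at h1
    have h2 := tderiv_mlieBracket (hN hv).1 (AE.contMDiff_anchor_sec (σ i) (by simp) v.proj)
      (AE.contMDiff_anchor_sec (ε k) (by simp) v.proj)
    refine Eq.trans ?_ (h1.symm.trans h2)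
    rw [coord_apply (v := (⟨v.proj, AE.bracket (σ i) (ε k) v.proj⟩ : TotalSpace FE VE))
      (hN hv).2.1]
    have h3 : φ.symm (φ v.proj) = v.proj := (extChartAt 𝓘(ℝ, EX) x₀).left_inv
      (by rw [extChartAt_source]; exact (hN hv).1)
    simp only [R, Γ]
    rw [h3]

end Extension.Connection

end ChartModel


/-! ### Affine segments in the unit interval, local-to-global and compactness arguments. -/

section Interval

/-- The point `(1 - s) t₁ + s t₂` of the unit interval. -/
def seg (t₁ t₂ s : Interval) : Interval :=
  ⟨(1 - s) * t₁ + s * t₂, by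
    have h1 := t₁.2.1
    have h2 := t₂.2.1
    have h3 := s.2.1
    have h4 := s.2.2
    constructor
    · exact add_nonneg (mul_nonneg (by linarith) h1) (mul_nonneg h3 h2)
    · nlinarith [t₁.2.2, t₂.2.2]⟩

theorem coe_seg (t₁ t₂ s : Interval) : (seg t₁ t₂ s : ℝ) = (1 - s) * t₁ + s * t₂ :=
  rfl

theorem seg_zero (t₁ t₂ : Interval) : seg t₁ t₂ 0 = t₁ :=
  Subtype.ext (by simp [coe_seg])

theorem seg_one (t₁ t₂ : Interval) : seg t₁ t₂ 1 = t₂ :=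
  Subtype.ext (by simp [coe_seg])

theorem seg_self (t s : Interval) : seg t t s = t :=
  Subtype.ext (by rw [coe_seg]; ring)

theorem continuous_seg :
    Continuous (fun q : Interval × Interval × Interval => seg q.1 q.2.1 q.2.2) :=
  Continuous.subtype_mk (by fun_prop) _

theorem dist_seg_lt {t t₁ t₂ s : Interval} {δ : ℝ} (h₁ : dist t₁ t < δ) (h₂ : dist t₂ t < δ) :
    dist (seg t₁ t₂ s) t < δ := by
  rw [Subtype.dist_eq, Real.dist_eq] at *
  have h3 := s.2.1
  have h4 := s.2.2
  have h5 : (seg t₁ t₂ s : ℝ) - t = (1 - s) * (t₁ - t) + s * (t₂ - t) := by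
    rw [coe_seg]
    ring
  rw [h5]
  refine (abs_add_le _ _).trans_lt ?_
  rw [abs_mul, abs_mul, abs_of_nonneg h3, abs_of_nonneg (sub_nonneg.2 h4)]
  rcases h3.eq_or_lt with h | h
  · rw [← h]
    simpa using h₁
  · nlinarith

theorem hasDerivAtI_seg (t₁ t₂ s : Interval) :
    HasDerivAtI (fun s => (seg t₁ t₂ s : ℝ)) (t₂ - t₁) s := by
  have h1 : HasDerivWithinAt (fun r : ℝ => (1 - r) * t₁ + r * t₂) ((t₂ : ℝ) - t₁) (Icc 0 1) s := by
    have := (((hasDerivAt_id (s : ℝ)).const_sub 1).mul_const (t₁ : ℝ)).add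
      ((hasDerivAt_id (s : ℝ)).mul_const (t₂ : ℝ))
    exact (this.congr_deriv (by ring)).hasDerivWithinAt
  refine h1.congr (fun r hr => ?_) ?_
  · rw [projIcc_of_mem _ hr]
    rfl
  · rw [projIcc_val]
    rfl

/-- Connectedness of the interval: the hypothesis makes `S` open and closed. It replaces subdivision
into small steps and works in both directions of time. -/
theorem forall_mem_of_locally {S : Set Interval} {t₀ : Interval} (h₀ : t₀ ∈ S)
    (h : ∀ t : Interval, ∃ δ > 0, ∀ t₁ t₂, dist t₁ t < δ → dist t₂ t < δ → t₁ ∈ S → t₂ ∈ S)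
    (t : Interval) : t ∈ S := by
  have hS : IsClopen S := by
    constructor
    · rw [← closure_subset_iff_isClosed]
      intro t ht
      obtain ⟨δ, hδ, hS⟩ := h t
      obtain ⟨t₁, h₁, h₂⟩ := Metric.mem_closure_iff.1 ht δ hδ
      exact hS t₁ t (by rwa [dist_comm]) (by rwa [dist_self]) h₁
    · rw [Metric.isOpen_iff]
      intro t ht
      obtain ⟨δ, hδ, hS⟩ := h t
      exact ⟨δ, hδ, fun t₂ h₂ => hS t t₂ (by rwa [dist_self]) h₂ ht⟩
  have := hS.eq_univ ⟨t₀, h₀⟩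
  rw [this]
  trivial

/-- Convergence with moving argument is locally uniform convergence, hence uniform on the compact
interval. -/
theorem tendstoUniformlyOn_of_forall_tendsto {P X : Type*} [PseudoMetricSpace X] {l : Filter P}
    {b : P → Interval → X} {b₀ : Interval → X} (hb₀ : Continuous b₀)
    (h : ∀ s, Tendsto (fun q : P × Interval => b q.1 q.2) (l ×ˢ 𝓝 s) (𝓝 (b₀ s))) :
    TendstoUniformlyOn (fun p s => b p (projIcc 0 1 zero_le_one s))
      (fun s => b₀ (projIcc 0 1 zero_le_one s)) l (Icc (0 : ℝ) 1) := by
  rw [← tendstoLocallyUniformlyOn_iff_tendstoUniformlyOn_of_compact isCompact_Icc,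
    tendstoLocallyUniformlyOn_iff_forall_tendsto]
  intro s hs
  rw [tendsto_uniformity_iff_dist_tendsto_zero]
  have h1 : Tendsto (projIcc (0 : ℝ) 1 zero_le_one) (𝓝[Icc 0 1] s)
      (𝓝 (projIcc (0 : ℝ) 1 zero_le_one s)) :=
    continuous_projIcc.continuousAt.mono_left nhdsWithin_le_nhds
  have h2 := ((hb₀.tendsto _).comp (h1.comp (tendsto_snd (f := l)))).dist
    ((h (projIcc 0 1 zero_le_one s)).comp (tendsto_fst.prodMk (h1.comp tendsto_snd)))
  rw [dist_self] at h2
  exact h2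

theorem HasDerivAtI.comp_reparam {E : Type*} [NormedAddCommGroup E] [NormedSpace ℝ E]
    {u : Interval → E} {ρ : Interval → Interval} {t : Interval} {D : E} {r : ℝ}
    (hu : HasDerivAtI u D (ρ t)) (hρ : HasDerivAtI (fun s => (ρ s : ℝ)) r t) :
    HasDerivAtI (fun s => u (ρ s)) (r • D) t := by
  have h1 : HasDerivWithinAt (fun s : ℝ => u (projIcc 0 1 zero_le_one s)) D (Icc 0 1)
      (ρ (projIcc 0 1 zero_le_one (t : ℝ)) : ℝ) := by
    rw [projIcc_val]
    exact hu
  have h2 := HasDerivWithinAt.scomp (t : ℝ) h1 hρ (fun s _ => (ρ _).2)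
  refine h2.congr (fun s _ => ?_) ?_ <;> simp

theorem HasDerivAtI.congr {E : Type*} [NormedAddCommGroup E] [NormedSpace ℝ E]
    {u v : Interval → E} {t : Interval} {D : E} (hu : HasDerivAtI u D t)
    (h : ∀ᶠ s in 𝓝 t, v s = u s) : HasDerivAtI v D t :=
  HasDerivWithinAt.congr_of_eventuallyEq hu ((tendsto_projIcc t).eventually h)
    (by rw [projIcc_val]; exact h.self_of_nhds)

end Interval

/-! ### Solutions of the parallel equation: reparametrization, continuous dependence and uniqueness.
-/

section Weak

variable {EX : Type*} [NormedAddCommGroup EX] [NormedSpace ℝ EX]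
  {X : Type*} [TopologicalSpace X] [ChartedSpace EX X] [IsManifold 𝓘(ℝ, EX) ∞ X]
  {FE : Type*} [NormedAddCommGroup FE] [NormedSpace ℝ FE]
  {VE : X → Type*} [TopologicalSpace (TotalSpace FE VE)] [∀ x, TopologicalSpace (VE x)]
  [∀ x, AddCommGroup (VE x)] [∀ x, Module ℝ (VE x)] [FiberBundle FE VE] [VectorBundle ℝ FE VE]
  [ContMDiffVectorBundle ∞ FE VE 𝓘(ℝ, EX)]
  {EB : Type*} [NormedAddCommGroup EB] [NormedSpace ℝ EB]
  {B : Type*} [TopologicalSpace B] [ChartedSpace EB B] [IsManifold 𝓘(ℝ, EB) ∞ B]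
  {FB : Type*} [NormedAddCommGroup FB] [NormedSpace ℝ FB]
  {VB : B → Type*} [TopologicalSpace (TotalSpace FB VB)] [∀ b, TopologicalSpace (VB b)]
  [∀ b, AddCommGroup (VB b)] [∀ b, Module ℝ (VB b)] [FiberBundle FB VB] [VectorBundle ℝ FB VB]
  [ContMDiffVectorBundle ∞ FB VB 𝓘(ℝ, EB)]
  {AE : LieAlgebroid EX FE VE} {AB : LieAlgebroid EB FB VB} {Q : Extension AE AB}

namespace Extension.Connection

/-- `c` solves the parallel transport equation along `a` in all charts. -/
structure IsWeakParallel (C : Q.Connection) (a : Interval → TotalSpace FB VB)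
    (c : Interval → TotalSpace FE VE) : Prop where
  continuous : Continuous c
  lies_over : ∀ t, Q.p (c t).proj = (a t).proj
  hasDerivAtI : ∀ (x₀ : X) (m : C.ChartModel x₀) (t : Interval), (c t).proj ∈ m.N →
    HasDerivAtI (fun s => coord EX x₀ (c s))
      (m.G ((trivializationAt FB VB (Q.p x₀) (a t)).2, coord EX x₀ (c t))) t

variable {C : Q.Connection}

theorem IsParallel.isWeakParallel {a : Interval → TotalSpace FB VB}
    {c : Interval → TotalSpace FE VE} (h : C.IsParallel a c) : C.IsWeakParallel a c :=
  ⟨h.mdifferentiable.continuous, h.lies_over, fun _ m => m.hasDerivAtI a c h⟩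

/-- The chain rule and linearity of `G` in the driving vector. The speed `r` may vanish or be
negative, so time reversal and constant reparametrizations are included. -/
theorem IsWeakParallel.comp_reparam {a : Interval → TotalSpace FB VB}
    {c : Interval → TotalSpace FE VE} (h : C.IsWeakParallel a c) {ρ : Interval → Interval}
    (hρ : Continuous ρ) {r : Interval → ℝ}
    (hr : ∀ s, HasDerivAtI (fun s => (ρ s : ℝ)) (r s) s) :
    C.IsWeakParallel (fun s => fibreSMul (r s) (a (ρ s))) (fun s => c (ρ s)) := by
  refine ⟨h.continuous.comp hρ, fun t => h.lies_over (ρ t), fun x₀ m t ht => ?_⟩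
  have h1 := (h.hasDerivAtI x₀ m (ρ t) ht).comp_reparam (hr t)
  rw [trivialization_fibreSMul, m.G_smul]
  · exact h1
  · rw [← h.lies_over]
    exact m.base _ ht

omit [NormedSpace ℝ EX] [NormedSpace ℝ FE] [(x : X) → Module ℝ (VE x)] [VectorBundle ℝ FE VE] in
omit [IsManifold 𝓘(ℝ, EX) ∞ X] [ContMDiffVectorBundle ∞ FE VE 𝓘(ℝ, EX)] in
theorem mem_source_chartAt_zero (v : TotalSpace FE VE) :
    v ∈ (chartAt (ModelProd EX FE) (⟨v.proj, 0⟩ : TotalSpace FE VE)).source := by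
  have h := mem_chart_source (ModelProd EX FE) v
  rw [FiberBundle.chartedSpace_chartAt] at h ⊢
  exact h

omit [IsManifold 𝓘(ℝ, EX) ∞ X] [ContMDiffVectorBundle ∞ FE VE 𝓘(ℝ, EX)] in
theorem coord_fibreSMul {x₀ : X} {v : TotalSpace FE VE} (r : ℝ)
    (hv : v.proj ∈ (trivializationAt FE VE x₀).baseSet) :
    coord EX x₀ (fibreSMul r v) = ((coord EX x₀ v).1, r • (coord EX x₀ v).2) := by
  rw [coord_apply hv, coord_apply (v := fibreSMul r v) hv, trivialization_fibreSMul _ _ hv]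
  rfl

/-- The vector field is linear: its base part ignores the fibre variable and its fibre part is
homogeneous in it. -/
theorem IsWeakParallel.fibreSMul {a : Interval → TotalSpace FB VB}
    {c : Interval → TotalSpace FE VE} (h : C.IsWeakParallel a c) (r : ℝ) :
    C.IsWeakParallel a (fun s => fibreSMul r (c s)) := by
  refine ⟨continuous_fibreSMul.comp (continuous_const.prodMk h.continuous),
    h.lies_over, fun x₀ m t ht => ?_⟩
  have ht' : (c t).proj ∈ m.N := ht
  have h1 := h.hasDerivAtI x₀ m t ht'
  rw [coord_fibreSMul r (m.baseSet ht'), m.G_fibre]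
  have h2 : HasDerivAtI (fun s => ((coord EX x₀ (c s)).1, r • (coord EX x₀ (c s)).2))
      ((m.G ((trivializationAt FB VB (Q.p x₀) (a t)).2, coord EX x₀ (c t))).1,
      r • (m.G ((trivializationAt FB VB (Q.p x₀) (a t)).2, coord EX x₀ (c t))).2) t :=
    HasDerivWithinAt.prodMk
      ((ContinuousLinearMap.fst ℝ EX FE).hasFDerivAt.comp_hasDerivWithinAt _ h1)
      (((ContinuousLinearMap.snd ℝ EX FE).hasFDerivAt.comp_hasDerivWithinAt _ h1).const_smul r)
  refine h2.congr ?_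
  have h3 : ContinuousAt (fun s => (c s).proj) t :=
    ((FiberBundle.continuous_proj FE VE).comp h.continuous).continuousAt
  filter_upwards [h3 (m.isOpen_N.mem_nhds ht')] with s hs
  exact coord_fibreSMul r (m.baseSet hs)

variable [FiniteDimensional ℝ EX] [FiniteDimensional ℝ FE] [FiniteDimensional ℝ EB]
  [FiniteDimensional ℝ FB] [T2Space X] [T2Space B]

/-- Continuous dependence of parallel curves on the initial value and on the driving path. -/
theorem IsWeakParallel.tendsto {P : Type*} {l : Filter P} {a : P → Interval → TotalSpace FB VB}
    {a₀ : Interval → TotalSpace FB VB} {u : P → Interval → TotalSpace FE VE}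
    {u₀ : Interval → TotalSpace FE VE} (hu : ∀ p, C.IsWeakParallel (a p) (u p))
    (hu₀ : C.IsWeakParallel a₀ u₀) (ha₀ : Continuous a₀)
    (ha : ∀ s, Tendsto (fun q : P × Interval => a q.1 q.2) (l ×ˢ 𝓝 s) (𝓝 (a₀ s)))
    {t₁ : Interval} (h₁ : Tendsto (fun p => u p t₁) l (𝓝 (u₀ t₁))) (t : Interval) :
    Tendsto (fun p => u p t) l (𝓝 (u₀ t)) := by
  have : T2Space (TotalSpace FE VE) := t2Space_totalSpace
  refine forall_mem_of_locally (S := {t | Tendsto (fun p => u p t) l (𝓝 (u₀ t))}) h₁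
    (fun t => ?_) t
  set x₀ := (u₀ t).proj with hx₀
  obtain ⟨m⟩ := C.nonempty_chartModel x₀
  set eB := trivializationAt FB VB (Q.p x₀) with heB
  let χ : OpenPartialHomeomorph (TotalSpace FE VE) (EX × FE) :=
    chartAt (ModelProd EX FE) (⟨x₀, 0⟩ : TotalSpace FE VE)
  have hχ : ∀ v, χ v = coord EX x₀ v := fun v => rfl
  have hproj := FiberBundle.continuous_proj FE VE
  have hz : u₀ t ∈ χ.source := mem_source_chartAt_zero (u₀ t)
  obtain ⟨W, hW, V, hV, hWO, key⟩ := exists_nhds_tendsto_of_ode χ hz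
    (m.contDiffAt_G (eB (a₀ t)).2 (u₀ t) m.mem_N)
    (hproj.continuousAt (m.isOpen_N.mem_nhds m.mem_N))
  have hcB {s : Interval} (hs : (u₀ s).proj ∈ m.N) : ContinuousAt (fun w => (eB w).2) (a₀ s) := by
    refine continuousAt_snd.comp (eB.continuousAt (eB.mem_source.2 ?_))
    rw [← hu₀.lies_over]
    exact m.base _ hs
  obtain ⟨δ, hδ, hδW⟩ := Metric.mem_nhds_iff.1 (inter_mem (hu₀.continuous.continuousAt hW)
    (ContinuousAt.comp (g := fun w => (eB w).2) (hcB m.mem_N) ha₀.continuousAt hV))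
  refine ⟨δ, hδ, fun t₁ t₂ ht₁ ht₂ hS => ?_⟩
  have hseg (s : Interval) := hδW (dist_seg_lt (s := s) ht₁ ht₂)
  have hsegc : Continuous (seg t₁ t₂) :=
    continuous_seg.comp (continuous_const.prodMk (continuous_const.prodMk continuous_id))
  -- Time is rescaled so that `t₁` becomes `0` and `t₂` becomes `1`. The factor `t₂ - t₁` may be
  -- negative, which covers propagation backwards.
  have hode {a : Interval → TotalSpace FB VB} {u : Interval → TotalSpace FE VE}
      (hu : C.IsWeakParallel a u) (s : ℝ) (hs : s ∈ Icc (0 : ℝ) 1)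
      (hN : (u (seg t₁ t₂ (projIcc 0 1 zero_le_one s))).proj ∈ m.N) : HasDerivWithinAt
      (fun s => χ (u (seg t₁ t₂ (projIcc 0 1 zero_le_one s))))
      (((t₂ : ℝ) - t₁) • m.G ((eB (a (seg t₁ t₂ (projIcc 0 1 zero_le_one s)))).2,
        χ (u (seg t₁ t₂ (projIcc 0 1 zero_le_one s))))) (Icc 0 1) s := by
    have h1 := (hu.hasDerivAtI x₀ m (seg t₁ t₂ (projIcc 0 1 zero_le_one s)) hN).comp_reparam
      (hasDerivAtI_seg t₁ t₂ _)
    unfold HasDerivAtI at h1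
    rwa [projIcc_of_mem zero_le_one hs] at h1 ⊢
  have hunif := tendstoUniformlyOn_of_forall_tendsto (l := l)
    (b := fun p s => (eB (a p (seg t₁ t₂ s))).2) (b₀ := fun s => (eB (a₀ (seg t₁ t₂ s))).2)
    (continuous_iff_continuousAt.2 fun s => ContinuousAt.comp (g := fun w => (eB w).2)
      (hcB (hWO (hseg s).1).1) (ha₀.comp hsegc).continuousAt)
    (fun s => Tendsto.comp (g := fun w => (eB w).2) (hcB (hWO (hseg s).1).1)
      ((ha (seg t₁ t₂ s)).comp (tendsto_fst.prodMk ((hsegc.tendsto s).comp tendsto_snd))))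
  have hlim (ε : ℝ) (hε : 0 < ε) := key l
    (fun p s => u p (seg t₁ t₂ (projIcc 0 1 zero_le_one s)))
    _ (fun s => u₀ (seg t₁ t₂ (projIcc 0 1 zero_le_one s)))
    _ ((t₂ : ℝ) - t₁) (fun p => (hu p).continuous.comp (hsegc.comp continuous_projIcc))
    (hu₀.continuous.comp (hsegc.comp continuous_projIcc)) (fun s _ => (hseg _).1)
    (fun s _ => (hseg _).2) hunif (by simpa [seg_zero] using hS)
    (Eventually.of_forall fun p s hs h => hode (hu p) s hs h)
    (fun s hs => hode hu₀ s hs (hWO (hseg _).1).1) ε hε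
  simp only [mem_inter_iff] at hlim
  have hend (ε : ℝ) (hε : 0 < ε) : ∀ᶠ p in l, u p t₂ ∈ χ.source ∧
      dist (χ (u p t₂)) (χ (u₀ t₂)) < ε := by
    filter_upwards [hlim ε hε] with p hp
    have h1 := hp 1 (by simp)
    rw [projIcc_right] at h1
    rw [show (⟨1, right_mem_Icc.2 zero_le_one⟩ : Interval) = 1 from rfl, seg_one] at h1
    exact ⟨h1.1.2, h1.2⟩
  have hz₂ : u₀ t₂ ∈ χ.source := by
    have := (hWO (hseg 1).1).2
    rwa [seg_one] at this
  have h1 : Tendsto (fun p => χ (u p t₂)) l (𝓝 (χ (u₀ t₂))) :=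
    Metric.tendsto_nhds.2 fun ε hε => (hend ε hε).mono fun p hp => hp.2
  have h2 := (χ.continuousAt_symm (χ.map_source hz₂)).tendsto.comp h1
  rw [χ.left_inv hz₂] at h2
  refine h2.congr' ?_
  filter_upwards [hend 1 one_pos] with p hp
  exact χ.left_inv hp.1

/-- Uniqueness is continuous dependence for a constant family, in a Hausdorff space. -/
theorem IsWeakParallel.eq {a : Interval → TotalSpace FB VB} {u u' : Interval → TotalSpace FE VE}
    (hu : C.IsWeakParallel a u) (hu' : C.IsWeakParallel a u') (ha : Continuous a) {t₁ : Interval}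
    (h : u t₁ = u' t₁) (t : Interval) : u t = u' t := by
  have : T2Space (TotalSpace FE VE) := t2Space_totalSpace
  have h1 := IsWeakParallel.tendsto (P := Unit) (l := pure ()) (a := fun _ => a) (u := fun _ => u)
    (fun _ => hu) hu' ha (fun s => (ha.tendsto s).comp tendsto_snd) (t₁ := t₁)
    (by rw [h]; exact tendsto_const_nhds) t
  exact tendsto_nhds_unique tendsto_const_nhds h1

/-- The final time is made a parameter: each curve is rescaled to run from `t₁` to that time over
the unit interval and evaluated at `1`. -/
theorem IsWeakParallel.tendsto_prod {P : Type*} {l : Filter P}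
    {a : P → Interval → TotalSpace FB VB}
    {a₀ : Interval → TotalSpace FB VB} {u : P → Interval → TotalSpace FE VE}
    {u₀ : Interval → TotalSpace FE VE} (hu : ∀ p, C.IsWeakParallel (a p) (u p))
    (hu₀ : C.IsWeakParallel a₀ u₀) (ha₀ : Continuous a₀)
    (ha : ∀ s, Tendsto (fun q : P × Interval => a q.1 q.2) (l ×ˢ 𝓝 s) (𝓝 (a₀ s)))
    {t₁ : Interval} (h₁ : Tendsto (fun p => u p t₁) l (𝓝 (u₀ t₁))) (t : Interval) :
    Tendsto (fun q : P × Interval => u q.1 q.2) (l ×ˢ 𝓝 t) (𝓝 (u₀ t)) := by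
  have hsegc (t : Interval) : Continuous (seg t₁ t) :=
    continuous_seg.comp (continuous_const.prodMk (continuous_const.prodMk continuous_id))
  have h := IsWeakParallel.tendsto (P := P × Interval) (l := l ×ˢ 𝓝 t) (C := C)
    (u := fun q s => u q.1 (seg t₁ q.2 s))
    (fun q => (hu q.1).comp_reparam (hsegc q.2) (hasDerivAtI_seg t₁ q.2))
    (hu₀.comp_reparam (hsegc t) (hasDerivAtI_seg t₁ t))
    (continuous_fibreSMul.comp (continuous_const.prodMk (ha₀.comp (hsegc t)))) ?_ (t₁ := 0)
    (by simp only [seg_zero]; exact h₁.comp tendsto_fst) 1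
  · simpa only [seg_one] using h
  · intro s
    have h1 : Tendsto (fun q : (P × Interval) × Interval => seg t₁ q.1.2 q.2)
        ((l ×ˢ 𝓝 t) ×ˢ 𝓝 s) (𝓝 (seg t₁ t s)) :=
      (continuous_seg.tendsto (t₁, t, s)).comp (tendsto_const_nhds.prodMk_nhds
        ((tendsto_snd.comp tendsto_fst).prodMk_nhds tendsto_snd))
    have h2 : Tendsto (fun q : (P × Interval) × Interval => ((q.1.2 : ℝ) - t₁,
        a q.1.1 (seg t₁ q.1.2 q.2))) ((l ×ˢ 𝓝 t) ×ˢ 𝓝 s) (𝓝 ((t : ℝ) - t₁, a₀ (seg t₁ t s))) :=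
      (((continuous_subtype_val.tendsto t).comp
        (tendsto_snd.comp tendsto_fst)).sub_const _).prodMk_nhds
        ((ha _).comp ((tendsto_fst.comp tendsto_fst).prodMk h1))
    exact (continuous_fibreSMul.tendsto _).comp h2

end Extension.Connection

end Weak


/-! ### Reparametrization of strictly differentiable families and of algebroid paths. -/

section StrictCurves

variable {Y Y' : Type*} {E E' H H' : Type*} [NormedAddCommGroup E] [NormedSpace ℝ E]
  [NormedAddCommGroup E'] [NormedSpace ℝ E'] [TopologicalSpace H] [TopologicalSpace H']
  {I : ModelWithCorners ℝ E H} {I' : ModelWithCorners ℝ E' H'}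
  {Z Z' : Type*} [TopologicalSpace Z] [ChartedSpace H Z]
  [TopologicalSpace Z'] [ChartedSpace H' Z'] [TopologicalSpace Y] [TopologicalSpace Y']

omit [TopologicalSpace Y] in
theorem hasStrictDerivFam_coe {l : Filter Y} (t : Interval) :
    HasStrictDerivFam (fun (_ : Y) s => (s : ℝ)) l t 1 := by
  unfold HasStrictDerivFam
  simp only [smul_eq_mul, mul_one, sub_self]
  exact isLittleO_zero _ _

omit [TopologicalSpace Y] in
theorem HasStrictDerivAt.hasStrictDerivFam {f : ℝ → E} {D : E} {t : Interval} {l : Filter Y}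
    (h : HasStrictDerivAt f D t) : HasStrictDerivFam (fun (_ : Y) s => f s) l t D := by
  have h1 := (hasStrictDerivFam_coe (l := l) t).comp_strictFDeriv
    (HasStrictDerivAt.hasStrictFDerivAt h) ((continuous_subtype_val.tendsto t).comp tendsto_snd)
  simpa using h1

/-- Affine reparametrizations whose coefficients depend continuously on a parameter. -/
theorem hasStrictDerivFam_affine {f : Y → Interval → ℝ} {g : Y → ℝ} {y₀ : Y} {t : Interval}
    (hg : ContinuousAt g y₀) (h : ∀ y t t', f y t' - f y t = ((t' : ℝ) - t) * g y) :
    HasStrictDerivFam f (𝓝 y₀) t (g y₀) := by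
  have h1 : Tendsto (fun p : Y × Interval × Interval => g p.1 - g y₀) (𝓝 y₀ ×ˢ 𝓝 t ×ˢ 𝓝 t)
      (𝓝 0) := by
    have := (hg.tendsto.comp (tendsto_fst (g := 𝓝 t ×ˢ 𝓝 t))).sub_const (g y₀)
    rwa [sub_self] at this
  have h2 := ((isLittleO_one_iff ℝ).2 h1).mul_isBigO
    (isBigO_refl (fun p : Y × Interval × Interval => ((p.2.2 : ℝ) - p.2.1)) _)
  refine (h2.congr_left fun p => ?_).congr_right fun p => one_mul _
  rw [h, smul_eq_mul]
  ring

theorem StrictAt.prodMk {u : Y → Interval → Z} {v : Y → Interval → Z'} {y₀ : Y} {t₀ : Interval}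
    (hu : StrictAt I u y₀ t₀) (hv : StrictAt I' v y₀ t₀) :
    StrictAt (I.prod I') (fun y t => (u y t, v y t)) y₀ t₀ := by
  obtain ⟨hu, D, hD⟩ := hu
  obtain ⟨hv, D', hD'⟩ := hv
  refine ⟨hu.prodMk hv, (D, D'), ?_⟩
  simp only [extChartAt_prod]
  exact hD.prodMk hD'

theorem StrictAt.comp_reparam {u : Y → Interval → Z} {k : Y' → Y} {θ : Y' → Interval → Interval}
    {y₀ : Y'} {t₁ : Interval} (h : StrictAt I u (k y₀) (θ y₀ t₁)) (hk : ContinuousAt k y₀)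
    (hθc : ContinuousAt (fun p : Y' × Interval => θ p.1 p.2) (y₀, t₁)) {m : ℝ}
    (hθ : HasStrictDerivFam (fun y t => (θ y t : ℝ)) (𝓝 y₀) t₁ m) :
    StrictAt I (fun y t => u (k y) (θ y t)) y₀ t₁ := by
  refine ⟨?_, _, h.2.choose_spec.comp_reparam hk hθ (by rw [← nhds_prod_eq]; exact hθc)⟩
  have h1 : ContinuousAt (fun p : Y' × Interval => (k p.1, θ p.1 p.2)) (y₀, t₁) :=
    (ContinuousAt.comp (g := k) hk continuousAt_fst).prodMk hθc
  exact ContinuousAt.comp (g := fun p : Y × Interval => u p.1 p.2)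
    (f := fun p : Y' × Interval => (k p.1, θ p.1 p.2)) (x := (y₀, t₁)) h.1 h1

theorem mfderiv_comp_reparam [IsManifold I 1 Z] {c : Interval → Z} {ρ : Interval → Interval}
    {t : Interval} {r : ℝ} (hc : MDifferentiableAt (𝓡∂ 1) I c (ρ t)) (hρc : ContinuousAt ρ t)
    (hρ : HasDerivAtI (fun s => (ρ s : ℝ)) r t) :
    MDifferentiableAt (𝓡∂ 1) I (fun s => c (ρ s)) t ∧
      (mfderiv (𝓡∂ 1) I (fun s => c (ρ s)) t (1 : TangentSpace (𝓡∂ 1) t) : E) =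
        r • (mfderiv (𝓡∂ 1) I c (ρ t) (1 : TangentSpace (𝓡∂ 1) (ρ t)) : E) := by
  have h1 := hasDerivAtI_comp hc (mdifferentiableAt_extChartAt (I := I)
    (mem_chart_source H (c (ρ t))))
  rw [show tderiv (extChartAt I (c (ρ t))) (velocity I c (ρ t)) = _ from
    tderiv_extChartAt_self (velocity I c (ρ t))] at h1
  exact mdifferentiableAt_of_hasDerivAtI (ContinuousAt.comp (g := c) hc.continuousAt hρc)
    (h1.comp_reparam hρ)

end StrictCurves

section Paths

variable {EM : Type*} [NormedAddCommGroup EM] [NormedSpace ℝ EM]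
  {M : Type*} [TopologicalSpace M] [ChartedSpace EM M]
  {F : Type*} [NormedAddCommGroup F] [NormedSpace ℝ F]
  {V : M → Type*} [TopologicalSpace (TotalSpace F V)] [∀ x, TopologicalSpace (V x)]
  [∀ x, AddCommGroup (V x)] [∀ x, Module ℝ (V x)] [FiberBundle F V] [VectorBundle ℝ F V]
  [IsManifold 𝓘(ℝ, EM) ∞ M] [ContMDiffVectorBundle ∞ F V 𝓘(ℝ, EM)] {A : LieAlgebroid EM F V}
  {Y Y' : Type*} [TopologicalSpace Y] [TopologicalSpace Y']

theorem StrictAt.fibreSMul {r : Y → Interval → ℝ} {u : Y → Interval → TotalSpace F V} {y₀ : Y}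
    {t₀ : Interval} (hr : StrictAt 𝓘(ℝ, ℝ) r y₀ t₀)
    (hu : StrictAt (𝓘(ℝ, EM).prod 𝓘(ℝ, F)) u y₀ t₀) :
    StrictAt (𝓘(ℝ, EM).prod 𝓘(ℝ, F)) (fun y t => fibreSMul (r y t) (u y t)) y₀ t₀ :=
  (hr.prodMk hu).comp_contMDiffAt (F := fun p : ℝ × TotalSpace F V => AlgebroidSplitting.fibreSMul p.1 p.2)
    (contMDiff_fibreSMul.contMDiffAt)

theorem LieAlgebroid.Path.strictAt (a : A.Path) (y : Y) (t : Interval) :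
    StrictAt (𝓘(ℝ, EM).prod 𝓘(ℝ, F)) (fun (_ : Y) => a.toFun) y t :=
  LieAlgebroid.continuous_path_iff.1 (continuous_const (y := a)) y t

/-- An `A`-path from a strictly differentiable curve. -/
def LieAlgebroid.Path.ofStrictAt (A : LieAlgebroid EM F V) (c : Interval → TotalSpace F V)
    (hc : ∀ t, StrictAt (𝓘(ℝ, EM).prod 𝓘(ℝ, F)) (fun _ : Unit => c) () t)
    (h : ∀ t : Interval,
      mfderiv (𝓡∂ 1) 𝓘(ℝ, EM) (fun s => (c s).proj) t (1 : TangentSpace (𝓡∂ 1) t)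
        = A.anchor (c t).proj (c t).2) : A.Path :=
  ⟨c, contMDiff_of_continuous_velocity (fun t => (hc t).mdifferentiableAt)
    ((StrictAt.continuous_velocity (u := fun _ : Unit => c) fun _ t => hc t).comp
      (f := fun t => ((), t)) (continuous_const.prodMk continuous_id)), h⟩

omit [(x : M) → AddCommGroup (V x)] in
omit [(x : M) → Module ℝ (V x)] [VectorBundle ℝ F V] [IsManifold 𝓘(ℝ, EM) ∞ M]
  [ContMDiffVectorBundle ∞ F V 𝓘(ℝ, EM)] in
theorem mdifferentiable_proj :
    MDifferentiable (𝓘(ℝ, EM).prod 𝓘(ℝ, F)) 𝓘(ℝ, EM) (TotalSpace.proj : TotalSpace F V → M) :=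
  (contMDiff_proj (n := ∞) V).mdifferentiable (by simp)

theorem LieAlgebroid.Path.mdifferentiable_base (a : A.Path) :
    MDifferentiable (𝓡∂ 1) 𝓘(ℝ, EM) (fun s => (a s).proj) :=
  mdifferentiable_proj.comp a.mdifferentiable

/-- The reparametrization `t ↦ ρ'(t) a(ρ(t))`. -/
def LieAlgebroid.Path.reparam (a : A.Path) (ρ : Interval → Interval) (r : Interval → ℝ)
    (hρ : Continuous ρ)
    (hr : ∀ t, HasStrictDerivFam (fun (_ : Unit) t => (ρ t : ℝ)) (𝓝 ()) t (r t))
    (hr' : ∀ t, StrictAt 𝓘(ℝ, ℝ) (fun _ : Unit => r) () t) : A.Path :=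
  LieAlgebroid.Path.ofStrictAt A (fun t => fibreSMul (r t) (a (ρ t)))
    (fun t => (hr' t).fibreSMul ((a.strictAt () (ρ t)).comp_reparam (k := id)
      (θ := fun _ => ρ) continuousAt_id
      (ContinuousAt.comp (g := ρ) hρ.continuousAt continuousAt_snd) (hr t)))
    (fun t => by
      have h1 := (mfderiv_comp_reparam (a.mdifferentiable_base (ρ t)) hρ.continuousAt
        ((hr t).hasDerivAtI (pure_le_nhds ()))).2
      refine h1.trans ?_
      rw [a.deriv_base]
      exact (map_smul (A.anchor (a (ρ t)).proj) (r t) (a (ρ t)).2).symm)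

theorem strictAt_const {Z : Type*} {E H : Type*} [NormedAddCommGroup E] [NormedSpace ℝ E]
    [TopologicalSpace H] {I : ModelWithCorners ℝ E H} [TopologicalSpace Z] [ChartedSpace H Z]
    (z : Z) (y : Y) (t : Interval) : StrictAt I (fun (_ : Y) _ => z) y t := by
  refine ⟨continuousAt_const, 0, ?_⟩
  unfold HasStrictDerivFam
  simp only [sub_self, smul_zero]
  exact isLittleO_zero _ _

theorem continuous_seg_right (t₁ t₂ : Interval) : Continuous (seg t₁ t₂) :=
  continuous_seg.comp (continuous_const.prodMk (continuous_const.prodMk continuous_id))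

/-- The path reparametrized by the affine map from `[0, 1]` to `[t₁, t₂]`. -/
def LieAlgebroid.Path.restrict (a : A.Path) (t₁ t₂ : Interval) : A.Path :=
  a.reparam (seg t₁ t₂) (fun _ => t₂ - t₁) (continuous_seg_right t₁ t₂)
    (fun t => hasStrictDerivFam_affine (g := fun _ => (t₂ : ℝ) - t₁) continuousAt_const
      fun _ t t' => by rw [coe_seg, coe_seg]; ring)
    (fun t => strictAt_const _ _ t)

end Paths

/-! ### Parallel transport between arbitrary times. -/

section Transport

variable {EX : Type*} [NormedAddCommGroup EX] [NormedSpace ℝ EX] [FiniteDimensional ℝ EX]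
  {X : Type*} [TopologicalSpace X] [ChartedSpace EX X] [IsManifold 𝓘(ℝ, EX) ∞ X] [T2Space X]
  {FE : Type*} [NormedAddCommGroup FE] [NormedSpace ℝ FE] [FiniteDimensional ℝ FE]
  {VE : X → Type*} [TopologicalSpace (TotalSpace FE VE)] [∀ x, TopologicalSpace (VE x)]
  [∀ x, AddCommGroup (VE x)] [∀ x, Module ℝ (VE x)] [FiberBundle FE VE] [VectorBundle ℝ FE VE]
  [ContMDiffVectorBundle ∞ FE VE 𝓘(ℝ, EX)]
  {EB : Type*} [NormedAddCommGroup EB] [NormedSpace ℝ EB] [FiniteDimensional ℝ EB]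
  {B : Type*} [TopologicalSpace B] [ChartedSpace EB B] [IsManifold 𝓘(ℝ, EB) ∞ B] [T2Space B]
  {FB : Type*} [NormedAddCommGroup FB] [NormedSpace ℝ FB] [FiniteDimensional ℝ FB]
  {VB : B → Type*} [TopologicalSpace (TotalSpace FB VB)] [∀ b, TopologicalSpace (VB b)]
  [∀ b, AddCommGroup (VB b)] [∀ b, Module ℝ (VB b)] [FiberBundle FB VB] [VectorBundle ℝ FB VB]
  [ContMDiffVectorBundle ∞ FB VB 𝓘(ℝ, EB)]
  {AE : LieAlgebroid EX FE VE} {AB : LieAlgebroid EB FB VB} {Q : Extension AE AB}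
  {C : Q.Connection}

/-- The `A_B`-path `π ∘ a`. -/
def Extension.mapPath (Q : Extension AE AB) (a : AE.Path) : AB.Path :=
  LieAlgebroid.Path.ofStrictAt AB (fun t => Q.map (a t))
    (fun t => (a.strictAt () t).comp_contMDiffAt (F := Q.map)
      ((Q.contMDiff_map.contMDiffAt).of_le (by simp)))
    (fun t => by
      have h1 := mfderiv_comp t ((Q.isMorphism.contMDiff_base (a t).proj).mdifferentiableAt
        (by simp)) (a.mdifferentiable_base t)
      have h2 := congrArg (fun L => L (1 : TangentSpace (𝓡∂ 1) t)) h1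
      refine Eq.trans h2 ?_
      rw [ContinuousLinearMap.comp_apply, a.deriv_base]
      exact Q.mfderiv_anchor _ _)

omit [FiniteDimensional ℝ FE] [FiniteDimensional ℝ FB] in
@[simp]
theorem Extension.mapPath_apply (a : AE.Path) (t : Interval) : Q.mapPath a t = Q.map (a t) :=
  rfl

namespace Extension.Connection

/-- Completeness only provides curves with a given value at time `0`. Hence `v` is first carried
from `s` back to `0` along the reversed path and then forwards; uniqueness shows that the second
curve passes through `v` at time `s`. -/
theorem exists_isParallel (hC : C.IsComplete) (a : AB.Path) {s : Interval} {v : TotalSpace FE VE}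
    (hv : Q.p v.proj = (a s).proj) (hk : Q.pr v.proj v.2 = 0) :
    ∃ c, C.IsParallel a c ∧ c s = v := by
  obtain ⟨c₁, hc₁, rfl⟩ := hC (a.restrict s 0) v (hv.trans (by
    change _ = (a (seg s 0 0)).proj
    rw [seg_zero])) hk
  obtain ⟨c, hc, h0⟩ := hC a (c₁ 1) ((hc₁.lies_over 1).trans (by
    change (a (seg s 0 1)).proj = _
    rw [seg_one])) (hc₁.mem_ker 1)
  refine ⟨c, hc, ?_⟩
  have h1 := IsWeakParallel.eq (hc.isWeakParallel.comp_reparam (continuous_seg_right s 0)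
    (hasDerivAtI_seg s 0)) hc₁.isWeakParallel (a.restrict s 0).continuous (t₁ := 1)
    (by rw [seg_one]; exact h0) 0
  rwa [seg_zero] at h1

theorem isParallel_transport (hC : C.IsComplete) (a : AB.Path) {s : Interval}
    {v : TotalSpace FE VE} (hv : Q.p v.proj = (a s).proj) (hk : Q.pr v.proj v.2 = 0) :
    C.IsParallel a (fun t => C.transport a t s v) ∧ C.transport a s s v = v := by
  have h := exists_isParallel hC a hv hk
  unfold transport
  simp only [dif_pos h]
  exact h.choose_spec

/-- Transport is defined by a choice of parallel curve; by uniqueness any solution of the equation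
in charts computes it. -/
theorem transport_eq (hC : C.IsComplete) (a : AB.Path) {c : Interval → TotalSpace FE VE}
    (hc : C.IsWeakParallel a c) {s : Interval} (hk : Q.pr (c s).proj (c s).2 = 0) (t : Interval) :
    C.transport a t s (c s) = c t := by
  have h := isParallel_transport hC a (hc.lies_over s) hk
  exact h.1.isWeakParallel.eq hc a.continuous h.2 t

theorem transport_self (hC : C.IsComplete) (a : AB.Path) {s : Interval}
    {v : TotalSpace FE VE} (hv : Q.p v.proj = (a s).proj) (hk : Q.pr v.proj v.2 = 0) :
    C.transport a s s v = v :=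
  (isParallel_transport hC a hv hk).2

theorem transport_transport (hC : C.IsComplete) (a : AB.Path) {s : Interval}
    {v : TotalSpace FE VE} (hv : Q.p v.proj = (a s).proj) (hk : Q.pr v.proj v.2 = 0)
    (t r : Interval) : C.transport a t r (C.transport a r s v) = C.transport a t s v :=
  have h := (isParallel_transport hC a hv hk).1
  transport_eq hC a h.isWeakParallel (h.mem_ker r) t

omit [FiniteDimensional ℝ EX] [T2Space X] [FiniteDimensional ℝ FE] [FiniteDimensional ℝ EB]
  [T2Space B] [FiniteDimensional ℝ FB] in
theorem pr_fibreSMul {v : TotalSpace FE VE} (r : ℝ) (hk : Q.pr v.proj v.2 = 0) :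
    Q.pr (AlgebroidSplitting.fibreSMul r v).proj (AlgebroidSplitting.fibreSMul r v).2 = 0 := by
  change Q.pr v.proj (r • v.2) = 0
  rw [map_smul, hk, smul_zero]

theorem transport_fibreSMul (hC : C.IsComplete) (a : AB.Path) {s : Interval}
    {v : TotalSpace FE VE} (hv : Q.p v.proj = (a s).proj) (hk : Q.pr v.proj v.2 = 0)
    (r : ℝ) (t : Interval) :
    C.transport a t s (AlgebroidSplitting.fibreSMul r v) =
      AlgebroidSplitting.fibreSMul r (C.transport a t s v) := by
  have h := isParallel_transport hC a hv hk
  have h1 := transport_eq hC a (h.1.isWeakParallel.fibreSMul r) (s := s)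
    (pr_fibreSMul r (h.1.mem_ker s)) t
  rwa [h.2] at h1

end Extension.Connection

end Transport


/-! ### Strict estimates uniform along a compact family. -/

section UniformStrict

variable {Y E : Type*} [TopologicalSpace Y] [NormedAddCommGroup E] [NormedSpace ℝ E]
  {f : Y → Interval → Interval → E} {y₀ : Y} {t₀ : Interval} {b : Interval → E}

/-- The strict estimate at `s₀` also holds for nearby `s`, where it compares the two derivatives. -/
theorem continuous_strictDeriv
    (h : ∀ s, HasStrictDerivFam (fun (q : Y × Interval) t => f q.1 t q.2) (𝓝 (y₀, s)) t₀ (b s)) :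
    Continuous b := by
  refine continuous_iff_continuousAt.2 fun s₀ => Metric.tendsto_nhds.2 fun ε hε => ?_
  have h1 := IsLittleO.def (h s₀) (half_pos hε)
  rw [← nhds_prod_eq, ← nhds_prod_eq] at h1
  have h2 : Tendsto (fun p : Interval × Interval => ((y₀, p.1), t₀, p.2)) (𝓝 s₀ ×ˢ 𝓝 t₀)
      (𝓝 ((y₀, s₀), t₀, t₀)) :=
    (tendsto_const_nhds.prodMk_nhds tendsto_fst).prodMk_nhds
      (tendsto_const_nhds.prodMk_nhds tendsto_snd)
  filter_upwards [(h2.eventually h1).curry] with s hs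
  rw [dist_eq_norm]
  exact (((h s).hasDerivAtI (pure_le_nhds _)).norm_le hs).trans_lt (half_lt_self hε)

/-- Half of `ε` is spent on the strict estimate at `s₀` and half on the continuity of `b`;
compactness of the interval makes the neighbourhood independent of `s`. -/
theorem eventually_forall_norm_le_of_strict
    (h : ∀ s, HasStrictDerivFam (fun (q : Y × Interval) t => f q.1 t q.2) (𝓝 (y₀, s)) t₀ (b s))
    {ε : ℝ} (hε : 0 < ε) : ∀ᶠ p : Y × Interval × Interval in 𝓝 y₀ ×ˢ 𝓝 t₀ ×ˢ 𝓝 t₀, ∀ s,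
      ‖f p.1 p.2.2 s - f p.1 p.2.1 s - ((p.2.2 : ℝ) - p.2.1) • b s‖ ≤ ε * |(p.2.2 : ℝ) - p.2.1| := by
  rw [← nhds_prod_eq, ← nhds_prod_eq]
  have key := isCompact_univ.eventually_forall_of_forall_eventually (x₀ := (y₀, t₀, t₀))
    (P := fun (p : Y × Interval × Interval) (s : Interval) =>
      ‖f p.1 p.2.2 s - f p.1 p.2.1 s - ((p.2.2 : ℝ) - p.2.1) • b s‖ ≤ ε * |(p.2.2 : ℝ) - p.2.1|)
    (K := univ) fun s₀ _ => ?_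
  · exact key.mono fun p hp s => hp s trivial
  have h1 := IsLittleO.def (h s₀) (half_pos hε)
  rw [← nhds_prod_eq, ← nhds_prod_eq] at h1
  have h2 : Tendsto (fun z : (Y × Interval × Interval) × Interval =>
      ((z.1.1, z.2), z.1.2.1, z.1.2.2)) (𝓝 ((y₀, t₀, t₀), s₀)) (𝓝 ((y₀, s₀), t₀, t₀)) :=
    Continuous.tendsto (by fun_prop) ((y₀, t₀, t₀), s₀)
  have h3 := (continuous_snd.tendsto ((y₀, t₀, t₀), s₀)).eventually
    (Metric.tendsto_nhds.1 ((continuous_strictDeriv h).tendsto s₀) (ε / 2) (half_pos hε))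
  filter_upwards [h2.eventually h1, h3] with z h4 h5
  simp only [Real.norm_eq_abs] at h4
  have h6 : f z.1.1 z.1.2.2 z.2 - f z.1.1 z.1.2.1 z.2 - ((z.1.2.2 : ℝ) - z.1.2.1) • b z.2 =
      (f z.1.1 z.1.2.2 z.2 - f z.1.1 z.1.2.1 z.2 - ((z.1.2.2 : ℝ) - z.1.2.1) • b s₀) -
      ((z.1.2.2 : ℝ) - z.1.2.1) • (b z.2 - b s₀) := by
    rw [smul_sub]
    abel
  rw [h6]
  refine (norm_sub_le _ _).trans ?_
  rw [norm_smul, Real.norm_eq_abs]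
  rw [dist_eq_norm] at h5
  nlinarith [abs_nonneg ((z.1.2.2 : ℝ) - z.1.2.1)]

end UniformStrict

/-! ### The anchor condition along the linearized equation. -/

section LinearizedAnchor

variable {FB EX FE : Type*} [NormedAddCommGroup FB] [NormedSpace ℝ FB]
  [NormedAddCommGroup EX] [NormedSpace ℝ EX] [NormedAddCommGroup FE] [NormedSpace ℝ FE]

theorem fderiv_apply_of_linear_left {E F : Type*} [NormedAddCommGroup E] [NormedSpace ℝ E]
    [NormedAddCommGroup F] [NormedSpace ℝ F] {G : FB × E → F}
    (hadd : ∀ β β' u, G (β + β', u) = G (β, u) + G (β', u))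
    (hsmul : ∀ (r : ℝ) β u, G (r • β, u) = r • G (β, u)) {β : FB} {u : E}
    (hG : DifferentiableAt ℝ G (β, u)) (x : FB) (y : E) :
    fderiv ℝ G (β, u) (x, y) = G (x, u) + fderiv ℝ (fun v => G (β, v)) u y := by
  have h1 : fderiv ℝ (fun v => G (β, v)) u y = fderiv ℝ G (β, u) (0, y) := by
    have h2 : HasFDerivAt (fun v : E => (β, v)) (ContinuousLinearMap.inr ℝ FB E) u :=
      hasFDerivAt_prodMk_right β u
    have h3 := HasFDerivAt.comp u (g := G) hG.hasFDerivAt h2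
    rw [show fderiv ℝ (fun v => G (β, v)) u = _ from h3.fderiv]
    rfl
  have h4 : fderiv ℝ G (β, u) (x, 0) = G (x, u) := by
    have h5 : HasDerivAt (fun t : ℝ => (β + t • x, u)) (x, 0) 0 := by
      have := (((hasDerivAt_id (0 : ℝ)).smul_const x).const_add β).prodMk (hasDerivAt_const 0 u)
      rwa [one_smul] at this
    have h6 : HasFDerivAt G (fderiv ℝ G (β, u)) (β + (0 : ℝ) • x, u) := by
      rw [zero_smul, add_zero]
      exact hG.hasFDerivAt
    have h7 := HasFDerivAt.comp_hasDerivAt (0 : ℝ) (f := fun t : ℝ => (β + t • x, u)) h6 h5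
    have h8 : HasDerivAt (fun t : ℝ => G (β, u) + t • G (x, u)) (G (x, u)) 0 := by
      have := ((hasDerivAt_id (0 : ℝ)).smul_const (G (x, u))).const_add (G (β, u))
      rwa [one_smul] at this
    refine h7.unique (h8.congr_of_eventuallyEq (Eventually.of_forall fun t => ?_))
    change G (β + t • x, u) = _
    rw [hadd, hsmul]
  rw [h1, ← h4, ← map_add, Prod.mk_add_mk, add_zero, zero_add]

/-- The defect `e = w.1 - R(u) - G(σβ, u).1` of the anchor condition solves a homogeneous linear
equation. It vanishes at `0` by `h0`, hence also at `1`. -/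
theorem linearized_anchor_eq {G : FB × (EX × FE) → EX × FE} {R : EX × FE → EX}
    (hadd : ∀ β β' u, G (β + β', u) = G (β, u) + G (β', u))
    (hsmul : ∀ (r : ℝ) β u, G (r • β, u) = r • G (β, u))
    {β b : ℝ → FB} {σ : ℝ → ℝ} {u w : ℝ → EX × FE} {c μ : ℝ}
    (hG : ∀ s ∈ Icc (0 : ℝ) 1, ∀ β, ContDiffAt ℝ 1 G (β, u s))
    (hR : ∀ s ∈ Icc (0 : ℝ) 1, ContDiffAt ℝ 1 R (u s))
    (hGR : ∀ s ∈ Icc (0 : ℝ) 1, ∀ β ζ, fderiv ℝ R (u s) (G (β, u s)) =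
      fderiv ℝ (fun v => (G (β, v)).1) (u s) (R (u s), ζ))
    (hβ : ContinuousOn (fun s => c • β s) (Icc 0 1))
    (hu : ∀ s ∈ Icc (0 : ℝ) 1, HasDerivWithinAt u (μ • G (c • β s, u s)) (Icc 0 1) s)
    (hw : ∀ s ∈ Icc (0 : ℝ) 1,
      HasDerivWithinAt w (μ • fderiv ℝ G (c • β s, u s) (b s, w s)) (Icc 0 1) s)
    (hσ : ∀ s ∈ Icc (0 : ℝ) 1, HasDerivWithinAt (fun s => σ s • β s) (μ • b s) (Icc 0 1) s)
    (h0 : (w 0).1 = R (u 0) + (G (σ 0 • β 0, u 0)).1) :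
    (w 1).1 = R (u 1) + (G (σ 1 • β 1, u 1)).1 := by
  let e : ℝ → EX := fun s => (w s).1 - R (u s) - (G (σ s • β s, u s)).1
  -- The base-to-base block of the derivative of `G` in its second variable.
  let L : ℝ → EX →L[ℝ] EX := fun s => (ContinuousLinearMap.fst ℝ EX FE).comp
    ((fderiv ℝ G (c • β s, u s)).comp
      ((ContinuousLinearMap.inr ℝ FB (EX × FE)).comp (ContinuousLinearMap.inl ℝ EX FE)))
  have hG1 {s} (hs : s ∈ Icc (0 : ℝ) 1) (γ : FB) (v : EX × FE) :
      fderiv ℝ (fun v => (G (γ, v)).1) (u s) v = (fderiv ℝ (fun v => G (γ, v)) (u s) v).1 := by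
    have h1 : DifferentiableAt ℝ (fun v => G (γ, v)) (u s) :=
      DifferentiableAt.comp (u s) (g := G) ((hG s hs γ).differentiableAt one_ne_zero)
        (differentiableAt_const γ |>.prodMk differentiableAt_id)
    rw [fderiv.fst h1]
    rfl
  have hG2 {s} (hs : s ∈ Icc (0 : ℝ) 1) (r : ℝ) (γ : FB) (v : EX × FE) :
      fderiv ℝ (fun v => G (r • γ, v)) (u s) v = r • fderiv ℝ (fun v => G (γ, v)) (u s) v := by
    have h1 : DifferentiableAt ℝ (fun v => G (γ, v)) (u s) :=
      DifferentiableAt.comp (u s) (g := G) ((hG s hs γ).differentiableAt one_ne_zero)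
        (differentiableAt_const γ |>.prodMk differentiableAt_id)
    simp only [hsmul]
    rw [fderiv_fun_const_smul h1]
    rfl
  have he (s) (hs : s ∈ Icc (0 : ℝ) 1) : HasDerivWithinAt e (μ • L s (e s)) (Icc 0 1) s := by
    have h1 := (ContinuousLinearMap.fst ℝ EX FE).hasFDerivAt.comp_hasDerivWithinAt s (hw s hs)
    have h2 := ((hR s hs).differentiableAt one_ne_zero).hasFDerivAt.comp_hasDerivWithinAt s
      (hu s hs)
    have hGs := ((hG s hs (σ s • β s)).differentiableAt one_ne_zero)
    have h3 := (ContinuousLinearMap.fst ℝ EX FE).hasFDerivAt.comp_hasDerivWithinAt s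
      (HasFDerivAt.comp_hasDerivWithinAt s (f := fun s => (σ s • β s, u s)) hGs.hasFDerivAt
        ((hσ s hs).prodMk (hu s hs)))
    refine ((h1.sub h2).sub h3).congr_deriv ?_
    have hGc := ((hG s hs (c • β s)).differentiableAt one_ne_zero)
    simp only [ContinuousLinearMap.coe_fst']
    rw [← Prod.smul_mk]
    simp only [map_smul, Prod.smul_fst, ← smul_sub]
    congr 1
    simp only [L, ContinuousLinearMap.comp_apply, ContinuousLinearMap.coe_fst',
      ContinuousLinearMap.inr_apply, ContinuousLinearMap.inl_apply]
    -- The free fibre component in `hGR` is chosen so that the three vectors combine to one with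
    -- zero fibre part.
    have h4 : ((e s, 0) : EX × FE) = w s - (R (u s), (w s).2 - (G (σ s • β s, u s)).2) -
        G (σ s • β s, u s) := by
      refine Prod.ext rfl ?_
      simp
    have h5 := hGR s hs (c • β s) ((w s).2 - (G (σ s • β s, u s)).2)
    rw [hG1 hs] at h5
    rw [h5, fderiv_apply_of_linear_left hadd hsmul hGc, fderiv_apply_of_linear_left hadd hsmul hGs,
      fderiv_apply_of_linear_left hadd hsmul hGc, h4]
    have h6 : G (0, u s) = 0 := by
      have := hsmul 0 0 (u s)
      rwa [zero_smul, zero_smul] at this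
    -- Both driving vectors are multiples of `β s`, so the second order terms are symmetric. For
    -- independent vectors their difference could contribute a curvature term.
    have h7 : fderiv ℝ (fun v => G (σ s • β s, v)) (u s) (G (c • β s, u s)) =
        fderiv ℝ (fun v => G (c • β s, v)) (u s) (G (σ s • β s, u s)) := by
      rw [hG2 hs, hG2 hs, hsmul, hsmul, map_smul, map_smul, smul_comm]
    rw [h6, h7, map_sub, map_sub, Prod.fst_add, Prod.fst_add, Prod.fst_add, Prod.fst_sub,
      Prod.fst_sub, Prod.fst_zero]
    abel
  have huc : ContinuousOn u (Icc 0 1) := fun s hs => (hu s hs).continuousWithinAt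
  have hD : ContinuousOn (fun s => fderiv ℝ G (c • β s, u s)) (Icc 0 1) := fun s hs =>
    ((hG s hs _).continuousAt_fderiv one_ne_zero).comp_continuousWithinAt
      (f := fun s => (c • β s, u s)) ((hβ.prodMk huc) s hs)
  have hL : ContinuousOn L (Icc 0 1) :=
    continuousOn_const.clm_comp (hD.clm_comp continuousOn_const)
  obtain ⟨K, hK⟩ := isCompact_Icc.exists_bound_of_continuousOn hL
  have h1 := norm_le_gronwallBound_of_norm_deriv_right_le (f := e) (δ := 0) (K := |μ| * K)
    (ε := 0) (a := 0) (b := 1) (fun s hs => (he s hs).continuousWithinAt)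
    (fun s hs => (he s (Ico_subset_Icc_self hs)).mono_of_mem_nhdsWithin
      (Icc_mem_nhdsGE_of_mem hs)) (by
      rw [norm_le_zero_iff]
      simp only [e]
      rw [h0]
      abel) (fun s hs => by
      rw [norm_smul, Real.norm_eq_abs, add_zero, mul_assoc]
      exact mul_le_mul_of_nonneg_left ((L s).le_of_opNorm_le
        (hK s (Ico_subset_Icc_self hs)) _) (abs_nonneg μ)) 1 (by simp)
  rw [gronwallBound_ε0_δ0, norm_le_zero_iff] at h1
  simp only [e] at h1
  rw [sub_sub, sub_eq_zero] at h1
  exact h1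

end LinearizedAnchor


/-! ### The anchor condition in coordinates. -/

section Anchored

variable {EX : Type*} [NormedAddCommGroup EX] [NormedSpace ℝ EX]
  {X : Type*} [TopologicalSpace X] [ChartedSpace EX X] [IsManifold 𝓘(ℝ, EX) ∞ X]
  {FE : Type*} [NormedAddCommGroup FE] [NormedSpace ℝ FE]
  {VE : X → Type*} [TopologicalSpace (TotalSpace FE VE)] [∀ x, TopologicalSpace (VE x)]
  [∀ x, AddCommGroup (VE x)] [∀ x, Module ℝ (VE x)] [FiberBundle FE VE] [VectorBundle ℝ FE VE]
  [ContMDiffVectorBundle ∞ FE VE 𝓘(ℝ, EX)]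
  {EB : Type*} [NormedAddCommGroup EB] [NormedSpace ℝ EB]
  {B : Type*} [TopologicalSpace B] [ChartedSpace EB B] [IsManifold 𝓘(ℝ, EB) ∞ B]
  {FB : Type*} [NormedAddCommGroup FB] [NormedSpace ℝ FB]
  {VB : B → Type*} [TopologicalSpace (TotalSpace FB VB)] [∀ b, TopologicalSpace (VB b)]
  [∀ b, AddCommGroup (VB b)] [∀ b, Module ℝ (VB b)] [FiberBundle FB VB] [VectorBundle ℝ FB VB]
  [ContMDiffVectorBundle ∞ FB VB 𝓘(ℝ, EB)]
  {AE : LieAlgebroid EX FE VE} {AB : LieAlgebroid EB FB VB} {Q : Extension AE AB}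
  {C : Q.Connection}

omit [NormedSpace ℝ EX] [NormedSpace ℝ FE] [(x : X) → Module ℝ (VE x)] [VectorBundle ℝ FE VE] in
omit [IsManifold 𝓘(ℝ, EX) ∞ X] [ContMDiffVectorBundle ∞ FE VE 𝓘(ℝ, EX)] in
theorem mem_source_coord {x₀ : X} {v : TotalSpace FE VE} (h : v.proj ∈ (chartAt EX x₀).source)
    (h' : v.proj ∈ (trivializationAt FE VE x₀).baseSet) :
    v ∈ (chartAt (ModelProd EX FE) (⟨x₀, 0⟩ : TotalSpace FE VE)).source := by
  rw [FiberBundle.chartedSpace_chartAt]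
  simp [h, h', Trivialization.mem_source]

theorem contMDiffAt_coord {x₀ : X} {v : TotalSpace FE VE} (h : v.proj ∈ (chartAt EX x₀).source)
    (h' : v.proj ∈ (trivializationAt FE VE x₀).baseSet) :
    ContMDiffAt (𝓘(ℝ, EX).prod 𝓘(ℝ, FE)) 𝓘(ℝ, EX × FE) 1 (coord EX x₀) v :=
  have : IsManifold (𝓘(ℝ, EX).prod 𝓘(ℝ, FE)) 1 (TotalSpace FE VE) := inferInstance
  contMDiffAt_extChartAt' (mem_source_coord h h')

theorem tderiv_extChartAt_injective {x₀ x : X} (hx : x ∈ (chartAt EX x₀).source)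
    {v w : TangentSpace 𝓘(ℝ, EX) x} (h : tderiv (extChartAt 𝓘(ℝ, EX) x₀)
      (⟨x, v⟩ : TangentBundle 𝓘(ℝ, EX) X) = tderiv (extChartAt 𝓘(ℝ, EX) x₀)
      (⟨x, w⟩ : TangentBundle 𝓘(ℝ, EX) X)) : v = w := by
  have : IsManifold 𝓘(ℝ, EX) 1 X := .of_le (show (1 : WithTop ℕ∞) ≤ ∞ by simp)
  rw [tderiv_extChartAt (v := (⟨x, v⟩ : TangentBundle 𝓘(ℝ, EX) X)) hx,
    tderiv_extChartAt (v := (⟨x, w⟩ : TangentBundle 𝓘(ℝ, EX) X)) hx] at h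
  have h1 : x ∈ (trivializationAt EX (TangentSpace 𝓘(ℝ, EX)) x₀).baseSet := by simpa using hx
  refine ((trivializationAt EX (TangentSpace 𝓘(ℝ, EX)) x₀).linearEquivAt ℝ x h1).injective ?_
  simpa using h

namespace Extension.Connection

/-- The base velocity of `c` at time `t` is `♯(c(t) + h(b))`. -/
def IsAnchored (C : Q.Connection) (c : Interval → TotalSpace FE VE) (b : TotalSpace FB VB)
    (t : Interval) : Prop :=
  mfderiv (𝓡∂ 1) 𝓘(ℝ, EX) (fun s => (c s).proj) t (1 : TangentSpace (𝓡∂ 1) t) =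
    AE.anchor (c t).proj ((c t).2 + C.liftAt (c t).proj b)

theorem ChartModel.isAnchored_iff {x₀ : X} (m : C.ChartModel x₀) {c : Interval → TotalSpace FE VE}
    {b : TotalSpace FB VB} {t : Interval}
    (hc : MDifferentiableAt (𝓡∂ 1) (𝓘(ℝ, EX).prod 𝓘(ℝ, FE)) c t) (hN : (c t).proj ∈ m.N)
    (hb : Q.p (c t).proj = b.proj) :
    C.IsAnchored c b t ↔ (tderiv (coord EX x₀) (velocity (𝓘(ℝ, EX).prod 𝓘(ℝ, FE)) c t)).1 =
      m.R (coord EX x₀ (c t)) +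
        (m.G ((trivializationAt FB VB (Q.p x₀) b).2, coord EX x₀ (c t))).1 := by
  have : IsManifold 𝓘(ℝ, EX) 1 X := .of_le (show (1 : WithTop ℕ∞) ≤ ∞ by simp)
  have h1 := hasDerivAtI_comp hc
    ((contMDiffAt_coord (m.source hN) (m.baseSet hN)).mdifferentiableAt one_ne_zero)
  have hcb : MDifferentiableAt (𝓡∂ 1) 𝓘(ℝ, EX) (fun s => (c s).proj) t :=
    (mdifferentiable_proj (EM := EX) (c t)).comp t hc
  have h2 := hasDerivAtI_comp hcb (mdifferentiableAt_extChartAt (I := 𝓘(ℝ, EX)) (m.source hN))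
  have h3 : HasDerivAtI (fun s => (coord EX x₀ (c s)).1) (tderiv (coord EX x₀)
      (velocity (𝓘(ℝ, EX).prod 𝓘(ℝ, FE)) c t)).1 t :=
    (ContinuousLinearMap.fst ℝ EX FE).hasFDerivAt.comp_hasDerivWithinAt _ h1
  have h4 : tderiv (extChartAt 𝓘(ℝ, EX) x₀) (velocity 𝓘(ℝ, EX) (fun s => (c s).proj) t) =
      (tderiv (coord EX x₀) (velocity (𝓘(ℝ, EX).prod 𝓘(ℝ, FE)) c t)).1 := by
    refine h2.unique (h3.congr ?_)
    filter_upwards [hcb.continuousAt (m.isOpen_N.mem_nhds hN)] with s hs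
    rw [coord_apply (m.baseSet hs)]
  have h5 : tderiv (extChartAt 𝓘(ℝ, EX) x₀) (⟨(c t).proj, AE.anchor (c t).proj ((c t).2 +
      C.liftAt (c t).proj b)⟩ : TangentBundle 𝓘(ℝ, EX) X) = m.R (coord EX x₀ (c t)) +
        (m.G ((trivializationAt FB VB (Q.p x₀) b).2, coord EX x₀ (c t))).1 := by
    rw [← m.anchor_eq _ hN]
    obtain ⟨y, b⟩ := b
    obtain rfl : Q.p (c t).proj = y := hb
    have h6 := m.lift_anchor _ hN b (trivializationAt FE VE x₀ (c t)).2
    rw [← coord_apply (m.baseSet hN)] at h6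
    rw [liftAt_mk, map_add, ← h6]
    exact map_add (mfderiv 𝓘(ℝ, EX) 𝓘(ℝ, EX) (extChartAt 𝓘(ℝ, EX) x₀) (c t).proj) _ _
  rw [← h4, ← h5]
  exact ⟨fun h => congrArg (fun w : TangentSpace 𝓘(ℝ, EX) (c t).proj =>
    tderiv (extChartAt 𝓘(ℝ, EX) x₀) (⟨(c t).proj, w⟩ : TangentBundle 𝓘(ℝ, EX) X)) h,
    fun h => tderiv_extChartAt_injective (m.source hN) h⟩

theorem IsWeakParallel.hasDerivWithinAt_seg {a : Interval → TotalSpace FB VB}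
    {c : Interval → TotalSpace FE VE} (h : C.IsWeakParallel a c) {x₀ : X} (m : C.ChartModel x₀)
    (s₁ s₂ : Interval) {r : ℝ} (hr : r ∈ Icc (0 : ℝ) 1)
    (hN : (c (seg s₁ s₂ (projIcc 0 1 zero_le_one r))).proj ∈ m.N) :
    HasDerivWithinAt (fun r => coord EX x₀ (c (seg s₁ s₂ (projIcc 0 1 zero_le_one r))))
      (((s₂ : ℝ) - s₁) • m.G ((trivializationAt FB VB (Q.p x₀)
        (a (seg s₁ s₂ (projIcc 0 1 zero_le_one r)))).2,
        coord EX x₀ (c (seg s₁ s₂ (projIcc 0 1 zero_le_one r))))) (Icc 0 1) r := by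
  have h1 := (h.hasDerivAtI x₀ m _ hN).comp_reparam (hasDerivAtI_seg s₁ s₂ _)
  unfold HasDerivAtI at h1
  rwa [projIcc_of_mem zero_le_one hr] at h1 ⊢

end Extension.Connection

end Anchored

/-! ### Propagation of differentiability and of the anchor condition along parallel curves. -/

section Propagation

variable {EX : Type*} [NormedAddCommGroup EX] [NormedSpace ℝ EX] [FiniteDimensional ℝ EX]
  {X : Type*} [TopologicalSpace X] [ChartedSpace EX X] [IsManifold 𝓘(ℝ, EX) ∞ X] [T2Space X]
  {FE : Type*} [NormedAddCommGroup FE] [NormedSpace ℝ FE] [FiniteDimensional ℝ FE]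
  {VE : X → Type*} [TopologicalSpace (TotalSpace FE VE)] [∀ x, TopologicalSpace (VE x)]
  [∀ x, AddCommGroup (VE x)] [∀ x, Module ℝ (VE x)] [FiberBundle FE VE] [VectorBundle ℝ FE VE]
  [ContMDiffVectorBundle ∞ FE VE 𝓘(ℝ, EX)]
  {EB : Type*} [NormedAddCommGroup EB] [NormedSpace ℝ EB] [FiniteDimensional ℝ EB]
  {B : Type*} [TopologicalSpace B] [ChartedSpace EB B] [IsManifold 𝓘(ℝ, EB) ∞ B] [T2Space B]
  {FB : Type*} [NormedAddCommGroup FB] [NormedSpace ℝ FB] [FiniteDimensional ℝ FB]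
  {VB : B → Type*} [TopologicalSpace (TotalSpace FB VB)] [∀ b, TopologicalSpace (VB b)]
  [∀ b, AddCommGroup (VB b)] [∀ b, Module ℝ (VB b)] [FiberBundle FB VB] [VectorBundle ℝ FB VB]
  [ContMDiffVectorBundle ∞ FB VB 𝓘(ℝ, EB)]
  {AE : LieAlgebroid EX FE VE} {AB : LieAlgebroid EB FB VB} {Q : Extension AE AB}
  {C : Q.Connection} {Y : Type*} [TopologicalSpace Y]

namespace Extension.Connection

omit [FiniteDimensional ℝ EB] [IsManifold 𝓘(ℝ, EB) ∞ B] [T2Space B] [FiniteDimensional ℝ FB] in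
theorem contMDiffAt_trivialization_snd (b₀ : B) {w : TotalSpace FB VB}
    (hw : w.proj ∈ (trivializationAt FB VB b₀).baseSet) :
    ContMDiffAt (𝓘(ℝ, EB).prod 𝓘(ℝ, FB)) 𝓘(ℝ, FB) 1
      (fun w : TotalSpace FB VB => (trivializationAt FB VB b₀ w).2) w :=
  (((trivializationAt FB VB b₀).contMDiffAt_iff (f := fun w : TotalSpace FB VB => w)
    ((trivializationAt FB VB b₀).mem_source.2 hw)).1 contMDiffAt_id).2

set_option maxHeartbeats 1000000 in
/-- Strict differentiability and the anchor condition propagate along parallel curves, when the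
driving curves form a homotopy of `A_B`-paths. -/
theorem strictAt_and_isAnchored {D : Y → Interval → Interval → TotalSpace FB VB}
    {u : Y → Interval → Interval → TotalSpace FE VE} {y₀ : Y} {t₀ : Interval}
    (hu : ∀ y t, C.IsWeakParallel (D y t) (u y t))
    (hD : ∀ s, StrictAt (𝓘(ℝ, EB).prod 𝓘(ℝ, FB)) (fun (q : Y × Interval) t => D q.1 t q.2)
      (y₀, s) t₀)
    {a : Interval → TotalSpace FB VB} {c : ℝ} {σ : Interval → ℝ}
    (ha : ∀ s, D y₀ t₀ s = AlgebroidSplitting.fibreSMul c (a s))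
    (hσ : ∀ s b₀, (a s).proj ∈ (trivializationAt FB VB b₀).baseSet → HasDerivAtI
      (fun s => (trivializationAt FB VB b₀ (AlgebroidSplitting.fibreSMul (σ s) (a s))).2)
      (tderiv (fun w => (trivializationAt FB VB b₀ w).2)
        (velocity (𝓘(ℝ, EB).prod 𝓘(ℝ, FB)) (fun t => D y₀ t s) t₀)) s)
    {s₀ : Interval}
    (h₀ : StrictAt (𝓘(ℝ, EX).prod 𝓘(ℝ, FE)) (fun y t => u y t s₀) y₀ t₀)
    (h₀' : C.IsAnchored (fun t => u y₀ t s₀) (AlgebroidSplitting.fibreSMul (σ s₀) (a s₀)) t₀)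
    (s : Interval) :
    StrictAt (𝓘(ℝ, EX).prod 𝓘(ℝ, FE)) (fun y t => u y t s) y₀ t₀ ∧
    C.IsAnchored (fun t => u y₀ t s) (AlgebroidSplitting.fibreSMul (σ s) (a s)) t₀ := by
  have hDt (s : Interval) : Tendsto (fun q : (Y × Interval) × Interval => D q.1.1 q.1.2 q.2)
      (𝓝 (y₀, t₀) ×ˢ 𝓝 s) (𝓝 (D y₀ t₀ s)) := by
    rw [← nhds_prod_eq]
    exact (hD s).1.tendsto.comp (Continuous.tendsto
      (f := fun q : (Y × Interval) × Interval => ((q.1.1, q.2), q.1.2)) (by fun_prop)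
      ((y₀, t₀), s))
  have hDc : Continuous (D y₀ t₀) := continuous_iff_continuousAt.2 fun s =>
    (hDt s).comp ((tendsto_const_nhds (x := (y₀, t₀))).prodMk tendsto_id)
  have hut (s : Interval) := IsWeakParallel.tendsto_prod (P := Y × Interval) (l := 𝓝 (y₀, t₀))
    (a := fun q => D q.1 q.2) (u := fun q => u q.1 q.2) (fun q => hu q.1 q.2) (hu y₀ t₀) hDc hDt
    h₀.1 s
  have hproj := FiberBundle.continuous_proj FE VE
  have haB (s : Interval) : Q.p (u y₀ t₀ s).proj = (a s).proj :=
    ((hu y₀ t₀).lies_over s).trans (by rw [ha]; rfl)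
  refine forall_mem_of_locally (S := {s | StrictAt (𝓘(ℝ, EX).prod 𝓘(ℝ, FE))
    (fun y t => u y t s) y₀ t₀ ∧ C.IsAnchored (fun t => u y₀ t s)
      (AlgebroidSplitting.fibreSMul (σ s) (a s)) t₀}) ⟨h₀, h₀'⟩ (fun s => ?_) s
  set x₀ := (u y₀ t₀ s).proj with hx₀
  obtain ⟨m⟩ := C.nonempty_chartModel x₀
  set eB := trivializationAt FB VB (Q.p x₀) with heB
  have hcoord {v : TotalSpace FE VE} (hv : v.proj ∈ m.N) : ContinuousAt (coord EX x₀) v :=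
    (contMDiffAt_coord (m.source hv) (m.baseSet hv)).continuousAt
  have haN {s : Interval} (hs : (u y₀ t₀ s).proj ∈ m.N) : (a s).proj ∈ eB.baseSet :=
    haB s ▸ m.base _ hs
  have hDN {s : Interval} (hs : (u y₀ t₀ s).proj ∈ m.N) : (D y₀ t₀ s).proj ∈ eB.baseSet := by
    rw [← (hu y₀ t₀).lies_over]
    exact m.base _ hs
  have heBc {s : Interval} (hs : (u y₀ t₀ s).proj ∈ m.N) :=
    contMDiffAt_trivialization_snd (EB := EB) (Q.p x₀) (hDN hs)
  have hDeB {s : Interval} (hs : (u y₀ t₀ s).proj ∈ m.N) :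
      (eB (D y₀ t₀ s)).2 = c • (eB (a s)).2 := by
    rw [ha, trivialization_fibreSMul eB c (haN hs)]
  have hG' : ContinuousAt (fun s => fderiv ℝ m.G ((eB (D y₀ t₀ s)).2, coord EX x₀ (u y₀ t₀ s)))
      s := by
    refine ContinuousAt.comp (g := fderiv ℝ m.G)
      (f := fun s => ((eB (D y₀ t₀ s)).2, coord EX x₀ (u y₀ t₀ s)))
      ((m.contDiffAt_G _ (u y₀ t₀ s) m.mem_N).continuousAt_fderiv one_ne_zero)
      (ContinuousAt.prodMk ?_ ?_)
    · exact ContinuousAt.comp (g := fun w => (eB w).2) (heBc m.mem_N).continuousAt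
        hDc.continuousAt
    · exact ContinuousAt.comp (hcoord m.mem_N) (hu y₀ t₀).continuous.continuousAt
  set K := ‖fderiv ℝ m.G ((eB (D y₀ t₀ s)).2, coord EX x₀ (u y₀ t₀ s))‖ + 1 with hK
  have hKpos : 0 < K := by positivity
  obtain ⟨δ', hδ', hδW⟩ := Metric.mem_nhds_iff.1 (inter_mem
    ((hproj.comp (hu y₀ t₀).continuous).continuousAt (m.isOpen_N.mem_nhds m.mem_N))
    (hG'.norm.eventually_lt_const (lt_add_one _)))
  -- Any two times in this range differ by less than `1 / (2K)`, so the rescaled linear coefficient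
  -- has norm at most `1/2`, as `exists_linear_ode` requires.
  refine ⟨min δ' (1 / (4 * K)), lt_min hδ' (by positivity), fun s₁ s₂ h₁ h₂ hS => ?_⟩
  have hW (r : Interval) := hδW (dist_seg_lt (s := r) (h₁.trans_le (min_le_left _ _))
    (h₂.trans_le (min_le_left _ _)))
  have hN (r : Interval) : (u y₀ t₀ (seg s₁ s₂ r)).proj ∈ m.N := (hW r).1
  have hKr (r : Interval) : ‖fderiv ℝ m.G ((eB (D y₀ t₀ (seg s₁ s₂ r))).2,
    coord EX x₀ (u y₀ t₀ (seg s₁ s₂ r)))‖ ≤ K := le_of_lt (hW r).2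
  set μ : ℝ := (s₂ : ℝ) - s₁ with hμ
  have hμK : |μ| * K ≤ 1 / 2 := by
    have h3 : dist s₂ s₁ < 1 / (4 * K) + 1 / (4 * K) :=
      (dist_triangle_right s₂ s₁ s).trans_lt (add_lt_add (h₂.trans_le (min_le_right _ _))
        (h₁.trans_le (min_le_right _ _)))
    rw [Subtype.dist_eq, Real.dist_eq] at h3
    calc |μ| * K ≤ (1 / (4 * K) + 1 / (4 * K)) * K := by gcongr
      _ = 1 / 2 := by field_simp; norm_num
  have hsegc := continuous_seg_right s₁ s₂
  -- The `t`-derivative of the driving vector, the inhomogeneous term of the linearized equation.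
  let b' : Interval → FB := fun r => tderiv (fun w => (eB w).2)
    (velocity (𝓘(ℝ, EB).prod 𝓘(ℝ, FB)) (fun t => D y₀ t (seg s₁ s₂ r)) t₀)
  have hstr (r : Interval) : HasStrictDerivFam (fun (q : Y × Interval) t =>
      (eB (D q.1 t (seg s₁ s₂ q.2))).2) (𝓝 (y₀, r)) t₀ (b' r) :=
    ((hD (seg s₁ s₂ r)).hasStrictDerivFam (heBc (hN r))).comp_tendsto
      (k := fun q : Y × Interval => (q.1, seg s₁ s₂ q.2))
      (((continuous_fst.prodMk (hsegc.comp continuous_snd)).tendsto (y₀, r)))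
  have hb'c : Continuous b' :=
    continuous_strictDeriv (f := fun y t r => (eB (D y t (seg s₁ s₂ r))).2) hstr
  let ϖ : ℝ → Interval := projIcc 0 1 zero_le_one
  have hϖ : Continuous ϖ := continuous_projIcc
  have hϖ0 : seg s₁ s₂ (ϖ 0) = s₁ := by
    rw [show ϖ 0 = 0 from projIcc_left _, seg_zero]
  have hϖ1 : seg s₁ s₂ (ϖ 1) = s₂ := by
    rw [show ϖ 1 = 1 from projIcc_right _, seg_one]
  let U : ℝ → EX × FE := fun r => coord EX x₀ (u y₀ t₀ (seg s₁ s₂ (ϖ r)))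
  let β : ℝ → FB := fun r => (eB (a (seg s₁ s₂ (ϖ r)))).2
  have hβ (r : ℝ) : (eB (D y₀ t₀ (seg s₁ s₂ (ϖ r)))).2 = c • β r := hDeB (hN (ϖ r))
  have hβc : Continuous (fun r => c • β r) := by
    simp only [← hβ]
    exact continuous_iff_continuousAt.2 fun r => ContinuousAt.comp (g := fun w => (eB w).2)
      (heBc (hN (ϖ r))).continuousAt (hDc.comp (hsegc.comp hϖ)).continuousAt
  have hUc : Continuous U := continuous_iff_continuousAt.2 fun r =>
    ContinuousAt.comp (g := coord EX x₀) (hcoord (hN (ϖ r)))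
      ((hu y₀ t₀).continuous.comp (hsegc.comp hϖ)).continuousAt
  have hGat (r : ℝ) (γ : FB) : ContDiffAt ℝ 1 m.G (γ, U r) := m.contDiffAt_G γ _ (hN (ϖ r))
  have hDGc : Continuous (fun r => fderiv ℝ m.G (c • β r, U r)) :=
    continuous_iff_continuousAt.2 fun r => ContinuousAt.comp (g := fderiv ℝ m.G)
      (f := fun r => (c • β r, U r)) ((hGat r _).continuousAt_fderiv one_ne_zero)
      (hβc.prodMk hUc).continuousAt
  have hs₁N : (u y₀ t₀ s₁).proj ∈ m.N := by
    have := hN 0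
    rwa [seg_zero] at this
  have hs₂N : (u y₀ t₀ s₂).proj ∈ m.N := by
    have := hN 1
    rwa [seg_one] at this
  have hc₁ := contMDiffAt_coord (FE := FE) (VE := VE) (m.source hs₁N) (m.baseSet hs₁N)
  have hc₂ := contMDiffAt_coord (FE := FE) (VE := VE) (m.source hs₂N) (m.baseSet hs₂N)
  have hS₁ := hS.1.hasStrictDerivFam hc₁
  -- The candidate for the `t`-derivative of `u` along the segment, starting from the known
  -- derivative at `s₁`.
  obtain ⟨w, hw0, hw⟩ := exists_linear_ode
    (A := fun r => μ • (fderiv ℝ m.G (c • β r, U r)).comp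
      (ContinuousLinearMap.inr ℝ FB (EX × FE)))
    (r := fun r => μ • fderiv ℝ m.G (c • β r, U r) (b' (ϖ r), 0))
    ((hDGc.clm_comp continuous_const).const_smul μ).continuousOn
    ((hDGc.clm_apply ((hb'c.comp hϖ).prodMk continuous_const)).const_smul μ).continuousOn
    (fun r _ => by
      rw [norm_smul, Real.norm_eq_abs]
      refine le_trans ?_ hμK
      refine mul_le_mul_of_nonneg_left ?_ (abs_nonneg μ)
      refine (ContinuousLinearMap.opNorm_comp_le _ _).trans ?_
      have h3 := hKr (ϖ r)
      rw [hβ r] at h3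
      refine (mul_le_mul h3 (ContinuousLinearMap.norm_inr_le_one ℝ FB (EX × FE)) (norm_nonneg _)
        hKpos.le).trans (mul_one K).le)
    (tderiv (coord EX x₀) (velocity (𝓘(ℝ, EX).prod 𝓘(ℝ, FE)) (fun t => u y₀ t s₁) t₀))
  have hw' (r : ℝ) (hr : r ∈ Icc (0 : ℝ) 1) : HasDerivWithinAt w
      (μ • fderiv ℝ m.G (c • β r, U r) (b' (ϖ r), w r)) (Icc 0 1) r := by
    refine (hw r hr).congr_deriv ?_
    change μ • fderiv ℝ m.G (c • β r, U r) (0, w r) + _ = _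
    rw [← smul_add, ← map_add, Prod.mk_add_mk, zero_add, add_zero]
  -- By compactness all nearby parallel curves stay in the domain of the chart model along the whole
  -- segment.
  have hevN : ∀ᶠ q : Y × Interval in 𝓝 (y₀, t₀), ∀ r, (u q.1 q.2 (seg s₁ s₂ r)).proj ∈ m.N := by
    have key := isCompact_univ.eventually_forall_of_forall_eventually (x₀ := (y₀, t₀))
      (P := fun (q : Y × Interval) (r : Interval) => (u q.1 q.2 (seg s₁ s₂ r)).proj ∈ m.N)
      (K := univ) fun r _ => ?_
    · exact key.mono fun q hq r => hq r trivial
    · have h3 := (hut (seg s₁ s₂ r)).comp (tendsto_fst.prodMk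
        ((hsegc.tendsto r).comp (tendsto_snd (f := 𝓝 (y₀, t₀)))))
      rw [nhds_prod_eq]
      exact ((hproj.tendsto _).comp h3).eventually (m.isOpen_N.mem_nhds (hN r))
  have hunifU : TendstoUniformlyOn (fun (q : Y × Interval) r =>
      coord EX x₀ (u q.1 q.2 (seg s₁ s₂ (ϖ r)))) U (𝓝 (y₀, t₀)) (Icc 0 1) :=
    tendstoUniformlyOn_of_forall_tendsto
      (b := fun (q : Y × Interval) r => coord EX x₀ (u q.1 q.2 (seg s₁ s₂ r)))
      (b₀ := fun r => coord EX x₀ (u y₀ t₀ (seg s₁ s₂ r)))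
      (continuous_iff_continuousAt.2 fun r => ContinuousAt.comp (g := coord EX x₀)
        (hcoord (hN r)) ((hu y₀ t₀).continuous.comp hsegc).continuousAt)
      (fun r => (hcoord (hN r)).tendsto.comp ((hut (seg s₁ s₂ r)).comp (tendsto_fst.prodMk
        ((hsegc.tendsto r).comp tendsto_snd))))
  have hunifb : TendstoUniformlyOn (fun (q : Y × Interval) r =>
      (eB (D q.1 q.2 (seg s₁ s₂ (ϖ r)))).2) (fun r => c • β r) (𝓝 (y₀, t₀)) (Icc 0 1) := by
    simp only [← hβ]
    exact tendstoUniformlyOn_of_forall_tendsto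
      (b := fun (q : Y × Interval) r => (eB (D q.1 q.2 (seg s₁ s₂ r))).2)
      (b₀ := fun r => (eB (D y₀ t₀ (seg s₁ s₂ r))).2)
      (continuous_iff_continuousAt.2 fun r => ContinuousAt.comp (g := fun w => (eB w).2)
        (heBc (hN r)).continuousAt (hDc.comp hsegc).continuousAt)
      (fun r => (heBc (hN r)).continuousAt.tendsto.comp ((hDt (seg s₁ s₂ r)).comp
        (tendsto_fst.prodMk ((hsegc.tendsto r).comp tendsto_snd))))
  have hk₁ : Tendsto (fun p : Y × Interval × Interval => (p.1, p.2.1))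
      (𝓝 y₀ ×ˢ 𝓝 t₀ ×ˢ 𝓝 t₀) (𝓝 (y₀, t₀)) := by
    rw [nhds_prod_eq]
    exact tendsto_fst.prodMk (tendsto_fst.comp tendsto_snd)
  have hk₂ : Tendsto (fun p : Y × Interval × Interval => (p.1, p.2.2))
      (𝓝 y₀ ×ˢ 𝓝 t₀ ×ˢ 𝓝 t₀) (𝓝 (y₀, t₀)) := by
    rw [nhds_prod_eq]
    exact tendsto_fst.prodMk (tendsto_snd.comp tendsto_snd)
  have hode : ∀ᶠ q : Y × Interval in 𝓝 (y₀, t₀), ∀ r ∈ Icc (0 : ℝ) 1, HasDerivWithinAt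
      (fun r => coord EX x₀ (u q.1 q.2 (seg s₁ s₂ (ϖ r))))
      (μ • m.G ((eB (D q.1 q.2 (seg s₁ s₂ (ϖ r)))).2,
        coord EX x₀ (u q.1 q.2 (seg s₁ s₂ (ϖ r))))) (Icc 0 1) r :=
    hevN.mono fun q hq r hr => (hu q.1 q.2).hasDerivWithinAt_seg m s₁ s₂ hr (hq (ϖ r))
  have hB := eventually_norm_sub_le_of_linearized_ode (P := Y × Interval × Interval)
    (l := 𝓝 y₀ ×ˢ 𝓝 t₀ ×ˢ 𝓝 t₀) (G := m.G) (b := fun r => c • β r) (b' := fun r => b' (ϖ r))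
    (u := U) (w := w) (μ := μ) hβc.continuousOn (hb'c.comp hϖ).continuousOn hUc.continuousOn
    (fun r _ => hGat r _) (h := fun p => (p.2.2 : ℝ) - p.2.1) (hk₁.eventually hode)
    (hk₂.eventually hode) (fun V hV => hk₁.eventually (hunifU V hV))
    (fun V hV => hk₂.eventually (hunifU V hV)) (fun V hV => hk₁.eventually (hunifb V hV))
    (fun V hV => hk₂.eventually (hunifb V hV))
    (fun ε hε => (eventually_forall_norm_le_of_strict
      (f := fun y t r => (eB (D y t (seg s₁ s₂ r))).2) hstr hε).mono fun p hp r _ => hp (ϖ r))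
    hw' (by
      simp only [hϖ0, hw0]
      exact hS₁)
  -- The uniform first order estimate at the end of the segment says that `w 1` is the strict
  -- derivative at `s₂`.
  have hstrict : HasStrictDerivFam (fun y t => coord EX x₀ (u y t s₂)) (𝓝 y₀) t₀ (w 1) := by
    refine isLittleO_iff.2 fun ε hε => (hB ε hε).mono fun p hp => ?_
    have h3 := hp 1 (by simp)
    rwa [hϖ1] at h3
  have hcont₂ : ContinuousAt (fun p : Y × Interval => u p.1 p.2 s₂) (y₀, t₀) :=
    (hut s₂).comp (tendsto_id.prodMk tendsto_const_nhds)
  have hSt : StrictAt (𝓘(ℝ, EX).prod 𝓘(ℝ, FE)) (fun y t => u y t s₂) y₀ t₀ :=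
    StrictAt.of_chart hcont₂ (mem_source_coord (m.source hs₂N) (m.baseSet hs₂N)) hstrict
  refine ⟨hSt, ?_⟩
  have hw1 : tderiv (coord EX x₀) (velocity (𝓘(ℝ, EX).prod 𝓘(ℝ, FE)) (fun t => u y₀ t s₂) t₀) =
      w 1 := ((hSt.hasStrictDerivFam hc₂).hasDerivAtI (pure_le_nhds _)).unique
    (hstrict.hasDerivAtI (pure_le_nhds _))
  have hσN {s : Interval} (hs : (u y₀ t₀ s).proj ∈ m.N) :
      (eB (AlgebroidSplitting.fibreSMul (σ s) (a s))).2 = σ s • (eB (a s)).2 :=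
    trivialization_fibreSMul eB (σ s) (haN hs)
  rw [m.isAnchored_iff (b := AlgebroidSplitting.fibreSMul (σ s₂) (a s₂)) hSt.mdifferentiableAt hs₂N
    (haB s₂), hw1, hσN hs₂N]
  have h0 := (m.isAnchored_iff (b := AlgebroidSplitting.fibreSMul (σ s₁) (a s₁))
    hS.1.mdifferentiableAt hs₁N (haB s₁)).1 hS.2
  rw [← hw0, hσN hs₁N] at h0
  have h1 := linearized_anchor_eq (G := m.G) (R := m.R) m.G_add m.G_smul (β := β)
    (b := fun r => b' (ϖ r)) (σ := fun r => σ (seg s₁ s₂ (ϖ r))) (u := U) (w := w) (c := c)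
    (μ := μ) (fun r _ => hGat r) (fun r _ => m.contDiffAt_R _ (hN (ϖ r)))
    (fun r _ γ ζ => m.fderiv_R γ _ (hN (ϖ r)) ζ) hβc.continuousOn
    (fun r hr => ((hode.self_of_nhds r hr)).congr_deriv (by rw [hβ r])) hw'
    -- The homotopy condition `hσ`: the `s`-derivative of `σ a` is the `t`-derivative of the driving
    -- vector, here rescaled by `μ`.
    (fun r hr => by
      have h3 := (hσ _ _ (haN (hN (ϖ r)))).comp_reparam (hasDerivAtI_seg s₁ s₂ (ϖ r))
      unfold HasDerivAtI at h3
      have h4 : ((ϖ r : Interval) : ℝ) = r := by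
        change ((projIcc (0 : ℝ) 1 zero_le_one r : Interval) : ℝ) = r
        rw [projIcc_of_mem zero_le_one hr]
      rw [h4] at h3
      exact h3.congr (fun r _ => (hσN (hN (ϖ r))).symm) (hσN (hN (ϖ r))).symm)
    (by
      simp only [β, U, hϖ0]
      exact h0)
  simp only [β, U, hϖ1] at h1
  exact h1

end Extension.Connection

end Propagation


/-! ### Transport between moving times, and the splitting homeomorphism. -/

section Curves

variable {E : Type*} [NormedAddCommGroup E] [NormedSpace ℝ E] {Y : Type*} [TopologicalSpace Y]

theorem HasDerivAtI.smul {f : Interval → ℝ} {g : Interval → E} {f' : ℝ} {g' : E} {t : Interval}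
    (hf : HasDerivAtI f f' t) (hg : HasDerivAtI g g' t) :
    HasDerivAtI (fun s => f s • g s) (f t • g' + f' • g t) t := by
  have h := HasDerivWithinAt.smul hf hg
  simp only [projIcc_val] at h
  exact h

theorem hasDerivAtI_affine {f : Interval → ℝ} {m : ℝ} (t : Interval)
    (h : ∀ t t' : Interval, f t' - f t = ((t' : ℝ) - t) * m) : HasDerivAtI f m t :=
  (hasStrictDerivFam_affine (Y := Unit) (f := fun _ => f) (g := fun _ => m) (y₀ := ())
    continuousAt_const fun _ => h).hasDerivAtI (pure_le_nhds ())

theorem HasStrictDerivFam.strictAt {u : Y → Interval → E} {y₀ : Y} {t₀ : Interval} {D : E}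
    (h : HasStrictDerivFam u (𝓝 y₀) t₀ D)
    (hc : ContinuousAt (fun p : Y × Interval => u p.1 p.2) (y₀, t₀)) :
    StrictAt 𝓘(ℝ, E) u y₀ t₀ :=
  ⟨hc, D, h⟩

theorem StrictAt.slice {E' H : Type*} [NormedAddCommGroup E'] [NormedSpace ℝ E']
    [TopologicalSpace H] {I : ModelWithCorners ℝ E' H} {Z : Type*} [TopologicalSpace Z]
    [ChartedSpace H Z] {u : Y → Interval → Z} {y₀ : Y} {t₀ : Interval}
    (h : StrictAt I u y₀ t₀) : StrictAt I (fun _ : Unit => u y₀) () t₀ :=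
  StrictAt.comp_reparam (k := fun _ => y₀) (θ := fun _ t => t) h continuousAt_const
    continuousAt_snd (hasStrictDerivFam_coe t₀)

theorem seg_zero_one (t : Interval) : seg 0 1 t = t :=
  Subtype.ext (by simp [coe_seg])

theorem fibreSMul_one {M F : Type*} {V : M → Type*} [∀ x, AddCommGroup (V x)]
    [∀ x, Module ℝ (V x)] (v : TotalSpace F V) : fibreSMul 1 v = v := by
  unfold fibreSMul
  rw [one_smul]

end Curves

section Splitting

variable {EX : Type*} [NormedAddCommGroup EX] [NormedSpace ℝ EX] [FiniteDimensional ℝ EX]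
  {X : Type*} [TopologicalSpace X] [ChartedSpace EX X] [IsManifold 𝓘(ℝ, EX) ∞ X] [T2Space X]
  {FE : Type*} [NormedAddCommGroup FE] [NormedSpace ℝ FE] [FiniteDimensional ℝ FE]
  {VE : X → Type*} [TopologicalSpace (TotalSpace FE VE)] [∀ x, TopologicalSpace (VE x)]
  [∀ x, AddCommGroup (VE x)] [∀ x, Module ℝ (VE x)] [FiberBundle FE VE] [VectorBundle ℝ FE VE]
  [ContMDiffVectorBundle ∞ FE VE 𝓘(ℝ, EX)]
  {EB : Type*} [NormedAddCommGroup EB] [NormedSpace ℝ EB] [FiniteDimensional ℝ EB]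
  {B : Type*} [TopologicalSpace B] [ChartedSpace EB B] [IsManifold 𝓘(ℝ, EB) ∞ B] [T2Space B]
  {FB : Type*} [NormedAddCommGroup FB] [NormedSpace ℝ FB] [FiniteDimensional ℝ FB]
  {VB : B → Type*} [TopologicalSpace (TotalSpace FB VB)] [∀ b, TopologicalSpace (VB b)]
  [∀ b, AddCommGroup (VB b)] [∀ b, Module ℝ (VB b)] [FiberBundle FB VB] [VectorBundle ℝ FB VB]
  [ContMDiffVectorBundle ∞ FB VB 𝓘(ℝ, EB)]
  {AE : LieAlgebroid EX FE VE} {AB : LieAlgebroid EB FB VB} {Q : Extension AE AB}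
  {C : Q.Connection} {Y : Type*} [TopologicalSpace Y]

namespace Extension.Connection

/-- Transport from the moving time `seg p₀ q₀ t` to the moving time `seg p₁ q₁ t` is the end of a
parallel curve whose driving path depends on `t`. The anchor condition carries as horizontal part
the speed of the moving time, `q₀ - p₀` before and `q₁ - p₁` after transport. -/
theorem strictAt_transport (hC : C.IsComplete) {α : Y → AB.Path} (hα : Continuous α)
    (p₀ q₀ p₁ q₁ : Interval) {b : Y → Interval → TotalSpace FE VE}
    (hb : ∀ y t, StrictAt (𝓘(ℝ, EX).prod 𝓘(ℝ, FE)) b y t)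
    (hover : ∀ y t, Q.p (b y t).proj = (α y (seg p₀ q₀ t)).proj)
    (hker : ∀ y t, Q.pr (b y t).proj (b y t).2 = 0)
    (hanch : ∀ y t, C.IsAnchored (b y)
      (AlgebroidSplitting.fibreSMul (q₀ - p₀) (α y (seg p₀ q₀ t))) t) (y₀ : Y) (t₀ : Interval) :
    StrictAt (𝓘(ℝ, EX).prod 𝓘(ℝ, FE))
      (fun y t => C.transport (α y) (seg p₁ q₁ t) (seg p₀ q₀ t) (b y t)) y₀ t₀ ∧
    C.IsAnchored (fun t => C.transport (α y₀) (seg p₁ q₁ t) (seg p₀ q₀ t) (b y₀ t))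
      (AlgebroidSplitting.fibreSMul (q₁ - p₁) (α y₀ (seg p₁ q₁ t₀))) t₀ := by
  -- The interpolated time, with `δ` its derivative in `s` and `σ` its derivative in `t`. Both are
  -- affine with the same slope, the mixed second derivative of `ϑ`.
  let ϑ : Interval → Interval → Interval := fun t => seg (seg p₀ q₀ t) (seg p₁ q₁ t)
  let δ : Interval → ℝ := fun t => (seg p₁ q₁ t : ℝ) - seg p₀ q₀ t
  let σ : Interval → ℝ := fun s => (1 - s) * ((q₀ : ℝ) - p₀) + s * ((q₁ : ℝ) - p₁)
  have hϑ (t t' s : Interval) : (ϑ t' s : ℝ) - ϑ t s = ((t' : ℝ) - t) * σ s := by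
    simp only [ϑ, σ, coe_seg]
    ring
  have hδ (t t' : Interval) :
      δ t' - δ t = ((t' : ℝ) - t) * (((q₁ : ℝ) - p₁) - (q₀ - p₀)) := by
    simp only [δ, coe_seg]
    ring
  have hσ' (t t' : Interval) :
      σ t' - σ t = ((t' : ℝ) - t) * (((q₁ : ℝ) - p₁) - (q₀ - p₀)) := by
    simp only [σ]
    ring
  have hσc : Continuous σ := by fun_prop
  have hδc : Continuous δ := (continuous_subtype_val.comp (continuous_seg_right p₁ q₁)).sub
    (continuous_subtype_val.comp (continuous_seg_right p₀ q₀))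
  have hϑc : Continuous (fun p : Interval × Interval => ϑ p.1 p.2) :=
    continuous_seg.comp (((continuous_seg_right p₀ q₀).comp continuous_fst).prodMk
      (((continuous_seg_right p₁ q₁).comp continuous_fst).prodMk continuous_snd))
  have hw (y : Y) (t : Interval) := isParallel_transport hC (α y) (hover y t) (hker y t)
  have hαs := LieAlgebroid.continuous_path_iff.1 hα
  have hDs (y : Y) (t s : Interval) : StrictAt (𝓘(ℝ, EB).prod 𝓘(ℝ, FB))
      (fun (q : Y × Interval) t => AlgebroidSplitting.fibreSMul (δ t) (α q.1 (ϑ t q.2)))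
      (y, s) t := by
    refine StrictAt.fibreSMul (r := fun _ => δ) (HasStrictDerivFam.strictAt
      (hasStrictDerivFam_affine (g := fun _ => ((q₁ : ℝ) - p₁) - (q₀ - p₀)) continuousAt_const
        fun _ => hδ) (hδc.comp continuous_snd).continuousAt) ?_
    exact StrictAt.comp_reparam (u := fun y t => α y t) (k := Prod.fst)
      (θ := fun q t => ϑ t q.2) (hαs y (ϑ t s)) continuousAt_fst
      (hϑc.comp (continuous_snd.prodMk (continuous_snd.comp continuous_fst))).continuousAt
      (hasStrictDerivFam_affine (g := fun q : Y × Interval => σ q.2)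
        (hσc.comp continuous_snd).continuousAt fun q t t' => hϑ t t' q.2)
  have h0 (y : Y) (t : Interval) :
      C.transport (α y) (ϑ t 0) (seg p₀ q₀ t) (b y t) = b y t := by
    simp only [ϑ, seg_zero]
    exact (hw y t).2
  have key := strictAt_and_isAnchored (C := C)
    (D := fun y t s => AlgebroidSplitting.fibreSMul (δ t) (α y (ϑ t s)))
    (u := fun y t s => C.transport (α y) (ϑ t s) (seg p₀ q₀ t) (b y t)) (y₀ := y₀) (t₀ := t₀)
    (a := fun s => α y₀ (ϑ t₀ s)) (c := δ t₀) (σ := σ) (s₀ := 0)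
    (fun y t => (hw y t).1.isWeakParallel.comp_reparam (continuous_seg_right _ _)
      (hasDerivAtI_seg _ _)) (fun s => hDs y₀ t₀ s) (fun s => rfl) (fun s b₀ hs => by
      set eB := trivializationAt FB VB b₀ with heB
      have hα₀ : Continuous (α y₀) := (α y₀).continuous
      have hev {ρ : Interval → Interval} {r : Interval → ℝ} (hρ : Continuous ρ) {t : Interval}
          (ht : (α y₀ (ρ t)).proj ∈ eB.baseSet) : ∀ᶠ t in 𝓝 t,
          (eB (AlgebroidSplitting.fibreSMul (r t) (α y₀ (ρ t)))).2 =
            r t • (eB (α y₀ (ρ t))).2 := by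
        filter_upwards [((FiberBundle.continuous_proj FB VB).comp (hα₀.comp hρ)).continuousAt
          (eB.open_baseSet.mem_nhds ht)] with t ht
        exact trivialization_fibreSMul eB _ ht
      have h1 := hasDerivAtI_comp ((α y₀).mdifferentiable (ϑ t₀ s))
        ((contMDiffAt_trivialization_snd b₀ hs).mdifferentiableAt one_ne_zero)
      have hρ₁ : Continuous (fun t => ϑ t s) := hϑc.comp (continuous_id.prodMk continuous_const)
      have h2 := ((hasDerivAtI_affine t₀ hδ).smul (h1.comp_reparam (ρ := fun t => ϑ t s)
        (hasDerivAtI_affine t₀ fun t t' => hϑ t t' s))).congr (hev hρ₁ hs)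
      have h3 := hasDerivAtI_comp (hDs y₀ t₀ s).mdifferentiableAt
        ((contMDiffAt_trivialization_snd b₀ (w := AlgebroidSplitting.fibreSMul (δ t₀)
          (α y₀ (ϑ t₀ s))) hs).mdifferentiableAt one_ne_zero)
      -- Both `∂_t(δ α(ϑ))` and `∂_s(σ α(ϑ))` are the common slope times `α(ϑ)` plus `δ σ` times the
      -- derivative of `α`.
      rw [h3.unique h2]
      have h4 := ((hasDerivAtI_affine s hσ').smul (h1.comp_reparam (ρ := ϑ t₀)
        (hasDerivAtI_seg _ _ s))).congr (hev (continuous_seg_right _ _) hs)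
      rwa [smul_comm] at h4)
    (by
      simp only [h0]
      exact hb y₀ t₀)
    (by
      simp only [h0]
      have h1 : σ 0 = (q₀ : ℝ) - p₀ := by simp [σ]
      have h2 : ϑ t₀ 0 = seg p₀ q₀ t₀ := seg_zero _ _
      rw [h1, h2]
      exact hanch y₀ t₀) 1
  have h1 : σ 1 = (q₁ : ℝ) - p₁ := by simp [σ]
  have h2 (t : Interval) : ϑ t 1 = seg p₁ q₁ t := seg_one _ _
  simp only [h1, h2] at key
  exact key

omit [FiniteDimensional ℝ EX] [T2Space X] [FiniteDimensional ℝ FE] [FiniteDimensional ℝ EB]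
  [T2Space B] [FiniteDimensional ℝ FB] in
theorem liftAt_fibreSMul_zero {x : X} {b : TotalSpace FB VB} (h : Q.p x = b.proj) :
    C.liftAt x (AlgebroidSplitting.fibreSMul 0 b) = 0 := by
  obtain ⟨y, b⟩ := b
  obtain rfl : Q.p x = y := h
  unfold AlgebroidSplitting.fibreSMul
  rw [liftAt_mk, zero_smul, map_zero]

end Extension.Connection

omit [FiniteDimensional ℝ FE] [FiniteDimensional ℝ FB] in
theorem Extension.continuous_mapPath (Q : Extension AE AB) : Continuous Q.mapPath :=
  LieAlgebroid.continuous_path_iff.2 fun a t =>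
    (LieAlgebroid.continuous_path_iff.1 continuous_id a t).comp_contMDiffAt (F := Q.map)
      ((Q.contMDiff_map.contMDiffAt).of_le (by simp))

omit [FiniteDimensional ℝ EX] [T2Space X] [FiniteDimensional ℝ FE] [FiniteDimensional ℝ EB]
  [T2Space B] [FiniteDimensional ℝ FB] in
theorem Extension.SplitPath.lies_over (q : Q.SplitPath) (t : Interval) :
    Q.p (q.ker t).proj = (q.base 0).proj :=
  q.2 t

omit [FiniteDimensional ℝ EX] [T2Space X] [FiniteDimensional ℝ FE] [FiniteDimensional ℝ EB]
  [T2Space B] [FiniteDimensional ℝ FB] in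
theorem Extension.SplitPath.mem_ker (q : Q.SplitPath) (t : Interval) :
    Q.pr (q.ker t).proj (q.ker t).2 = 0 :=
  q.1.2.2 t

namespace Extension.Connection

/-- Transport from the moving time `t` to the fixed time `0`. The path condition of `a` is the
anchor condition with speed `1`; afterwards the speed is `0`, so the transported curve is a path by
its kernel part alone. -/
theorem strictAt_kerPart (hC : C.IsComplete) (a : AE.Path) (t : Interval) :
    StrictAt (𝓘(ℝ, EX).prod 𝓘(ℝ, FE))
      (fun (a : AE.Path) t => C.transport (Q.mapPath a) 0 t (C.vert (a t))) a t ∧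
    C.IsAnchored (fun t => C.transport (Q.mapPath a) 0 t (C.vert (a t)))
      (AlgebroidSplitting.fibreSMul 0 (Q.mapPath a 0)) t := by
  have key := strictAt_transport (Y := AE.Path) hC Q.continuous_mapPath 0 1 0 0
    (b := fun a t => C.vert (a t))
    (fun a t => (LieAlgebroid.continuous_path_iff.1 continuous_id a t).comp_contMDiffAt
      (F := C.vert) ((C.contMDiff_vert.contMDiffAt).of_le (by simp)))
    (fun a t => by
      rw [seg_zero_one, mapPath_apply, Extension.map, vert])
    (fun a t => C.pr_vert (a t))
    (fun a t => by
      rw [seg_zero_one, mapPath_apply]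
      have h1 := a.deriv_base t
      have h2 := C.vert_add_liftAt_map (a t)
      simp only [Set.Icc.coe_one, Set.Icc.coe_zero, sub_zero, fibreSMul_one]
      refine h1.trans ?_
      conv_lhs => rw [← h2]) a t
  simp only [seg_zero_one, seg_self, sub_self] at key
  exact key

/-- The component in `P(K)` of an `A_E`-path. -/
noncomputable def kerPart (hC : C.IsComplete) (a : AE.Path) : Q.KerPath :=
  ⟨LieAlgebroid.Path.ofStrictAt AE (fun t => C.transport (Q.mapPath a) 0 t (C.vert (a t)))
    (fun t => (strictAt_kerPart hC a t).1.slice) (fun t => by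
      refine ((strictAt_kerPart hC a t).2 : _ = _).trans ?_
      -- The target time is fixed, so the horizontal contribution is the lift of a zero vector.
      rw [liftAt_fibreSMul_zero, add_zero]
      exact (isParallel_transport hC (Q.mapPath a) (v := C.vert (a t)) (s := t) rfl
        (C.pr_vert (a t))).1.lies_over 0),
    fun t => (isParallel_transport hC (Q.mapPath a) (v := C.vert (a t)) (s := t) rfl
      (C.pr_vert (a t))).1.mem_ker 0⟩

theorem kerPart_apply (hC : C.IsComplete) (a : AE.Path) (t : Interval) :
    kerPart hC a t = C.transport (Q.mapPath a) 0 t (C.vert (a t)) :=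
  rfl

theorem continuous_kerPart (hC : C.IsComplete) : Continuous (kerPart hC) :=
  Continuous.subtype_mk (LieAlgebroid.continuous_path_iff.2 fun a t =>
    (strictAt_kerPart hC a t).1) _

theorem isParallel_split (hC : C.IsComplete) (q : Q.SplitPath) (t : Interval) :
    C.IsParallel q.base (fun s => C.transport q.base s 0 (q.ker t)) ∧
      C.transport q.base 0 0 (q.ker t) = q.ker t :=
  isParallel_transport hC q.base (q.lies_over t) (q.mem_ker t)

/-- The opposite case, from the fixed time `0` to the moving time `t`: a path in the kernel acquires
the horizontal velocity `♯h(a_B(t))`. -/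
theorem strictAt_join (hC : C.IsComplete) (q : Q.SplitPath) (t : Interval) :
    StrictAt (𝓘(ℝ, EX).prod 𝓘(ℝ, FE))
      (fun (q : Q.SplitPath) t => C.transport q.base t 0 (q.ker t)) q t ∧
    C.IsAnchored (fun t => C.transport q.base t 0 (q.ker t)) (q.base t) t := by
  have hb : Continuous (fun q : Q.SplitPath => q.base) :=
    continuous_fst.comp continuous_subtype_val
  have hk : Continuous (fun q : Q.SplitPath => q.ker.1) :=
    continuous_subtype_val.comp (continuous_snd.comp continuous_subtype_val)
  have key := strictAt_transport (Y := Q.SplitPath) hC hb 0 0 0 1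
    (b := fun q t => q.ker t) (LieAlgebroid.continuous_path_iff.1 hk)
    (fun q t => by
      rw [seg_self]
      exact q.lies_over t)
    (fun q t => q.mem_ker t)
    (fun q t => by
      rw [seg_self, sub_self]
      refine (q.1.2.1.deriv_base t).trans ?_
      have h1 := C.liftAt_fibreSMul_zero (q.lies_over t)
      exact (congrArg (AE.anchor (q.ker t).proj) (by rw [h1, add_zero]; rfl)).symm) q t
  simp only [seg_zero_one, seg_self, Set.Icc.coe_one, Set.Icc.coe_zero, sub_zero,
    fibreSMul_one] at key
  exact key

theorem strictAt_join_add (hC : C.IsComplete) (q : Q.SplitPath) (t : Interval) :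
    StrictAt (𝓘(ℝ, EX).prod 𝓘(ℝ, FE)) (fun (q : Q.SplitPath) t =>
      (⟨(C.transport q.base t 0 (q.ker t)).proj, (C.transport q.base t 0 (q.ker t)).2 +
        C.liftAt (C.transport q.base t 0 (q.ker t)).proj (q.base t)⟩ : TotalSpace FE VE)) q t :=
  strictAt_add_liftAt C (strictAt_join hC q t).1
    (LieAlgebroid.continuous_path_iff.1 (continuous_fst.comp continuous_subtype_val) q t)
    (fun q t => (isParallel_split hC q t).1.lies_over t)

/-- The `A_E`-path with given components. -/
noncomputable def join (hC : C.IsComplete) (q : Q.SplitPath) : AE.Path :=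
  LieAlgebroid.Path.ofStrictAt AE (fun t => ⟨(C.transport q.base t 0 (q.ker t)).proj,
    (C.transport q.base t 0 (q.ker t)).2 +
      C.liftAt (C.transport q.base t 0 (q.ker t)).proj (q.base t)⟩)
    (fun t => (strictAt_join_add hC q t).slice) (fun t => (strictAt_join hC q t).2)

theorem continuous_join (hC : C.IsComplete) : Continuous (join hC) :=
  LieAlgebroid.continuous_path_iff.2 fun q t => strictAt_join_add hC q t

theorem map_join (hC : C.IsComplete) (q : Q.SplitPath) (t : Interval) :
    Q.map (join hC q t) = q.base t :=
  map_add_liftAt C ((isParallel_split hC q t).1.lies_over t) ((isParallel_split hC q t).1.mem_ker t)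

theorem vert_join (hC : C.IsComplete) (q : Q.SplitPath) (t : Interval) :
    C.vert (join hC q t) = C.transport q.base t 0 (q.ker t) :=
  vert_add_liftAt C ((isParallel_split hC q t).1.lies_over t) ((isParallel_split hC q t).1.mem_ker t)

/-- The homeomorphism `P(A_E) → P(A_B) ⋉_B P(K)` given by a complete connection. -/
noncomputable def splitHomeomorph (hC : C.IsComplete) : AE.Path ≃ₜ Q.SplitPath where
  toFun a := ⟨(Q.mapPath a, kerPart hC a), fun t => (isParallel_transport hC (Q.mapPath a)
    (v := C.vert (a t)) (s := t) rfl (C.pr_vert (a t))).1.lies_over 0⟩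
  invFun q := join hC q
  left_inv a := by
    refine LieAlgebroid.Path.ext' fun t => ?_
    have h1 : C.transport (Q.mapPath a) t 0 (C.transport (Q.mapPath a) 0 t (C.vert (a t))) =
        C.vert (a t) := by
      have h2 := isParallel_transport hC (Q.mapPath a) (v := C.vert (a t)) (s := t) rfl
        (C.pr_vert (a t))
      rw [transport_transport hC (Q.mapPath a) (v := C.vert (a t)) (s := t) rfl
        (C.pr_vert (a t)), h2.2]
    refine Eq.trans ?_ (C.vert_add_liftAt_map (a t))
    change (⟨(C.transport (Q.mapPath a) t 0 (C.transport (Q.mapPath a) 0 t (C.vert (a t)))).proj,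
      (C.transport (Q.mapPath a) t 0 (C.transport (Q.mapPath a) 0 t (C.vert (a t)))).2 +
      C.liftAt (C.transport (Q.mapPath a) t 0 (C.transport (Q.mapPath a) 0 t
        (C.vert (a t)))).proj (Q.map (a t))⟩ : TotalSpace FE VE) = _
    rw [h1]
  right_inv q := by
    have hb : Q.mapPath (join hC q) = q.base := LieAlgebroid.Path.ext' fun t => map_join hC q t
    refine Subtype.ext (Prod.ext hb (Subtype.ext (LieAlgebroid.Path.ext' fun t => ?_)))
    change C.transport (Q.mapPath (join hC q)) 0 t (C.vert (join hC q t)) = q.ker t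
    rw [hb, vert_join, transport_transport hC q.base (q.lies_over t) (q.mem_ker t)]
    exact (isParallel_split hC q t).2
  continuous_toFun := Continuous.subtype_mk
    (Q.continuous_mapPath.prodMk (continuous_kerPart hC)) _
  continuous_invFun := continuous_join hC

end Extension.Connection

end Splitting


/-! ### Cut-off reparametrizations and gluing of paths. -/

section Reparametrization

/-- The projection to the interval has no effect, since `τ (k s)` stays in `[0, 1]`. -/
theorem hasDerivAtI_projIcc_comp_mul {τ : ℝ → ℝ} (hτ : Differentiable ℝ τ)
    (hτI : ∀ x ∈ Icc (0 : ℝ) 1, τ x ∈ Icc (0 : ℝ) 1) {k : ℝ} (hk : k ∈ Icc (0 : ℝ) 1)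
    (s : Interval) : HasDerivAtI
      (fun s : Interval => (projIcc (0 : ℝ) 1 zero_le_one (τ (k * s)) : ℝ))
      (k * deriv τ (k * s)) s := by
  have hmem (x : ℝ) (hx : x ∈ Icc (0 : ℝ) 1) : τ (k * x) ∈ Icc (0 : ℝ) 1 :=
    hτI _ ⟨mul_nonneg hk.1 hx.1, mul_le_one₀ hk.2 hx.1 hx.2⟩
  have h1 : HasDerivAt (fun x : ℝ => τ (k * x)) (k * deriv τ (k * s)) s := by
    have := HasDerivAt.comp (s : ℝ) (hτ (k * s)).hasDerivAt ((hasDerivAt_id (s : ℝ)).const_mul k)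
    rwa [mul_one, mul_comm] at this
  refine h1.hasDerivWithinAt.congr (fun x hx => ?_) ?_
  · change ((projIcc (0 : ℝ) 1 zero_le_one (τ (k * (projIcc (0 : ℝ) 1 zero_le_one x : Interval))) :
      Interval) : ℝ) = _
    rw [projIcc_of_mem zero_le_one hx, projIcc_of_mem zero_le_one (hmem x hx)]
  · change ((projIcc (0 : ℝ) 1 zero_le_one (τ (k * (projIcc (0 : ℝ) 1 zero_le_one (s : ℝ) :
      Interval))) : Interval) : ℝ) = _
    rw [projIcc_val, projIcc_of_mem zero_le_one (hmem s s.2)]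

theorem IsCutoff.deriv_of_nonpos {τ : ℝ → ℝ} (hτ : IsCutoff τ) {x : ℝ} (hx : x ≤ 0) :
    deriv τ x = 0 := by
  have h1 := (hτ.contDiff.differentiable (by simp) x).hasDerivAt.hasDerivWithinAt (s := Iic x)
  have h2 : HasDerivWithinAt τ 0 (Iic x) x := (hasDerivWithinAt_const x (Iic x) (0 : ℝ)).congr
    (fun y hy => hτ.eq_zero y (le_trans hy hx)) (hτ.eq_zero x hx)
  exact (uniqueDiffOn_Iic x x self_mem_Iic).eq_deriv _ h1 h2

theorem IsCutoff.deriv_of_one_le {τ : ℝ → ℝ} (hτ : IsCutoff τ) {x : ℝ} (hx : 1 ≤ x) :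
    deriv τ x = 0 := by
  have h1 := (hτ.contDiff.differentiable (by simp) x).hasDerivAt.hasDerivWithinAt (s := Ici x)
  have h2 : HasDerivWithinAt τ 0 (Ici x) x := (hasDerivWithinAt_const x (Ici x) (1 : ℝ)).congr
    (fun y hy => hτ.eq_one y (le_trans hx hy)) (hτ.eq_one x hx)
  exact (uniqueDiffOn_Ici x x self_mem_Ici).eq_deriv _ h1 h2

theorem IsCutoff.mem_Icc {τ : ℝ → ℝ} (hτ : IsCutoff τ) (x : ℝ) : τ x ∈ Icc (0 : ℝ) 1 := by
  have hmono : Monotone τ := by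
    refine monotone_of_deriv_nonneg (hτ.contDiff.differentiable (by simp)) fun y => ?_
    rcases le_or_gt y 0 with h | h
    · exact (hτ.deriv_of_nonpos h).ge
    rcases le_or_gt 1 y with h' | h'
    · exact (hτ.deriv_of_one_le h').ge
    · exact (hτ.deriv_pos y ⟨h, h'⟩).le
  constructor
  · rw [← hτ.eq_zero (min x 0) (min_le_right _ _)]
    exact hmono (min_le_left _ _)
  · rw [← hτ.eq_one (max x 1) (le_max_right _ _)]
    exact hmono (le_max_left _ _)

/-- The midpoint of the unit interval. -/
noncomputable def half : Interval :=
  ⟨1 / 2, by norm_num, by norm_num⟩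

theorem coe_half : (half : ℝ) = 1 / 2 :=
  rfl

end Reparametrization

section Glue

variable {EM : Type*} [NormedAddCommGroup EM] [NormedSpace ℝ EM]
  {M : Type*} [TopologicalSpace M] [ChartedSpace EM M]
  {F : Type*} [NormedAddCommGroup F] [NormedSpace ℝ F]
  {V : M → Type*} [TopologicalSpace (TotalSpace F V)] [∀ x, TopologicalSpace (V x)]
  [∀ x, AddCommGroup (V x)] [∀ x, Module ℝ (V x)] [FiberBundle F V] [VectorBundle ℝ F V]
  [IsManifold 𝓘(ℝ, EM) ∞ M] [ContMDiffVectorBundle ∞ F V 𝓘(ℝ, EM)] {A : LieAlgebroid EM F V}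

theorem StrictAt.congr {Y E H Z : Type*} [TopologicalSpace Y] [NormedAddCommGroup E]
    [NormedSpace ℝ E] [TopologicalSpace H] {I : ModelWithCorners ℝ E H} [TopologicalSpace Z]
    [ChartedSpace H Z] {u v : Y → Interval → Z} {y₀ : Y} {t₀ : Interval} (h : StrictAt I u y₀ t₀)
    (huv : ∀ᶠ p in 𝓝 (y₀, t₀), u p.1 p.2 = v p.1 p.2) : StrictAt I v y₀ t₀ := by
  obtain ⟨hc, D, hD⟩ := h
  refine ⟨hc.congr huv, D, ?_⟩
  rw [← huv.self_of_nhds]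
  refine hD.congr ?_
  rw [← nhds_prod_eq]
  exact huv.mono fun p hp => congrArg _ hp

/-- When at each time one of two curves rests at `z`, the glued curve is `ψ(a₁) + ψ(a₂) - ψ(z)` in a
chart. Differentiability at the junction follows without one-sided derivatives. -/
theorem add_sub_apply_of_or {α E : Type*} [AddCommGroup E] (ψ : α → E) {x y z c : α}
    (h : c = x ∧ y = z ∨ c = y ∧ x = z) : ψ x + ψ y - ψ z = ψ c := by
  rcases h with ⟨rfl, rfl⟩ | ⟨rfl, rfl⟩
  · rw [add_sub_cancel_right]
  · rw [add_sub_cancel_left]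

/-- Two `A`-paths that rest at the same zero vector on complementary halves of the unit interval
can be glued. -/
theorem LieAlgebroid.Path.exists_glue (a₁ a₂ : A.Path) {z : TotalSpace F V}
    (h₁ : ∀ t : Interval, 1 / 2 ≤ (t : ℝ) → a₁ t = z)
    (h₂ : ∀ t : Interval, (t : ℝ) ≤ 1 / 2 → a₂ t = z) (hz : z.2 = 0) :
    ∃ c : A.Path, ∀ t : Interval, c t = if (t : ℝ) ≤ 1 / 2 then a₁ t else a₂ t := by
  have : IsManifold 𝓘(ℝ, EM) 1 M := .of_le (show (1 : WithTop ℕ∞) ≤ ∞ by simp)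
  set c : Interval → TotalSpace F V := fun t => if (t : ℝ) ≤ 1 / 2 then a₁ t else a₂ t with hc
  have hcc : Continuous c := Continuous.if_le a₁.continuous a₂.continuous continuous_subtype_val
    continuous_const fun t ht => by rw [h₁ t ht.ge, h₂ t ht.le]
  have hlt (t : Interval) (ht : (t : ℝ) < 1 / 2) : ∀ᶠ s in 𝓝 t, a₁ s = c s :=
    (continuous_subtype_val.continuousAt.eventually_lt_const ht).mono fun s hs =>
      (if_pos (le_of_lt hs)).symm
  have hgt (t : Interval) (ht : 1 / 2 < (t : ℝ)) : ∀ᶠ s in 𝓝 t, a₂ s = c s :=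
    (continuous_subtype_val.continuousAt.eventually_const_lt ht).mono fun s hs =>
      (if_neg (not_le_of_gt hs)).symm
  have hor (t : Interval) : c t = a₁ t ∧ a₂ t = z ∨ c t = a₂ t ∧ a₁ t = z := by
    rcases le_or_gt (t : ℝ) (1 / 2) with ht | ht
    · exact Or.inl ⟨if_pos ht, h₂ t ht⟩
    · exact Or.inr ⟨if_neg (not_le_of_gt ht), h₁ t ht.le⟩
  have hcz (t : Interval) (ht : (t : ℝ) = 1 / 2) : c t = z := by
    rw [hc]
    simp only [if_pos ht.le, h₁ t ht.ge]
  refine ⟨LieAlgebroid.Path.ofStrictAt A c (fun t => ?_) (fun t => ?_), fun t => rfl⟩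
  · rcases lt_trichotomy (t : ℝ) (1 / 2) with ht | ht | ht
    · exact (a₁.strictAt () t).congr ((continuous_snd.tendsto ((), t)).eventually (hlt t ht))
    · have hz₁ := h₁ t ht.ge
      have hz₂ := h₂ t ht.le
      refine ⟨(hcc.comp continuous_snd).continuousAt, ?_⟩
      change ∃ D, HasStrictDerivFam (fun (_ : Unit) s =>
        extChartAt (𝓘(ℝ, EM).prod 𝓘(ℝ, F)) (c t) (c s)) (𝓝 ()) t D
      rw [hcz t ht]
      obtain ⟨hc₁, D₁, hD₁⟩ := a₁.strictAt () t
      obtain ⟨hc₂, D₂, hD₂⟩ := a₂.strictAt () t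
      simp only at hD₁ hD₂
      rw [hz₁] at hD₁
      rw [hz₂] at hD₂
      set ψ := extChartAt (𝓘(ℝ, EM).prod 𝓘(ℝ, F)) z with hψ
      have hψ₁ : ContinuousAt ψ (a₁ t) := by
        rw [hz₁]
        exact continuousAt_extChartAt z
      have hψ₂ : ContinuousAt ψ (a₂ t) := by
        rw [hz₂]
        exact continuousAt_extChartAt z
      have h3 := (hD₁.prodMk hD₂).comp_strictFDeriv (f := fun q : (EM × F) × (EM × F) =>
        q.1 + q.2 - ψ z) (x := (ψ (a₁ t), ψ (a₂ t)))
        ((hasStrictFDerivAt_fst.add hasStrictFDerivAt_snd).sub_const (ψ z)) (by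
          rw [← nhds_prod_eq]
          exact (hψ₁.comp_fam (u := fun (_ : Unit) t => a₁ t) hc₁).prodMk
            (hψ₂.comp_fam (u := fun (_ : Unit) t => a₂ t) hc₂))
      exact ⟨_, h3.congr (Eventually.of_forall fun p => add_sub_apply_of_or ψ (hor p.2))⟩
    · exact (a₂.strictAt () t).congr ((continuous_snd.tendsto ((), t)).eventually (hgt t ht))
  · rcases lt_trichotomy (t : ℝ) (1 / 2) with ht | ht | ht
    · have h3 : (fun s => (c s).proj) =ᶠ[𝓝 t] fun s => (a₁ s).proj :=
        (hlt t ht).mono fun s hs => congrArg _ hs.symm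
      have h4 := a₁.deriv_base t
      rw [(hlt t ht).self_of_nhds] at h4
      rw [h3.mfderiv_eq]
      exact h4
    -- At the junction both base curves have velocity `♯0 = 0`, so the glued base curve does too.
    · have hbase {a : A.Path} (ha : a t = z) : HasDerivAtI
          (fun s => extChartAt 𝓘(ℝ, EM) z.proj (a s).proj) 0 t := by
        have h3 := hasDerivAtI_comp (a.mdifferentiable_base t)
          (mdifferentiableAt_extChartAt (I := 𝓘(ℝ, EM)) (mem_chart_source EM (a t).proj))
        rw [show tderiv (extChartAt 𝓘(ℝ, EM) (a t).proj) (velocity 𝓘(ℝ, EM) _ t) = _ from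
          tderiv_extChartAt_self (velocity 𝓘(ℝ, EM) (fun s => (a s).proj) t)] at h3
        rw [show (velocity 𝓘(ℝ, EM) (fun s => (a s).proj) t).2 = _ from a.deriv_base t] at h3
        rw [ha, hz, map_zero] at h3
        exact h3
      have h4 := (HasDerivWithinAt.add (hbase (h₁ t ht.ge)) (hbase (h₂ t ht.le))).sub_const
        (extChartAt 𝓘(ℝ, EM) z.proj z.proj)
      have h5 : HasDerivAtI (fun s => extChartAt 𝓘(ℝ, EM) (c t).proj (c s).proj) 0 t := by
        rw [hcz t ht]
        rw [add_zero] at h4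
        exact HasDerivWithinAt.congr h4
          (fun s _ => (add_sub_apply_of_or (fun v => extChartAt 𝓘(ℝ, EM) z.proj v.proj) (hor _)).symm)
          (add_sub_apply_of_or (fun v => extChartAt 𝓘(ℝ, EM) z.proj v.proj) (hor _)).symm
      refine (mdifferentiableAt_of_hasDerivAtI
        ((FiberBundle.continuous_proj F V).comp hcc).continuousAt h5).2.trans ?_
      rw [hcz t ht, hz, map_zero]
      rfl
    · have h3 : (fun s => (c s).proj) =ᶠ[𝓝 t] fun s => (a₂ s).proj :=
        (hgt t ht).mono fun s hs => congrArg _ hs.symm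
      have h4 := a₂.deriv_base t
      rw [(hgt t ht).self_of_nhds] at h4
      rw [h3.mfderiv_eq]
      exact h4

/-- The path `t ↦ 2 a^τ(2t - m)`. -/
theorem LieAlgebroid.Path.exists_cutoff_reparam (a : A.Path) {τ : ℝ → ℝ} (hτ : IsCutoff τ)
    (m : ℝ) : ∃ c : A.Path, ∀ t : Interval, c t = fibreSMul (2 * deriv τ (2 * t - m))
      (a (projIcc 0 1 zero_le_one (τ (2 * t - m)))) := by
  have hlin : ContDiff ℝ ∞ (fun x : ℝ => 2 * x - m) := by fun_prop
  have h1 : ContDiff ℝ 1 (fun x : ℝ => τ (2 * x - m)) :=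
    (hτ.contDiff.comp hlin).of_le (by simp)
  have hτ' : ContDiff ℝ 1 (deriv τ) :=
    ((contDiff_infty_iff_deriv.1 hτ.contDiff).2).of_le (by simp)
  have h2 : ContDiff ℝ 1 (fun x : ℝ => 2 * deriv τ (2 * x - m)) :=
    contDiff_const.mul (hτ'.comp (hlin.of_le (by simp)))
  have hd (x : ℝ) : deriv (fun x : ℝ => τ (2 * x - m)) x = 2 * deriv τ (2 * x - m) := by
    have := HasDerivAt.comp x (hτ.contDiff.differentiable (by simp) (2 * x - m)).hasDerivAt
      (((hasDerivAt_id x).const_mul 2).sub_const m)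
    rw [mul_one, mul_comm] at this
    exact this.deriv
  have hproj (x : ℝ) : ((projIcc (0 : ℝ) 1 zero_le_one (τ x) : Interval) : ℝ) = τ x := by
    rw [projIcc_of_mem zero_le_one (hτ.mem_Icc x)]
  refine ⟨a.reparam (fun t => projIcc 0 1 zero_le_one (τ (2 * t - m)))
    (fun t => 2 * deriv τ (2 * t - m))
    (continuous_projIcc.comp (h1.continuous.comp continuous_subtype_val)) (fun t => ?_)
    (fun t => ?_), fun t => rfl⟩
  · have h3 := (h1.contDiffAt.hasStrictDerivAt one_ne_zero (x := (t : ℝ))).hasStrictDerivFam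
      (Y := Unit) (l := 𝓝 ())
    rw [hd] at h3
    simpa only [hproj] using h3
  · exact (((h2.contDiffAt.hasStrictDerivAt one_ne_zero (x := (t : ℝ))).hasStrictDerivFam
      (Y := Unit) (l := 𝓝 ())).strictAt
      (h2.continuous.comp (continuous_subtype_val.comp continuous_snd)).continuousAt)

theorem fibreSMul_fibreSMul {M F : Type*} {V : M → Type*} [∀ x, AddCommGroup (V x)]
    [∀ x, Module ℝ (V x)] (r s : ℝ) (v : TotalSpace F V) :
    fibreSMul r (fibreSMul s v) = fibreSMul (r * s) v :=
  congrArg (TotalSpace.mk v.proj) (smul_smul r s v.2)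

theorem fibreSMul_zero_congr {M F : Type*} {V : M → Type*} [∀ x, AddCommGroup (V x)]
    [∀ x, Module ℝ (V x)] {v w : TotalSpace F V} (h : v.proj = w.proj) :
    fibreSMul 0 v = fibreSMul 0 w := by
  obtain ⟨x, v⟩ := v
  obtain ⟨y, w⟩ := w
  obtain rfl : x = y := h
  simp [fibreSMul]

/-- Outside `(0, 1)` the cut-off is constant with zero derivative. Each half of the concatenation,
extended to the whole interval by its own formula, therefore rests at the zero vector over the
common end point, and the two halves can be glued. -/
theorem LieAlgebroid.Path.exists_concat {τ : ℝ → ℝ} (hτ : IsCutoff τ) (a₁ a₂ : A.Path)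
    (h : (a₁ 1).proj = (a₂ 0).proj) : ∃ c : A.Path, ∀ t, c t = concat τ a₂ a₁ t := by
  obtain ⟨c₁, hc₁⟩ := a₁.exists_cutoff_reparam hτ 0
  obtain ⟨c₂, hc₂⟩ := a₂.exists_cutoff_reparam hτ 1
  simp only [sub_zero] at hc₁
  obtain ⟨c, hc⟩ := LieAlgebroid.Path.exists_glue c₁ c₂ (z := fibreSMul 0 (a₁ 1))
    (fun t ht => by
      rw [hc₁, hτ.deriv_of_one_le (by linarith), hτ.eq_one _ (by linarith), mul_zero,
        projIcc_right]
      rfl)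
    (fun t ht => by
      rw [hc₂, hτ.deriv_of_nonpos (by linarith), hτ.eq_zero _ (by linarith), mul_zero,
        projIcc_left]
      exact (fibreSMul_zero_congr h).symm)
    (zero_smul ℝ _)
  refine ⟨c, fun t => ?_⟩
  rw [hc, hc₁, hc₂]
  rfl

/-- At `t = 1/2` the concatenation is defined by the first path. When it is continuous, the formula
for the second path also holds there, by approach from the right. -/
theorem concat_of_half_le [T2Space M] {τ : ℝ → ℝ} (hτ : ContDiff ℝ 1 τ)
    {a₁ a₂ c : Interval → TotalSpace F V} (ha₂ : Continuous a₂) (hc : Continuous c)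
    (h : ∀ t, c t = concat τ a₂ a₁ t) {t : Interval} (ht : 1 / 2 ≤ (t : ℝ)) :
    c t = fibreSMul (2 * deriv τ (2 * t - 1)) (a₂ (projIcc 0 1 zero_le_one (τ (2 * t - 1)))) := by
  have : T2Space (TotalSpace F V) := t2Space_totalSpace
  have hgt {t : Interval} (ht : 1 / 2 < (t : ℝ)) : c t =
      fibreSMul (2 * deriv τ (2 * t - 1)) (a₂ (projIcc 0 1 zero_le_one (τ (2 * t - 1)))) := by
    rw [h]
    exact if_neg (not_le_of_gt ht)
  rcases ht.eq_or_lt with ht' | ht'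
  · have hlin : Continuous (fun t : Interval => 2 * (t : ℝ) - 1) := by fun_prop
    have h1 : Continuous (fun t : Interval => fibreSMul (2 * deriv τ (2 * t - 1))
        (a₂ (projIcc 0 1 zero_le_one (τ (2 * t - 1))))) :=
      continuous_fibreSMul.comp ((continuous_const.mul
        ((hτ.continuous_deriv le_rfl).comp hlin)).prodMk
        (ha₂.comp (continuous_projIcc.comp (hτ.continuous.comp hlin))))
    have hseg := continuous_seg_right t 1
    have h2 : ∀ᶠ s in 𝓝[≠] (0 : Interval), c (seg t 1 s) =
        fibreSMul (2 * deriv τ (2 * seg t 1 s - 1))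
          (a₂ (projIcc 0 1 zero_le_one (τ (2 * seg t 1 s - 1)))) := by
      filter_upwards [self_mem_nhdsWithin] with s hs
      have hs' : 0 < (s : ℝ) := lt_of_le_of_ne s.2.1 fun h => hs (Subtype.ext h.symm)
      refine hgt ?_
      rw [coe_seg, ← ht']
      simp only [Set.Icc.coe_one]
      linarith
    have h3 := (hc.comp hseg).tendsto 0
    have h4 := (h1.comp hseg).tendsto 0
    have h5 := tendsto_nhds_unique ((h3.mono_left nhdsWithin_le_nhds).congr' h2)
      (h4.mono_left (nhdsWithin_le_nhds (s := {0}ᶜ)))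
    simp only [Function.comp_apply, seg_zero] at h5
    exact h5
  · exact hgt ht'

end Glue

/-! ### The splitting of a concatenation. -/

section Concatenation

variable {EX : Type*} [NormedAddCommGroup EX] [NormedSpace ℝ EX] [FiniteDimensional ℝ EX]
  {X : Type*} [TopologicalSpace X] [ChartedSpace EX X] [IsManifold 𝓘(ℝ, EX) ∞ X] [T2Space X]
  {FE : Type*} [NormedAddCommGroup FE] [NormedSpace ℝ FE] [FiniteDimensional ℝ FE]
  {VE : X → Type*} [TopologicalSpace (TotalSpace FE VE)] [∀ x, TopologicalSpace (VE x)]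
  [∀ x, AddCommGroup (VE x)] [∀ x, Module ℝ (VE x)] [FiberBundle FE VE] [VectorBundle ℝ FE VE]
  [ContMDiffVectorBundle ∞ FE VE 𝓘(ℝ, EX)]
  {EB : Type*} [NormedAddCommGroup EB] [NormedSpace ℝ EB] [FiniteDimensional ℝ EB]
  {B : Type*} [TopologicalSpace B] [ChartedSpace EB B] [IsManifold 𝓘(ℝ, EB) ∞ B] [T2Space B]
  {FB : Type*} [NormedAddCommGroup FB] [NormedSpace ℝ FB] [FiniteDimensional ℝ FB]
  {VB : B → Type*} [TopologicalSpace (TotalSpace FB VB)] [∀ b, TopologicalSpace (VB b)]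
  [∀ b, AddCommGroup (VB b)] [∀ b, Module ℝ (VB b)] [FiberBundle FB VB] [VectorBundle ℝ FB VB]
  [ContMDiffVectorBundle ∞ FB VB 𝓘(ℝ, EB)]
  {AE : LieAlgebroid EX FE VE} {AB : LieAlgebroid EB FB VB} {Q : Extension AE AB}
  {C : Q.Connection} {Y : Type*} [TopologicalSpace Y]

namespace Extension.Connection

/-- Pulled back to the unit interval, the two parallel curves have the same driving curve and the
same value at `1`; uniqueness gives the value at `0`. -/
theorem transport_eq_transport_of_reparam (hC : C.IsComplete) (a c : AB.Path) {t₁ t₂ : Interval}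
    {ρ : Interval → Interval} {r : Interval → ℝ} (hρ : Continuous ρ)
    (hr : ∀ s, HasDerivAtI (fun s => (ρ s : ℝ)) (r s) s)
    (h : ∀ s, AlgebroidSplitting.fibreSMul ((t₂ : ℝ) - t₁) (c (seg t₁ t₂ s)) =
      AlgebroidSplitting.fibreSMul (r s) (a (ρ s))) {v : TotalSpace FE VE}
    (hv : Q.p v.proj = (a (ρ 1)).proj) (hk : Q.pr v.proj v.2 = 0) :
    C.transport c t₁ t₂ v = C.transport a (ρ 0) (ρ 1) v := by
  have hv' : Q.p v.proj = (c t₂).proj := by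
    have h1 := congrArg TotalSpace.proj (h 1)
    rw [seg_one] at h1
    exact hv.trans h1.symm
  have h1 := isParallel_transport hC a hv hk
  have h2 := isParallel_transport hC c hv' hk
  have h3 := h1.1.isWeakParallel.comp_reparam hρ hr
  have h4 := h2.1.isWeakParallel.comp_reparam (continuous_seg_right t₁ t₂)
    (hasDerivAtI_seg t₁ t₂)
  simp only [← h] at h3
  have h5 := h4.eq h3 (continuous_fibreSMul.comp (continuous_const.prodMk
    (c.continuous.comp (continuous_seg_right t₁ t₂)))) (t₁ := 1) (by
      rw [seg_one, h1.2, h2.2]) 0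
  rwa [seg_zero] at h5

/-- Transport commutes with multiplication by `0`, so the base point of the result depends only on
the base point of the argument. -/
theorem proj_transport_congr (hC : C.IsComplete) (a : AB.Path) {s : Interval}
    {v w : TotalSpace FE VE} (hv : Q.p v.proj = (a s).proj) (hkv : Q.pr v.proj v.2 = 0)
    (hkw : Q.pr w.proj w.2 = 0) (h : v.proj = w.proj) (t : Interval) :
    (C.transport a t s v).proj = (C.transport a t s w).proj := by
  have h1 := congrArg TotalSpace.proj (transport_fibreSMul hC a hv hkv 0 t)
  have h2 := congrArg TotalSpace.proj (transport_fibreSMul hC a (h ▸ hv) hkw 0 t)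
  rw [fibreSMul_zero_congr h] at h1
  exact h1.symm.trans h2

/-- The case of two fixed times, `1` and `0`: both speeds vanish, and paths in the kernel go to
paths in the kernel. -/
theorem strictAt_transportKer (hC : C.IsComplete) (a : AB.Path) (k : Q.KerPath)
    (h : ∀ t, Q.p (k t).proj = (a 1).proj) (t : Interval) :
    StrictAt (𝓘(ℝ, EX).prod 𝓘(ℝ, FE))
      (fun (_ : Unit) t => C.transport a 0 1 (k t)) () t ∧
    C.IsAnchored (fun t => C.transport a 0 1 (k t))
      (AlgebroidSplitting.fibreSMul 0 (a 0)) t := by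
  have key := strictAt_transport (Y := Unit) hC (α := fun _ => a) continuous_const 1 1 0 0
    (b := fun _ t => k t) (fun _ t => k.1.strictAt () t)
    (fun _ t => by
      rw [seg_self]
      exact h t)
    (fun _ t => k.2 t)
    (fun _ t => by
      rw [seg_self, sub_self]
      refine (k.1.deriv_base t).trans ?_
      have h1 := liftAt_fibreSMul_zero (C := C) (h t)
      exact (congrArg (AE.anchor (k t).proj) (by rw [h1, add_zero])).symm) () t
  simp only [seg_self, sub_self] at key
  exact key

/-- The `K`-path `Φ_{0,1} ∘ k`. -/
noncomputable def transportKer (hC : C.IsComplete) (a : AB.Path) (k : Q.KerPath)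
    (h : ∀ t, Q.p (k t).proj = (a 1).proj) : Q.KerPath :=
  ⟨LieAlgebroid.Path.ofStrictAt AE (fun t => C.transport a 0 1 (k t))
    (fun t => (strictAt_transportKer hC a k h t).1) (fun t => by
      refine ((strictAt_transportKer hC a k h t).2 : _ = _).trans ?_
      rw [liftAt_fibreSMul_zero, add_zero]
      exact (isParallel_transport hC a (h t) (k.2 t)).1.lies_over 0),
    fun t => (isParallel_transport hC a (h t) (k.2 t)).1.mem_ker 0⟩

omit [FiniteDimensional ℝ EX] [T2Space X] [FiniteDimensional ℝ FE] [FiniteDimensional ℝ EB]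
  [T2Space B] [FiniteDimensional ℝ FB] in
theorem map_fibreSMul (r : ℝ) (v : TotalSpace FE VE) :
    Q.map (AlgebroidSplitting.fibreSMul r v) = AlgebroidSplitting.fibreSMul r (Q.map v) :=
  congrArg (TotalSpace.mk (Q.p v.proj)) (map_smul (Q.pr v.proj) r v.2)

omit [FiniteDimensional ℝ EX] [T2Space X] [FiniteDimensional ℝ FE] [FiniteDimensional ℝ EB]
  [T2Space B] [FiniteDimensional ℝ FB] in
theorem vert_fibreSMul (r : ℝ) (v : TotalSpace FE VE) :
    C.vert (AlgebroidSplitting.fibreSMul r v) = AlgebroidSplitting.fibreSMul r (C.vert v) :=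
  congrArg (TotalSpace.mk v.proj)
    (map_smul (Submodule.projection _ _ (C.isCompl v.proj)) r v.2)

omit [FiniteDimensional ℝ FE] [FiniteDimensional ℝ FB] in
theorem map_concat {τ : ℝ → ℝ} {a₁ a₂ c : AE.Path} (hc : ∀ t, c t = concat τ a₂ a₁ t)
    (t : Interval) : Q.map (c t) = concat τ (Q.mapPath a₂) (Q.mapPath a₁) t := by
  rw [hc]
  unfold concat
  split_ifs
  · exact map_fibreSMul _ _
  · exact map_fibreSMul _ _

theorem kerPart_over (hC : C.IsComplete) {a₁ a₂ : AE.Path} (h : (a₁ 1).proj = (a₂ 0).proj)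
    (t : Interval) : Q.p (kerPart hC a₂ t).proj = (Q.mapPath a₁ 1).proj :=
  ((isParallel_transport hC (Q.mapPath a₂) (v := C.vert (a₂ t)) (s := t) rfl
    (C.pr_vert (a₂ t))).1.lies_over 0).trans (congrArg Q.p h).symm

/-- At time `0` the kernel part of `a₂` is its vertical part, lying over the end point of `a₁`.
Transport along `a₁` therefore sends it over the same point as the vertical part of `a₁ 1`. -/
theorem proj_transportKer_zero (hC : C.IsComplete) {a₁ a₂ : AE.Path}
    (h : (a₁ 1).proj = (a₂ 0).proj) :
    (transportKer hC (Q.mapPath a₁) (kerPart hC a₂) (kerPart_over hC h) 0).proj =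
      (kerPart hC a₁ 1).proj := by
  have h1 : kerPart hC a₂ 0 = C.vert (a₂ 0) :=
    transport_self hC (Q.mapPath a₂) (v := C.vert (a₂ 0)) (s := 0) rfl (C.pr_vert (a₂ 0))
  change (C.transport (Q.mapPath a₁) 0 1 (kerPart hC a₂ 0)).proj =
    (C.transport (Q.mapPath a₁) 0 1 (C.vert (a₁ 1))).proj
  rw [h1]
  exact (proj_transport_congr hC (Q.mapPath a₁) (v := C.vert (a₁ 1)) (w := C.vert (a₂ 0)) rfl
    (C.pr_vert (a₁ 1)) (C.pr_vert (a₂ 0)) h 0).symm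

/-- For `t ≤ 1/2` transport along `c` from `t` to `0` is transport along `a₁`. For `t > 1/2` it
factors through `1/2` into transport along `a₂` to its start, giving the kernel part of `a₂`, and
transport along `a₁` from `1` to `0`. The scalar factors of the concatenation pass through by
linearity. -/
theorem kerPart_concat (hC : C.IsComplete) {τ : ℝ → ℝ} (hτ : ContDiff ℝ 1 τ) (hτ0 : τ 0 = 0)
    (hτ1 : τ 1 = 1) (hτI : ∀ x ∈ Icc (0 : ℝ) 1, τ x ∈ Icc (0 : ℝ) 1) {a₁ a₂ c : AE.Path}
    (h : (a₁ 1).proj = (a₂ 0).proj) (hc : ∀ t, c t = concat τ a₂ a₁ t) (t : Interval) :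
    kerPart hC c t = concat τ
      (transportKer hC (Q.mapPath a₁) (kerPart hC a₂) (kerPart_over hC h)) (kerPart hC a₁) t := by
  let ρ : ℝ → Interval → Interval := fun k s => projIcc 0 1 zero_le_one (τ (k * s))
  have hρc (k : ℝ) : Continuous (ρ k) :=
    continuous_projIcc.comp (hτ.continuous.comp (continuous_const.mul continuous_subtype_val))
  have hρ0 (k : ℝ) : ρ k 0 = 0 := by
    simp only [ρ, Set.Icc.coe_zero, mul_zero, hτ0]
    exact projIcc_left _
  have hρ1 (k : ℝ) : ρ k 1 = projIcc 0 1 zero_le_one (τ k) := by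
    simp only [ρ, Set.Icc.coe_one, mul_one]
  have hdiff := hτ.differentiable one_ne_zero
  have hfirst {t : Interval} (ht : (t : ℝ) ≤ 1 / 2) {v : TotalSpace FE VE}
      (hv : Q.p v.proj = (Q.mapPath a₁ (projIcc 0 1 zero_le_one (τ (2 * t)))).proj)
      (hk : Q.pr v.proj v.2 = 0) : C.transport (Q.mapPath c) 0 t v =
        C.transport (Q.mapPath a₁) 0 (projIcc 0 1 zero_le_one (τ (2 * t))) v := by
    -- On `[0, t]` the path `c` is `a₁` reparametrized by `s ↦ τ(2t s)`; here `2t ≤ 1` keeps the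
    -- argument in `[0, 1]`.
    have h1 := transport_eq_transport_of_reparam hC (Q.mapPath a₁) (Q.mapPath c) (t₁ := 0)
      (t₂ := t) (hρc (2 * t)) (hasDerivAtI_projIcc_comp_mul hdiff hτI
        ⟨mul_nonneg zero_le_two t.2.1, by linarith⟩) (fun s => by
        have h2 : (seg 0 t s : ℝ) = s * t := by simp [coe_seg]
        have h3 : (seg 0 t s : ℝ) ≤ 1 / 2 := by
          rw [h2]
          nlinarith [s.2.1, s.2.2, t.2.1]
        rw [mapPath_apply, hc, concat, if_pos h3, map_fibreSMul, ← mapPath_apply]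
        have h4 : (2 : ℝ) * (s * t) = 2 * t * s := by ring
        rw [h2, h4]
        rw [fibreSMul_fibreSMul, Set.Icc.coe_zero, sub_zero]
        rw [show (t : ℝ) * (2 * deriv τ (2 * t * s)) = 2 * t * deriv τ (2 * t * s) by ring])
      (by rw [hρ1]; exact hv) hk
    rwa [hρ0, hρ1] at h1
  have hsecond {t : Interval} (ht : 1 / 2 ≤ (t : ℝ)) {v : TotalSpace FE VE}
      (hv : Q.p v.proj = (Q.mapPath a₂ (projIcc 0 1 zero_le_one (τ (2 * t - 1)))).proj)
      (hk : Q.pr v.proj v.2 = 0) : C.transport (Q.mapPath c) half t v =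
        C.transport (Q.mapPath a₂) 0 (projIcc 0 1 zero_le_one (τ (2 * t - 1))) v := by
    -- On `[1/2, t]` the reparametrization is `s ↦ τ((2t - 1) s)`. The segment includes its end
    -- point `1/2`, so the second formula is needed there as well.
    have h1 := transport_eq_transport_of_reparam hC (Q.mapPath a₂) (Q.mapPath c) (t₁ := half)
      (t₂ := t) (hρc (2 * t - 1)) (hasDerivAtI_projIcc_comp_mul hdiff hτI
        ⟨by linarith, by linarith [t.2.2]⟩) (fun s => by
        have h2 : (seg half t s : ℝ) = (1 - s) * (1 / 2) + s * t := rfl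
        have h3 : 1 / 2 ≤ (seg half t s : ℝ) := by
          rw [h2]
          nlinarith [s.2.1, s.2.2]
        rw [mapPath_apply, concat_of_half_le hτ a₂.continuous c.continuous hc h3, map_fibreSMul,
          ← mapPath_apply]
        have h4 : (2 : ℝ) * ((1 - s) * (1 / 2) + s * t) - 1 = (2 * t - 1) * s := by ring
        rw [h2, h4]
        rw [fibreSMul_fibreSMul, coe_half]
        rw [show ((t : ℝ) - 1 / 2) * (2 * deriv τ ((2 * t - 1) * s)) =
          (2 * t - 1) * deriv τ ((2 * t - 1) * s) by ring])
      (by rw [hρ1]; exact hv) hk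
    rwa [hρ0, hρ1] at h1
  rw [kerPart_apply]
  rcases le_or_gt (t : ℝ) (1 / 2) with ht | ht
  · have h1 : c t = _ := (hc t).trans (if_pos ht)
    set t' := projIcc (0 : ℝ) 1 zero_le_one (τ (2 * t)) with ht'
    have hov : Q.p (C.vert (a₁ t')).proj = (Q.mapPath a₁ t').proj := rfl
    have hov' : Q.p (C.vert (a₁ t')).proj = (Q.mapPath c t).proj := by
      rw [mapPath_apply, h1]
      rfl
    rw [h1, vert_fibreSMul, transport_fibreSMul hC _ hov' (C.pr_vert (a₁ t')),
      hfirst ht hov (C.pr_vert (a₁ t'))]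
    exact (if_pos ht).symm
  · have h1 : c t = _ := (hc t).trans (if_neg (not_le_of_gt ht))
    set t' := projIcc (0 : ℝ) 1 zero_le_one (τ (2 * t - 1)) with ht'
    have hov : Q.p (C.vert (a₂ t')).proj = (Q.mapPath a₂ t').proj := rfl
    have hov' : Q.p (C.vert (a₂ t')).proj = (Q.mapPath c t).proj := by
      rw [mapPath_apply, h1]
      rfl
    have hhalf : projIcc (0 : ℝ) 1 zero_le_one (τ (2 * half)) = 1 := by
      rw [coe_half, show (2 : ℝ) * (1 / 2) = 1 by norm_num, hτ1]
      exact projIcc_right _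
    -- At the midpoint `τ(1) = 1`, so this is transport along all of `a₁`, the one that defines
    -- `transportKer`.
    have h2 := hfirst (t := half) le_rfl (v := kerPart hC a₂ t') (by
      rw [hhalf]
      exact kerPart_over hC h t') ((kerPart hC a₂).2 t')
    rw [hhalf] at h2
    rw [h1, vert_fibreSMul, transport_fibreSMul hC _ hov' (C.pr_vert (a₂ t')),
      ← transport_transport hC _ hov' (C.pr_vert (a₂ t')) 0 half,
      hsecond ht.le hov (C.pr_vert (a₂ t')), ← kerPart_apply hC, h2]
    exact (if_neg (not_le_of_gt ht)).symm

end Extension.Connection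

end Concatenation

end AlgebroidSplitting

theorem mainTheorem6
    {EX : Type*} [NormedAddCommGroup EX] [NormedSpace ℝ EX] [FiniteDimensional ℝ EX]
    {X : Type*} [TopologicalSpace X] [ChartedSpace EX X] [IsManifold 𝓘(ℝ, EX) ∞ X]
    [T2Space X] [SecondCountableTopology X]
    {FE : Type*} [NormedAddCommGroup FE] [NormedSpace ℝ FE] [FiniteDimensional ℝ FE]
    {VE : X → Type*} [TopologicalSpace (TotalSpace FE VE)] [∀ x, TopologicalSpace (VE x)]
    [∀ x, AddCommGroup (VE x)] [∀ x, Module ℝ (VE x)] [FiberBundle FE VE]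
    [VectorBundle ℝ FE VE] [ContMDiffVectorBundle ∞ FE VE 𝓘(ℝ, EX)]
    {EB : Type*} [NormedAddCommGroup EB] [NormedSpace ℝ EB] [FiniteDimensional ℝ EB]
    {B : Type*} [TopologicalSpace B] [ChartedSpace EB B] [IsManifold 𝓘(ℝ, EB) ∞ B]
    [T2Space B] [SecondCountableTopology B]
    {FB : Type*} [NormedAddCommGroup FB] [NormedSpace ℝ FB] [FiniteDimensional ℝ FB]
    {VB : B → Type*} [TopologicalSpace (TotalSpace FB VB)] [∀ b, TopologicalSpace (VB b)]
    [∀ b, AddCommGroup (VB b)] [∀ b, Module ℝ (VB b)] [FiberBundle FB VB]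
    [VectorBundle ℝ FB VB] [ContMDiffVectorBundle ∞ FB VB 𝓘(ℝ, EB)]
    (AE : LieAlgebroid EX FE VE) (AB : LieAlgebroid EB FB VB) (Q : Extension AE AB)
    (C : Q.Connection) (hC : C.IsComplete) :
    ∃ Ψ : AE.Path ≃ₜ Q.SplitPath,
      -- the homeomorphism is `a ↦ (a_B, a_K)`
      (∀ (a : AE.Path) (t : Interval),
        (Ψ a).base t = Q.map (a t) ∧
        (Ψ a).ker t = C.transport (fun s => Q.map (a s)) 0 t (C.vert (a t))) ∧
      -- concatenation of composable paths, made `C^1` by a cut-off reparametrization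
      (∀ τ : ℝ → ℝ, IsCutoff τ → ∀ a₁ a₂ : AE.Path, (a₁ 1).proj = (a₂ 0).proj →
        ∃ (c : AE.Path) (w : Q.KerPath),
          (∀ t, c t = concat τ a₂ a₁ t) ∧
          (∀ t, w t = C.transport (Ψ a₁).base 0 1 ((Ψ a₂).ker t)) ∧
          (w 0).proj = ((Ψ a₁).ker 1).proj ∧
          (∀ t, (Ψ c).base t = concat τ (Ψ a₂).base (Ψ a₁).base t) ∧
          (∀ t, (Ψ c).ker t = concat τ w (Ψ a₁).ker t)) ∧
      -- concatenation without reparametrization, whenever it is again an `A_E`-path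
      (∀ a₁ a₂ c : AE.Path, (a₁ 1).proj = (a₂ 0).proj → (∀ t, c t = concat id a₂ a₁ t) →
        ∃ w : Q.KerPath,
          (∀ t, w t = C.transport (Ψ a₁).base 0 1 ((Ψ a₂).ker t)) ∧
          (w 0).proj = ((Ψ a₁).ker 1).proj ∧
          (∀ t, (Ψ c).base t = concat id (Ψ a₂).base (Ψ a₁).base t) ∧
          (∀ t, (Ψ c).ker t = concat id w (Ψ a₁).ker t)) := by
  refine ⟨Extension.Connection.splitHomeomorph hC, fun a t => ⟨rfl, rfl⟩,
    fun τ hτ a₁ a₂ h => ?_, fun a₁ a₂ c h hc => ?_⟩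
  · obtain ⟨c, hc⟩ := LieAlgebroid.Path.exists_concat hτ a₁ a₂ h
    exact ⟨c, _, hc, fun t => rfl, Extension.Connection.proj_transportKer_zero hC h,
      Extension.Connection.map_concat hc,
      Extension.Connection.kerPart_concat hC (hτ.contDiff.of_le (by simp)) (hτ.eq_zero 0 le_rfl)
        (hτ.eq_one 1 le_rfl) (fun x _ => hτ.mem_Icc x) h hc⟩
  -- The computation of the kernel part only uses that `τ` is `C^1`, maps `[0, 1]` to itself and
  -- fixes the end points. Hence it also covers `τ = id`, where `c` is a path by assumption.
  · exact ⟨_, fun t => rfl, Extension.Connection.proj_transportKer_zero hC h,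
      Extension.Connection.map_concat hc,
      Extension.Connection.kerPart_concat hC contDiff_id rfl rfl (fun x hx => hx) h hc⟩
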